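/- **Conventions.** Fix $q\in(0,1)$. Write $(a;q)_n=\prod_{i=1}^n(1-aq^{i-1})$, $(a;q)_\infty=\prod_{i\ge1}(1-aq^{i-1})$ and $V(z_1,\dots,z_N)=\prod_{1\le i<j\le N}(z_i-z_j)$. A signature of length $N$ is $\lambda=(\lambda_1\ge\dots\ge\lambda_N)\in\mathbb Z^N$, and $s_\lambda(z_1,\dots,z_N)=\det[z_i^{\lambda_j+N-j}]_{i,j=1}^N/V(z_1,\dots,z_N)$ is its Schur (Laurent) polynomial, regarded as a function on $(\mathbb C^*)^N$ (extended by continuity to points with coinciding coordinates). Let $\mathbb X$ be the set of two-sided sequences of integers $\mathbf t=(\dots\le t_{-1}\le t_0\le t_1\le\cdots)$. For $m\in\mathbb Z$ let $(A_m\mathbf t)_n=t_{n+1-m}$. For $\mathbf t\in\mathbb X$ and $x\in D:=\mathbb C\setminus((-\infty,0]\cup\{q^n:n\in\mathbb Z\})$ put $$\Phi^{\mathbf t}(x;q)=-x(\ln q)^2\frac{(q;q)_\infty^2}{(qx;q)_\infty(q/x;q)_\infty}\left\{\int_{-\pi\mathbf i/\ln q}^{\pi\mathbf i/\ln q}\frac{dv}{2\pi\mathbf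 i}\int_{\mathcal L}\frac{du}{2\pi\mathbf i}\,\frac{x^u}{1-q^{v-u}}\prod_{i=1}^\infty\frac{1-q^{t_i+i-1-v}}{1-q^{t_i+i-1-u}}\prod_{j=1}^\infty\frac{1-q^{j+v-t_{1-j}}}{1-q^{j+u-t_{1-j}}}-\int_{-\pi\mathbf i/(2\ln q)}^{\pi\mathbf i/(2\ln q)}\frac{x^v}{\ln q}\frac{dv}{2\pi\mathbf i}\right\},$$ where the $v$-integrals are along the imaginary axis, $\mathcal L$ consists of the directed lines from $+\infty-\frac{\pi\mathbf i}{2\ln q}$ to $-\infty-\frac{\pi\mathbf i}{2\ln q}$ and from $-\infty+\frac{\pi\mathbf i}{2\ln q}$ to $+\infty+\frac{\pi\mathbf i}{2\ln q}$, and $x^u=e^{u\ln x}$ with the principal branch of $\ln$. **Theorem.** (0) For every $\mathbf t\in\mathbb X$ the double integral converges absolutely for each $x\in D$, and $\Phi^{\mathbf t}(\cdot\,;q)$ continues analytically from $D$ to $\mathbb C^*$; the continuation is denoted by the same symbol. For every $k\ge1$ the function $$\Phi^{\mathbf t}(x_1,\dots,x_k;q)=\frac{q^{k(k-1)(2k-1)/6}}{\prod_{i=1}^{k-1}(q;q)_i\;V(x_k,\dots,x_1)}\det_{1\le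 i,j\le k}\Bigl[\Phi^{A_j\mathbf t}(x_iq^{1-j};q)\prod_{1\le s\le k,\ s\ne j}(x_iq^{1-s}-1)\Bigr],$$ defined for pairwise distinct $x_1,\dots,x_k\in\mathbb C^*$, extends to a holomorphic function on $(\mathbb C^*)^k$, denoted by the same symbol. Let $b(1),b(2),\dots$ be nonnegative integers with $b(N)\to\infty$ and $N-b(N)\to\infty$, and let $\lambda(N)$ be a signature of length $N$ for every $N\ge1$. (1) If $\mathbf t\in\mathbb X$ and $\lim_{N\to\infty}\lambda(N)_{b(N)+1-i}=t_i$ for all $i\in\mathbb Z$, then for every $k\ge1$ $$\lim_{N\to\infty}\frac{s_{\lambda(N)}(1,q,\dots,q^{b(N)-1},q^{b(N)}x_1,\dots,q^{b(N)}x_k,q^{b(N)+k},\dots,q^{N-1})}{s_{\lambda(N)}(1,q,\dots,q^{N-1})}=\Phi^{\mathbf t}(x_1,\dots,x_k;q)\qquad(*)$$ uniformly on compact subsets of $(\mathbb C^*)^k$. (2) Conversely, if for every $k\ge1$ the limit on the left-hand side of $(*)$ exists uniformly on compact subsets of $(\mathbb C^*)^k$, then there is $\mathbf t\in\mathbb X$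 with $\lim_{N\to\infty}\lambda(N)_{b(N)+1-i}=t_i$ for all $i\in\mathbb Z$, and $(*)$ holds for every $k\ge1$, uniformly on compact subsets of $(\mathbb C^*)^k$. -/

import Mathlib

open Filter Topology MeasureTheory

namespace QSchur

noncomputable section

/-- The punctured torus `(ℂ*)^k`. -/
def torus (k : ℕ) : Set (Fin k → ℂ) := {x | ∀ i, x i ≠ 0}

/-- The dense open subset of `(ℂ*)^k` where the coordinates are pairwise distinct. -/
def regularTorus (k : ℕ) : Set (Fin k → ℂ) := {x | (∀ i, x i ≠ 0) ∧ Function.Injective x}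

/-- `V(z_1, …, z_N) = ∏_{i < j} (z_i - z_j)`. -/
def vandermonde {N : ℕ} (z : Fin N → ℂ) : ℂ := ∏ i, ∏ j ∈ Finset.Ioi i, (z i - z j)

/-- The (Laurent) Schur polynomial `det [z_i ^ (l_j + N - j)] / V(z_1, …, z_N)` as a function on
`(ℂ*)^N`. Where two coordinates coincide the quotient is `0 / 0`, and the value of the Laurent
polynomial is the limit of the quotient along points with pairwise distinct coordinates. The index
`j : Fin N` stands for the row number `j + 1`. -/
def schur {N : ℕ} (l : Fin N → ℤ) : (Fin N → ℂ) → ℂ :=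
  extendFrom (regularTorus N) fun z =>
    (Matrix.of fun i j : Fin N => z i ^ (l j + (N : ℤ) - ((j : ℤ) + 1))).det / vandermonde z

/-- The variables `(1, q, …, q^(b-1), q^b x_1, …, q^b x_k, q^(b+k), …, q^(N-1))`. -/
def insertedVars (q : ℝ) (N b : ℕ) {k : ℕ} (x : Fin k → ℂ) : Fin N → ℂ := fun i =>
  if h : b ≤ (i : ℕ) ∧ (i : ℕ) < b + k then
    (q : ℂ) ^ b * x ⟨(i : ℕ) - b, by omega⟩
  else (q : ℂ) ^ (i : ℕ)

/-- The normalized Schur polynomial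
`s_l(1, …, q^(b-1), q^b x_1, …, q^b x_k, q^(b+k), …, q^(N-1)) / s_l(1, q, …, q^(N-1))`. -/
def normSchur (q : ℝ) {N : ℕ} (l : Fin N → ℤ) (b : ℕ) {k : ℕ} (x : Fin k → ℂ) : ℂ :=
  schur l (insertedVars q N b x) / schur l fun i : Fin N => (q : ℂ) ^ (i : ℕ)

/-- The row `l_m` of a signature of length `N`, for `1 ≤ m ≤ N` (and `0` for the other `m`). -/
def row {N : ℕ} (l : Fin N → ℤ) (m : ℤ) : ℤ :=
  if h : 1 ≤ m ∧ m ≤ (N : ℤ) then l ⟨(m - 1).toNat, by omega⟩ else 0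

/-- `lim_N lam(N)_{b(N) + 1 - i} = t_i` for every integer `i`. If `b(N)` and `N - b(N)` tend to
infinity, then `1 ≤ b(N) + 1 - i ≤ N` for all large `N`. -/
def Stabilizes (b : ℕ → ℕ) (lam : ∀ N : ℕ, Fin N → ℤ) (t : ℤ → ℤ) : Prop :=
  ∀ i : ℤ, Tendsto (fun N : ℕ => row (lam N) ((b N : ℤ) + 1 - i)) atTop (𝓝 (t i))

/-- `(a; q)_n`. -/
def qPoch (a : ℂ) (q : ℝ) (n : ℕ) : ℂ := ∏ i ∈ Finset.range n, (1 - a * (q : ℂ) ^ i)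

/-- `(a; q)_∞`. -/
def qPochInf (a : ℂ) (q : ℝ) : ℂ := ∏' i : ℕ, (1 - a * (q : ℂ) ^ i)

/-- The integrand of the double integral,
`x^u / (1 - q^(v-u)) * ∏_{i ≥ 1} (1 - q^(t_i + i - 1 - v)) / (1 - q^(t_i + i - 1 - u))
 * ∏_{j ≥ 1} (1 - q^(j + v - t_{1-j})) / (1 - q^(j + u - t_{1-j}))`,
with the products indexed by `n = i - 1` and `n = j - 1`. -/
def integrand (q : ℝ) (t : ℤ → ℤ) (x v u : ℂ) : ℂ :=
  x ^ u / (1 - (q : ℂ) ^ (v - u))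
    * (∏' n : ℕ, (1 - (q : ℂ) ^ ((t ((n : ℤ) + 1) : ℂ) + (n : ℂ) - v))
        / (1 - (q : ℂ) ^ ((t ((n : ℤ) + 1) : ℂ) + (n : ℂ) - u)))
    * ∏' n : ℕ, (1 - (q : ℂ) ^ ((n : ℂ) + 1 + v - (t (-(n : ℤ)) : ℂ)))
        / (1 - (q : ℂ) ^ ((n : ℂ) + 1 + u - (t (-(n : ℤ)) : ℂ)))

/-- `∫_{a i}^{b i} f(v) dv / (2 π i)` along the segment of the imaginary axis. -/
def imagIntegral (a b : ℝ) (f : ℂ → ℂ) : ℂ :=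
  (∫ s in a..b, f ((s : ℂ) * Complex.I) * Complex.I) / (2 * (Real.pi : ℂ) * Complex.I)

/-- The point with real part `r` on the horizontal line with imaginary part `c`. -/
def linePt (c r : ℝ) : ℂ := (r : ℂ) + (c : ℂ) * Complex.I

/-- `∫_L f(u) du / (2 π i)`, where `L` consists of the line of imaginary part `-π / (2 ln q)`,
directed from `+∞` to `-∞`, and of the line of imaginary part `π / (2 ln q)`, directed from `-∞` to
`+∞`. -/
def lineIntegral (q : ℝ) (f : ℂ → ℂ) : ℂ :=
  ((∫ r : ℝ, f (linePt (Real.pi / (2 * Real.log q)) r))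
    - ∫ r : ℝ, f (linePt (-(Real.pi / (2 * Real.log q))) r)) / (2 * (Real.pi : ℂ) * Complex.I)

/-- The absolute convergence of the double integral, on each of the two lines of the
`u`-contour. -/
def IntegralConverges (q : ℝ) (t : ℤ → ℤ) (x : ℂ) : Prop :=
  ∀ c ∈ ({Real.pi / (2 * Real.log q), -(Real.pi / (2 * Real.log q))} : Set ℝ),
    Integrable (fun p : ℝ × ℝ => integrand q t x ((p.1 : ℂ) * Complex.I) (linePt c p.2))
      ((volume.restrict (Set.uIoc (-(Real.pi / Real.log q)) (Real.pi / Real.log q))).prod volume)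

/-- The contour integral formula for the limit function in one variable. Here `x ^ u` is
`exp (u * log x)` with the principal branch of the logarithm. -/
def phiFormula (q : ℝ) (t : ℤ → ℤ) (x : ℂ) : ℂ :=
  -(x * (Real.log q : ℂ) ^ 2 * qPochInf (q : ℂ) q ^ 2
      / (qPochInf ((q : ℂ) * x) q * qPochInf ((q : ℂ) / x) q))
    * (imagIntegral (-(Real.pi / Real.log q)) (Real.pi / Real.log q)
          (fun v => lineIntegral q fun u => integrand q t x v u)
        - imagIntegral (-(Real.pi / (2 * Real.log q))) (Real.pi / (2 * Real.log q))
          (fun v => x ^ v / (Real.log q : ℂ)))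

/-- `ℂ \ ((-∞, 0] ∪ {q^n : n ∈ ℤ})`. -/
def formulaDomain (q : ℝ) : Set ℂ :=
  {x | x ∈ Complex.slitPlane ∧ ∀ n : ℤ, x ≠ (q : ℂ) ^ n}

/-- The function `Φ^t(x; q)` on `ℂ*`: the continuation of the contour integral formula from its
dense domain. The analytic continuation is in particular the extension by continuity. -/
def Phi (q : ℝ) (t : ℤ → ℤ) : ℂ → ℂ := extendFrom (formulaDomain q) (phiFormula q t)

/-- The map `A_m`, `(A_m t)_n = t_{n + 1 - m}`. -/
def shift (m : ℤ) (t : ℤ → ℤ) : ℤ → ℤ := fun n => t (n + 1 - m)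

/-- The determinantal formula for the limit function in `k` variables, at a point with pairwise
distinct coordinates. The indices `i j s : Fin k` stand for `i + 1`, `j + 1`, `s + 1`. -/
def phiDet (q : ℝ) (t : ℤ → ℤ) {k : ℕ} (x : Fin k → ℂ) : ℂ :=
  (q : ℂ) ^ (k * (k - 1) * (2 * k - 1) / 6)
    / ((∏ i ∈ Finset.range k, qPoch (q : ℂ) q i) * vandermonde fun i : Fin k => x i.rev)
    * (Matrix.of fun i j : Fin k =>
        Phi q (shift ((j : ℤ) + 1) t) (x i * (q : ℂ) ^ (-(j : ℤ)))
          * ∏ s ∈ Finset.univ.erase j, (x i * (q : ℂ) ^ (-(s : ℤ)) - 1)).det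

/-- The function `Φ^t(x_1, …, x_k; q)` on `(ℂ*)^k`: the determinantal formula, extended to the
diagonals `x_i = x_j`. -/
def PhiMulti (q : ℝ) (t : ℤ → ℤ) (k : ℕ) : (Fin k → ℂ) → ℂ :=
  extendFrom (regularTorus k) (phiDet q t)

/-- Convergence, uniform on every compact subset of `(ℂ*)^k`, of the normalized Schur
polynomials. -/
def ConvergesTo (q : ℝ) (b : ℕ → ℕ) (lam : ∀ N : ℕ, Fin N → ℤ) (k : ℕ)
    (F : (Fin k → ℂ) → ℂ) : Prop :=
  ∀ K : Set (Fin k → ℂ), K ⊆ torus k → IsCompact K →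
    TendstoUniformlyOn (fun (N : ℕ) (x : Fin k → ℂ) => normSchur q (lam N) (b N) x) F atTop K

end

end QSchur

/-! Reduction to one variable. Changing `k` consecutive variables of the principal specialization
changes only `k` rows of the two alternants. Lagrange interpolation writes each new row as a
combination of the old ones, so the normalized Schur function is a quotient of two `k × k`
determinants (`normSchur_generic`). Comparison with the case `k = 1` shows that the determinantal
formula already holds for finite `N`, with the one-variable functions inserted at `b, b + 1, …, b +
k - 1` in place of the functions `Φ^{A_j t}` (`normSchur_eq_altQuot`). An alternant divided by the
Vandermonde product is a determinant of divided differences, hence of contour integrals; it is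
therefore holomorphic across the diagonals and inherits convergence from its entries
(`contConv_altExt`). Only `k = 1` is left.

One variable. The normalized function equals explicit q-Pochhammer factors times a Laurent sum `∑
y_m^b [y^b] ℓ_m(y) x^(a_m)`, where `ℓ_m` are the Lagrange basis polynomials at the nodes `y_m =
q^(a_m)` (`oneVar_eq_laurentSum`). A common shift of the exponents leaves the coefficients
unchanged, so one may take `a = t_i + i - 1`. The double integral with finite products equals this
sum up to a constant: the `u`-integral collects residues at the nodes, the `v`-integral over one
period extracts the coefficient of `y^b`, and the residue at `u = v` is what the single integral
removes (`contourDiff_integrandFin`). A majorant uniform in the truncation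
(`exists_integrandFin_bound`) gives the limit at every point that is not a power of `q`, and bounds
on circles. Cauchy's formula between circles that avoid the powers of `q` carries the convergence to
all of `ℂ*` and continues `Φ` at the same time (`exists_contConv_of_circles`). Every monotone `t` is
the limit of some signatures, so the assertions about `Φ` alone also follow.

Converse. The case `k = 1` suffices. The Laurent sums converge, hence so do their Laurent
coefficients. The coefficient at the `i`-th node has modulus at least `q^(wt i)` and, for `i ≥ 0`,
at most a constant times that (`le_norm_wcoef`, `norm_wcoef_le`). The lower bound and Cauchy's
estimates keep every node bounded. Each limit point of the nodes enumerates the support of the limit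
coefficients increasingly, so two limit points differ by a shift of the index; the two-sided bounds
exclude a nonzero shift (`IsLimitPoint.shift_nonpos`). Hence the rows converge, and the direct
statement identifies the limits. -/

namespace QSchur
-- Continuous convergence, and contour integrals depending on several points
noncomputable section

/-- Continuous convergence of the functions `F n` to `f` at the points of `U`. -/
def ContConv {X : Type*} [TopologicalSpace X] (F : ℕ → X → ℂ) (f : X → ℂ) (U : Set X) : Prop :=
  ∀ x ∈ U, Tendsto (fun p : ℕ × X => F p.1 p.2) (atTop ×ˢ 𝓝 x) (𝓝 (f x))

/-- Near `x` and for large `n`, both `F n y` and `f y` are close to `f x`; so the convergence is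
locally uniform, and compactness makes it uniform. This is the form in which all limits are finally
used. -/
theorem ContConv.tendstoUniformlyOn {X : Type*} [TopologicalSpace X] {F : ℕ → X → ℂ} {f : X → ℂ}
    {U K : Set X} (h : ContConv F f U) (hf : ContinuousOn f U) (hK : IsCompact K) (hKU : K ⊆ U) :
    TendstoUniformlyOn F f atTop K := by
  rw [← tendstoLocallyUniformlyOn_iff_tendstoUniformlyOn_of_compact hK,
    tendstoLocallyUniformlyOn_iff_forall_tendsto]
  intro x hx
  have h1 : Tendsto (fun y : ℕ × X => f y.2) (atTop ×ˢ 𝓝[K] x) (𝓝 (f x)) :=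
    ((hf x (hKU hx)).mono hKU).tendsto.comp tendsto_snd
  have h2 : Tendsto (fun y : ℕ × X => F y.1 y.2) (atTop ×ˢ 𝓝[K] x) (𝓝 (f x)) :=
    (h x (hKU hx)).mono_left (Filter.prod_mono le_rfl nhdsWithin_le_nhds)
  have h3 := h1.prodMk_nhds h2
  exact h3.mono_right (nhds_prod_eq.trans_le (nhds_prod_eq (x := f x) (y := f x) ▸ nhds_le_uniformity _))

theorem ContConv.tendsto {X : Type*} [TopologicalSpace X] {F : ℕ → X → ℂ} {f : X → ℂ} {U : Set X}
    (h : ContConv F f U) {x : X} (hx : x ∈ U) : Tendsto (fun n => F n x) atTop (𝓝 (f x)) :=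
  (h x hx).comp (tendsto_id.prodMk (tendsto_const_nhds (x := x)))

theorem norm_sub_ge_of_sphere {ρ : ℝ} {z w : ℂ} (hz : ‖z‖ = ρ) : |‖w‖ - ρ| ≤ ‖z - w‖ := by
  rw [← hz, norm_sub_rev]; exact abs_norm_sub_norm_le _ _

variable {k : ℕ}

/-- The contour integral of `g(z) / ∏ (z - x_s)` over the circle of radius `ρ`. -/
def ddCirc (ρ : ℝ) (g : ℂ → ℂ) (S : Finset (Fin k)) (x : Fin k → ℂ) : ℂ :=
  ∮ z in C(0, ρ), g z * ∏ s ∈ S, (z - x s)⁻¹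

theorem circleMap_zero_norm {ρ : ℝ} (hρ : 0 < ρ) (θ : ℝ) : ‖circleMap 0 ρ θ‖ = ρ := by
  simp [abs_of_pos hρ]

theorem continuous_ddKernel {ρ : ℝ} (hρ : 0 < ρ) {g : ℂ → ℂ} (hg : ContinuousOn g (Metric.sphere 0 ρ))
    (S : Finset (Fin k)) {x : Fin k → ℂ} (hx : ∀ s, ‖x s‖ ≠ ρ) :
    Continuous fun θ : ℝ => deriv (circleMap 0 ρ) θ •
      (g (circleMap 0 ρ θ) * ∏ s ∈ S, (circleMap 0 ρ θ - x s)⁻¹) := by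
  have h1 : Continuous fun θ : ℝ => g (circleMap 0 ρ θ) :=
    hg.comp_continuous (continuous_circleMap 0 ρ) fun θ => by simp [abs_of_pos hρ]
  have h2 : ∀ s (θ : ℝ), circleMap 0 ρ θ - x s ≠ 0 := by
    intro s θ h
    apply hx s
    rw [← sub_eq_zero.1 h, circleMap_zero_norm hρ]
  have h3 : ∀ s, Continuous fun θ : ℝ => (circleMap 0 ρ θ - x s)⁻¹ := fun s =>
    ((continuous_circleMap 0 ρ).sub continuous_const).inv₀ (h2 s)
  simp only [deriv_circleMap, smul_eq_mul]
  exact ((continuous_circleMap 0 ρ).mul continuous_const).mul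
    (h1.mul (continuous_finsetProd _ fun s _ => h3 s))

/-- The total derivative in `x` of `∏ (z - x_s)⁻¹`. -/
def ddKernelDeriv (S : Finset (Fin k)) (z : ℂ) (x : Fin k → ℂ) : (Fin k → ℂ) →L[ℂ] ℂ :=
  ∑ s ∈ S, (∏ j ∈ S.erase s, (z - x j)⁻¹) •
    (((z - x s) ^ 2)⁻¹ • (ContinuousLinearMap.proj (R := ℂ) (φ := fun _ : Fin k => ℂ) s))

theorem hasFDerivAt_ddKernel (S : Finset (Fin k)) {z : ℂ} {x : Fin k → ℂ} (hx : ∀ s, z - x s ≠ 0) :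
    HasFDerivAt (fun x : Fin k → ℂ => ∏ s ∈ S, (z - x s)⁻¹) (ddKernelDeriv S z x) x := by
  refine HasFDerivAt.finsetProd fun s _ => ?_
  have h1 : HasFDerivAt (fun y : Fin k → ℂ => z - y s)
      (-(ContinuousLinearMap.proj (R := ℂ) (φ := fun _ : Fin k => ℂ) s)) x :=
    (ContinuousLinearMap.proj (R := ℂ) (φ := fun _ : Fin k => ℂ) s).hasFDerivAt.const_sub z
  have h2 := (hasDerivAt_inv (hx s)).comp_hasFDerivAt x h1
  rwa [neg_smul_neg] at h2

theorem norm_ddKernelDeriv_le (S : Finset (Fin k)) {z : ℂ} {x : Fin k → ℂ} {δ : ℝ} (hδ : 0 < δ)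
    (hx : ∀ s, δ ≤ ‖z - x s‖) :
    ‖ddKernelDeriv S z x‖ ≤ ∑ s ∈ S, (∏ _j ∈ S.erase s, δ⁻¹) * ((δ ^ 2)⁻¹ * 1) := by
  refine (norm_sum_le _ _).trans (Finset.sum_le_sum fun s _ => ?_)
  simp only [norm_smul, norm_prod, norm_inv, norm_pow]
  have h1 : ‖(ContinuousLinearMap.proj (R := ℂ) (φ := fun _ : Fin k => ℂ) s)‖ ≤ 1 :=
    ContinuousLinearMap.opNorm_le_bound _ zero_le_one fun v => by
      simpa using norm_le_pi_norm v s
  gcongr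
  all_goals exact hx _

/-- Provides the neighbourhood with a uniform distance to the circle that dominates the kernels and
their derivatives. -/
theorem exists_open_away {ρ : ℝ} {x : Fin k → ℂ} (hx : ∀ s, ‖x s‖ ≠ ρ) :
    ∃ δ > 0, {y : Fin k → ℂ | ∀ s, δ < |‖y s‖ - ρ|} ∈ 𝓝 x := by
  have h : ∃ δ > 0, ∀ s, δ < |‖x s‖ - ρ| := by
    obtain ⟨δ, h1, h2⟩ : ∃ δ : ℝ, 0 < δ ∧ ∀ s ∈ (Finset.univ : Finset (Fin k)), δ < |‖x s‖ - ρ| := by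
      induction (Finset.univ : Finset (Fin k)) using Finset.induction_on with
      | empty => exact ⟨1, one_pos, by simp⟩
      | insert a S _ ih =>
        obtain ⟨δ, h1, h2⟩ := ih
        have h3 : 0 < |‖x a‖ - ρ| := abs_pos.2 (sub_ne_zero.2 (hx a))
        refine ⟨min δ (|‖x a‖ - ρ| / 2), by positivity, fun s hs => ?_⟩
        rcases Finset.mem_insert.1 hs with rfl | hs
        · exact (min_le_right _ _).trans_lt (by linarith)
        · exact (min_le_left _ _).trans_lt (h2 s hs)
    exact ⟨δ, h1, fun s => h2 s (Finset.mem_univ s)⟩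
  obtain ⟨δ, h1, h2⟩ := h
  refine ⟨δ, h1, ?_⟩
  rw [Set.ofPred_forall]
  refine (isOpen_iInter_of_finite fun s => ?_).mem_nhds (Set.mem_iInter.2 h2)
  exact isOpen_lt continuous_const (by fun_prop)

/-- Differentiation under the integral sign. The points `x_s` may coincide, which is why divided
differences written in this way are holomorphic across the diagonals. -/
theorem differentiableAt_ddCirc {ρ : ℝ} (hρ : 0 < ρ) {g : ℂ → ℂ}
    (hg : ContinuousOn g (Metric.sphere 0 ρ)) (S : Finset (Fin k)) {x : Fin k → ℂ}
    (hx : ∀ s, ‖x s‖ ≠ ρ) : DifferentiableAt ℂ (ddCirc ρ g S) x := by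
  obtain ⟨δ, hδ, hU⟩ := exists_open_away hx
  have hgc : Continuous fun θ : ℝ => g (circleMap 0 ρ θ) :=
    hg.comp_continuous (continuous_circleMap 0 ρ) fun θ => by simp [abs_of_pos hρ]
  have hne : ∀ y : Fin k → ℂ, (∀ s, δ < |‖y s‖ - ρ|) → ∀ s, ‖y s‖ ≠ ρ := by
    intro y hy s h
    have := hy s
    rw [h, sub_self, abs_zero] at this
    linarith
  have hcd : ∀ y : Fin k → ℂ, (∀ s, δ < |‖y s‖ - ρ|) → ∀ θ : ℝ, ∀ s,
      δ ≤ ‖circleMap 0 ρ θ - y s‖ := fun y hy θ s =>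
    (hy s).le.trans (norm_sub_ge_of_sphere (circleMap_zero_norm hρ θ))
  have hcd' : ∀ y : Fin k → ℂ, (∀ s, δ < |‖y s‖ - ρ|) → ∀ θ : ℝ, ∀ s,
      circleMap 0 ρ θ - y s ≠ 0 := fun y hy θ s => norm_pos_iff.1 (hδ.trans_le (hcd y hy θ s))
  have hxU : ∀ s, δ < |‖x s‖ - ρ| := mem_of_mem_nhds hU
  have key := intervalIntegral.hasFDerivAt_integral_of_dominated_of_fderiv_le (𝕜 := ℂ) (μ := volume)
    (a := 0) (b := 2 * Real.pi) (s := {y : Fin k → ℂ | ∀ s, δ < |‖y s‖ - ρ|}) (x₀ := x)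
    (bound := fun θ => ρ * ‖g (circleMap 0 ρ θ)‖ *
      ∑ s ∈ S, (∏ _j ∈ S.erase s, δ⁻¹) * ((δ ^ 2)⁻¹ * 1))
    (F := fun y θ => deriv (circleMap 0 ρ) θ •
      (g (circleMap 0 ρ θ) * ∏ s ∈ S, (circleMap 0 ρ θ - y s)⁻¹))
    (F' := fun y θ => (deriv (circleMap 0 ρ) θ * g (circleMap 0 ρ θ)) •
      ddKernelDeriv S (circleMap 0 ρ θ) y) hU ?_ ?_ ?_ ?_ ?_ ?_
  · exact key.differentiableAt
  · filter_upwards [hU] with y hy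
    exact (continuous_ddKernel hρ hg S (hne y hy)).aestronglyMeasurable
  · exact (continuous_ddKernel hρ hg S hx).intervalIntegrable _ _
  · have hinv : ∀ s, Continuous fun θ : ℝ => (circleMap 0 ρ θ - x s)⁻¹ := fun s =>
      ((continuous_circleMap 0 ρ).sub continuous_const).inv₀ fun θ => hcd' x hxU θ s
    have hinv2 : ∀ s, Continuous fun θ : ℝ => ((circleMap 0 ρ θ - x s) ^ 2)⁻¹ := fun s =>
      (((continuous_circleMap 0 ρ).sub continuous_const).pow 2).inv₀ fun θ =>
        pow_ne_zero 2 (hcd' x hxU θ s)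
    have : Continuous fun θ : ℝ => (deriv (circleMap 0 ρ) θ * g (circleMap 0 ρ θ)) •
        ddKernelDeriv S (circleMap 0 ρ θ) x := by
      simp only [deriv_circleMap, ddKernelDeriv]
      refine (((continuous_circleMap 0 ρ).mul continuous_const).mul hgc).smul
        (continuous_finsetSum _ fun s _ => ?_)
      exact (continuous_finsetProd _ fun j _ => hinv j).smul ((hinv2 s).smul continuous_const)
    exact this.aestronglyMeasurable
  · refine Eventually.of_forall fun θ _ y hy => ?_
    rw [norm_smul, norm_mul, deriv_circleMap, norm_mul, circleMap_zero_norm hρ, Complex.norm_I,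
      mul_one]
    gcongr
    exact norm_ddKernelDeriv_le S hδ (hcd y hy θ)
  · exact ((continuous_const.mul hgc.norm).mul continuous_const).intervalIntegrable _ _
  · refine Eventually.of_forall fun θ _ y hy => ?_
    have := (hasFDerivAt_ddKernel S (hcd' y hy θ)).const_smul
      (deriv (circleMap 0 ρ) θ * g (circleMap 0 ρ θ))
    simp only [smul_eq_mul, ← mul_assoc] at this ⊢
    exact this

/-- Dominated convergence with the function and the points moving together. Pointwise limits and one
bound on the circle are enough; no uniform convergence is assumed. -/
theorem tendsto_ddCirc {ρ : ℝ} (hρ : 0 < ρ) {G : ℕ → ℂ → ℂ} {g : ℂ → ℂ}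
    (hG : ∀ᶠ n in atTop, ContinuousOn (G n) (Metric.sphere 0 ρ))
    (hb : ∃ C, ∀ᶠ n in atTop, ∀ z ∈ Metric.sphere (0 : ℂ) ρ, ‖G n z‖ ≤ C)
    (hlim : ∀ z ∈ Metric.sphere (0 : ℂ) ρ, Tendsto (fun n => G n z) atTop (𝓝 (g z)))
    (S : Finset (Fin k)) {x : Fin k → ℂ} (hx : ∀ s, ‖x s‖ ≠ ρ) :
    Tendsto (fun p : ℕ × (Fin k → ℂ) => ddCirc ρ (G p.1) S p.2) (atTop ×ˢ 𝓝 x)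
      (𝓝 (ddCirc ρ g S x)) := by
  obtain ⟨C, hC⟩ := hb
  obtain ⟨δ, hδ, hU⟩ := exists_open_away hx
  have hsph : ∀ θ, circleMap 0 ρ θ ∈ Metric.sphere (0 : ℂ) ρ := fun θ => by simp [abs_of_pos hρ]
  have hne : ∀ y : Fin k → ℂ, (∀ s, δ < |‖y s‖ - ρ|) → ∀ s, ‖y s‖ ≠ ρ := by
    intro y hy s h
    have := hy s
    rw [h, sub_self, abs_zero] at this
    linarith
  have hcd : ∀ y : Fin k → ℂ, (∀ s, δ < |‖y s‖ - ρ|) → ∀ θ : ℝ, ∀ s,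
      δ ≤ ‖circleMap 0 ρ θ - y s‖ := fun y hy θ s =>
    (hy s).le.trans (norm_sub_ge_of_sphere (circleMap_zero_norm hρ θ))
  have hxU : ∀ s, δ < |‖x s‖ - ρ| := mem_of_mem_nhds hU
  unfold ddCirc circleIntegral
  refine intervalIntegral.tendsto_integral_filter_of_dominated_convergence
    (fun _ => ρ * (C * ∏ _s ∈ S, δ⁻¹)) ?_ ?_ (by simp) ?_
  · filter_upwards [hG.prod_mk hU] with p hp
    exact (continuous_ddKernel hρ hp.1 S (hne _ hp.2)).aestronglyMeasurable
  · filter_upwards [hC.prod_mk hU] with p hp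
    refine Eventually.of_forall fun θ _ => ?_
    rw [norm_smul, norm_mul, deriv_circleMap, norm_mul, circleMap_zero_norm hρ, Complex.norm_I,
      mul_one, norm_prod]
    simp only [norm_inv]
    have hC0 : 0 ≤ C := (norm_nonneg _).trans (hp.1 _ (hsph θ))
    gcongr
    · exact hp.1 _ (hsph θ)
    · exact hcd _ hp.2 θ _
  · refine Eventually.of_forall fun θ _ => Tendsto.const_smul (Tendsto.mul ?_ ?_) _
    · exact (hlim _ (hsph θ)).comp tendsto_fst
    · refine tendsto_finsetProd _ fun s _ => Tendsto.inv₀ ?_ ?_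
      · exact tendsto_const_nhds.sub (((continuous_apply s).tendsto x).comp tendsto_snd)
      · exact norm_pos_iff.1 (hδ.trans_le (hcd x hxU θ s))

end
end QSchur

/-! ### Divided differences and alternant quotients -/

namespace QSchur
noncomputable section
variable {k : ℕ}

theorem circleIntegral_inv_sub_eq_zero {r : ℝ} (hr : 0 < r) {w : ℂ} (hw : r < ‖w‖) :
    ∮ z in C(0, r), (z - w)⁻¹ = 0 := by
  have hne : ∀ z ∈ Metric.closedBall (0 : ℂ) r, z - w ≠ 0 := by
    intro z hz h
    rw [mem_closedBall_zero_iff, sub_eq_zero.1 h] at hz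
    linarith
  refine Complex.circleIntegral_eq_zero_of_differentiable_on_off_countable hr.le
    Set.countable_empty ?_ ?_
  · exact (continuousOn_id.sub continuousOn_const).inv₀ hne
  · intro z hz
    exact (differentiableAt_id.sub_const w).inv (hne z (Metric.ball_subset_closedBall hz.1))

/-- The slope `(g z - g w) / (z - w)` extends holomorphically over `w`, so its integrals over both
circles agree. Splitting it leaves `g w` times the integral of `1 / (z - w)`, which is `2πi` on the
outer circle and `0` on the inner one. -/
theorem cauchy_annulus {r R : ℝ} (hr : 0 < r) {g : ℂ → ℂ} (hg : DifferentiableOn ℂ g {0}ᶜ) {w : ℂ}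
    (h1 : r < ‖w‖) (h2 : ‖w‖ < R) :
    (∮ z in C(0, R), g z * (z - w)⁻¹) - (∮ z in C(0, r), g z * (z - w)⁻¹)
      = 2 * Real.pi * Complex.I * g w := by
  have hw0 : w ≠ 0 := norm_pos_iff.1 (hr.trans h1)
  have hR : 0 < R := hr.trans (h1.trans h2)
  have hopen : IsOpen ({0}ᶜ : Set ℂ) := isOpen_compl_singleton
  have hsl : DifferentiableOn ℂ (dslope g w) {0}ᶜ :=
    (Complex.differentiableOn_dslope (hopen.mem_nhds hw0)).2 hg
  have hsub : ∀ z ∈ Metric.closedBall (0 : ℂ) R \ Metric.ball 0 r, z ∈ ({0}ᶜ : Set ℂ) := by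
    rintro z ⟨-, hz⟩ rfl
    exact hz (Metric.mem_ball_self hr)
  have e1 := Complex.circleIntegral_eq_of_differentiable_on_annulus_off_countable hr
    (h1.trans h2).le Set.countable_empty (hsl.continuousOn.mono hsub)
    (fun z hz => hsl.differentiableAt (hopen.mem_nhds (hsub z
      ⟨Metric.ball_subset_closedBall hz.1.1, fun h => hz.1.2 (Metric.ball_subset_closedBall h)⟩)))
  have hint : ∀ ρ : ℝ, 0 < ρ → ‖w‖ ≠ ρ → (∮ z in C(0, ρ), dslope g w z)
      = (∮ z in C(0, ρ), g z * (z - w)⁻¹) - g w * ∮ z in C(0, ρ), (z - w)⁻¹ := by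
    intro ρ hρ hwρ
    have hne : ∀ z ∈ Metric.sphere (0 : ℂ) ρ, z - w ≠ 0 := by
      intro z hz h
      rw [mem_sphere_zero_iff_norm, sub_eq_zero.1 h] at hz
      exact hwρ hz
    have hci : ContinuousOn (fun z : ℂ => (z - w)⁻¹) (Metric.sphere 0 ρ) :=
      (continuousOn_id.sub continuousOn_const).inv₀ hne
    have hcg : ContinuousOn g (Metric.sphere 0 ρ) := hg.continuousOn.mono fun z hz h => by
      rw [h, mem_sphere_zero_iff_norm, norm_zero] at hz
      exact hρ.ne hz
    have i1 : CircleIntegrable (fun z => g z * (z - w)⁻¹) 0 ρ :=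
      (hcg.mul hci).circleIntegrable hρ.le
    have i2 : CircleIntegrable (fun z => g w * (z - w)⁻¹) 0 ρ :=
      (continuousOn_const.mul hci).circleIntegrable hρ.le
    rw [← circleIntegral.integral_const_mul, ← circleIntegral.integral_sub i1 i2]
    refine circleIntegral.integral_congr hρ.le fun z hz => ?_
    rw [dslope_of_ne _ (sub_ne_zero.1 (hne z hz)), slope_def_field]
    ring
  rw [hint R hR h2.ne, hint r hr h1.ne', circleIntegral_inv_sub_eq_zero hr h1,
    circleIntegral.integral_sub_inv_of_mem_ball (by simpa using h2)] at e1
  linear_combination e1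

/-- The divided difference of `g` at the points `x_s`, `s ∈ S`, as a difference of two contour
integrals. -/
def ddInt (r R : ℝ) (g : ℂ → ℂ) (S : Finset (Fin k)) (x : Fin k → ℂ) : ℂ :=
  (2 * Real.pi * Complex.I)⁻¹ * (ddCirc R g S x - ddCirc r g S x)

/-- Partial fractions: divide the identity "the Lagrange basis polynomials sum to `1`" by the nodal
polynomial. -/
theorem prod_inv_sub_eq_sum {S : Finset (Fin k)} (hS : S.Nonempty) {x : Fin k → ℂ}
    (hx : Function.Injective x) {z : ℂ} (hz : ∀ s, z - x s ≠ 0) :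
    ∏ s ∈ S, (z - x s)⁻¹ = ∑ s ∈ S, (∏ j ∈ S.erase s, (x s - x j)⁻¹) * (z - x s)⁻¹ := by
  have h := congrArg (Polynomial.eval z) (Lagrange.sum_basis (s := S) hx.injOn hS)
  rw [Polynomial.eval_finsetSum, Polynomial.eval_one] at h
  rw [← mul_one (∏ s ∈ S, _), ← h, Finset.mul_sum]
  refine Finset.sum_congr rfl fun s hs => ?_
  rw [Lagrange.basis, Polynomial.eval_prod, ← Finset.mul_prod_erase S _ hs, mul_assoc,
    ← Finset.prod_mul_distrib, mul_comm]
  congr 1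
  refine Finset.prod_congr rfl fun j _ => ?_
  simp only [Lagrange.basisDivisor, Polynomial.eval_mul, Polynomial.eval_C, Polynomial.eval_sub,
    Polynomial.eval_X]
  field_simp [hz j]

theorem ddInt_eq {r R : ℝ} (hr : 0 < r) {g : ℂ → ℂ} (hg : DifferentiableOn ℂ g {0}ᶜ)
    {S : Finset (Fin k)} (hS : S.Nonempty) {x : Fin k → ℂ} (hx : Function.Injective x)
    (h1 : ∀ s, r < ‖x s‖) (h2 : ∀ s, ‖x s‖ < R) :
    ddInt r R g S x = ∑ s ∈ S, (∏ j ∈ S.erase s, (x s - x j)⁻¹) * g (x s) := by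
  have hR : 0 < R := hr.trans ((h1 hS.choose).trans (h2 hS.choose))
  have hc : ∀ ρ : ℝ, 0 < ρ → (∀ s, ‖x s‖ ≠ ρ) → ddCirc ρ g S x =
      ∑ s ∈ S, (∏ j ∈ S.erase s, (x s - x j)⁻¹) * ∮ z in C(0, ρ), g z * (z - x s)⁻¹ := by
    intro ρ hρ hxρ
    have hne : ∀ s, ∀ z ∈ Metric.sphere (0 : ℂ) ρ, z - x s ≠ 0 := by
      intro s z hz h
      rw [mem_sphere_zero_iff_norm, sub_eq_zero.1 h] at hz
      exact hxρ s hz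
    have hcg : ContinuousOn g (Metric.sphere 0 ρ) := hg.continuousOn.mono fun z hz h => by
      rw [h, mem_sphere_zero_iff_norm, norm_zero] at hz
      exact hρ.ne hz
    simp only [← circleIntegral.integral_const_mul]
    have hi : ∀ s ∈ S, CircleIntegrable
        (fun z => (∏ j ∈ S.erase s, (x s - x j)⁻¹) * (g z * (z - x s)⁻¹)) 0 ρ := fun s _ =>
      (continuousOn_const.mul (hcg.mul
        ((continuousOn_id.sub continuousOn_const).inv₀ (hne s)))).circleIntegrable hρ.le
    rw [← circleIntegral.integral_fun_sum hi]
    refine circleIntegral.integral_congr hρ.le fun z hz => ?_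
    rw [prod_inv_sub_eq_sum hS hx fun s => hne s z hz, Finset.mul_sum]
    exact Finset.sum_congr rfl fun s _ => by simp; ring
  unfold ddInt
  rw [hc R hR fun s => (h2 s).ne, hc r hr fun s => (h1 s).ne', ← Finset.sum_sub_distrib,
    Finset.mul_sum]
  refine Finset.sum_congr rfl fun s _ => ?_
  rw [← mul_sub, cauchy_annulus hr hg (h1 s) (h2 s)]
  have : (2 * Real.pi * Complex.I : ℂ) ≠ 0 := Complex.two_pi_I_ne_zero
  field_simp

/-- `∏_{j < i} (x_i - x_j)`. -/
def vdm (x : Fin k → ℂ) : ℂ := ∏ i, ∏ j ∈ Finset.Iio i, (x i - x j)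

theorem vandermonde_rev (x : Fin k → ℂ) : vandermonde (fun i => x i.rev) = vdm x := by
  unfold vandermonde vdm
  refine Fintype.prod_equiv Fin.revPerm _ _ fun i => ?_
  refine Finset.prod_nbij' Fin.rev Fin.rev ?_ ?_ ?_ ?_ ?_ <;> simp [Fin.lt_rev_iff]

theorem vandermonde_eq_vdm (x : Fin k → ℂ) :
    vandermonde x = (∏ i : Fin k, ∏ _j ∈ Finset.Iio i, (-1 : ℂ)) * vdm x := by
  unfold vandermonde vdm
  rw [Finset.prod_comm' (t' := Finset.univ) (s' := fun j => Finset.Iio j) (by simp)]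
  simp only [← Finset.prod_mul_distrib]
  exact Finset.prod_congr rfl fun _ _ => Finset.prod_congr rfl fun _ _ => by ring

theorem vdm_ne_zero {x : Fin k → ℂ} (hx : Function.Injective x) : vdm x ≠ 0 :=
  Finset.prod_ne_zero_iff.2 fun _ _ => Finset.prod_ne_zero_iff.2 fun _ hj =>
    sub_ne_zero.2 fun h => (Finset.mem_Iio.1 hj).ne' (hx h)

/-- The alternant quotient `det [G_j(x_i)] / ∏_{j < i} (x_i - x_j)`. -/
def altQuot (G : Fin k → ℂ → ℂ) (x : Fin k → ℂ) : ℂ :=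
  (Matrix.of fun i j => G j (x i)).det / vdm x

/-- The matrix of divided differences. -/
def ddMat (r R : ℝ) (G : Fin k → ℂ → ℂ) (x : Fin k → ℂ) : Matrix (Fin k) (Fin k) ℂ :=
  Matrix.of fun i j => ddInt r R (G j) (Finset.Iic i) x

/-- Row `i` of the divided-difference matrix uses only the points `x_0, …, x_i`. It therefore arises
from the alternant through a lower triangular factor, and the diagonal of that factor multiplies to
the inverse Vandermonde product. -/
theorem altQuot_eq_det_ddMat {r R : ℝ} (hr : 0 < r) {G : Fin k → ℂ → ℂ}
    (hG : ∀ j, DifferentiableOn ℂ (G j) {0}ᶜ) {x : Fin k → ℂ} (hx : Function.Injective x)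
    (h1 : ∀ s, r < ‖x s‖) (h2 : ∀ s, ‖x s‖ < R) : altQuot G x = (ddMat r R G x).det := by
  set T : Matrix (Fin k) (Fin k) ℂ := Matrix.of fun i s =>
    if s ≤ i then ∏ j ∈ (Finset.Iic i).erase s, (x s - x j)⁻¹ else 0 with hT
  have h3 : ddMat r R G x = T * Matrix.of fun i j => G j (x i) := by
    ext i j
    simp only [ddMat, Matrix.of_apply, Matrix.mul_apply, hT]
    rw [ddInt_eq hr (hG j) ⟨i, by simp⟩ hx h1 h2]
    simp only [ite_mul, zero_mul]
    rw [← Finset.sum_filter]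
    congr 1
    ext s
    simp
  have h4 : T.det = (vdm x)⁻¹ := by
    rw [Matrix.det_of_isLowerTriangular T (by
      intro i j hij
      simp only [hT, Matrix.of_apply]
      exact if_neg (not_le.2 hij))]
    simp only [hT, Matrix.of_apply, le_refl, if_true, vdm, ← Finset.prod_inv_distrib]
    refine Finset.prod_congr rfl fun i _ => ?_
    congr 1
    ext s
    simp [lt_iff_le_and_ne, and_comm]
  rw [h3, Matrix.det_mul, h4, altQuot, div_eq_inv_mul]

theorem isOpen_torus : IsOpen (torus k) := by
  unfold torus
  rw [Set.ofPred_forall]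
  exact isOpen_iInter_of_finite fun i => isOpen_ne_fun (continuous_apply i) continuous_const

/-- The open poly-annulus. -/
def polyAnn (k : ℕ) (r R : ℝ) : Set (Fin k → ℂ) := {x | ∀ s, r < ‖x s‖ ∧ ‖x s‖ < R}

theorem isOpen_polyAnn (r R : ℝ) : IsOpen (polyAnn k r R) := by
  unfold polyAnn
  rw [Set.ofPred_forall]
  refine isOpen_iInter_of_finite fun i => ?_
  have h : Continuous fun x : Fin k → ℂ => ‖x i‖ := by fun_prop
  exact (isOpen_lt continuous_const h).inter (isOpen_lt h continuous_const)

theorem exists_polyAnn {x : Fin k → ℂ} (hx : x ∈ torus k) : ∃ r R, 0 < r ∧ x ∈ polyAnn k r R := by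
  have h : ∃ r > 0, ∀ s, r < ‖x s‖ := by
    obtain ⟨δ, h1, h2⟩ := exists_open_away (ρ := 0) (x := x) fun s => norm_ne_zero_iff.2 (hx s)
    have h3 : ∀ s, δ < |‖x s‖ - 0| := mem_of_mem_nhds h2
    exact ⟨δ, h1, fun s => by simpa using h3 s⟩
  obtain ⟨r, hr, h⟩ := h
  exact ⟨r, ‖x‖ + 1, hr, fun s => ⟨h s, (norm_le_pi_norm x s).trans_lt (lt_add_one _)⟩⟩

/-- A finite set of lines through `x` shows that the complement of a set meeting every such line in
a countable set is dense. -/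
theorem dense_of_curve {X : Type*} [TopologicalSpace X] {A : Set X} {x : X} (γ : ℝ → X)
    (h0 : γ 0 = x) (hc : ContinuousAt γ 0) (hbad : {t : ℝ | γ t ∉ A}.Countable) : x ∈ closure A := by
  have h1 : Dense {t : ℝ | γ t ∉ A}ᶜ := hbad.dense_compl ℝ
  have h2 : (0 : ℝ) ∈ closure {t : ℝ | γ t ∉ A}ᶜ := h1 0
  rw [← h0]
  refine closure_mono ?_ (hc.continuousWithinAt.mem_closure_image h2)
  rintro _ ⟨t, ht, rfl⟩
  simpa using ht

/-- The curve `x_i + t 2^i` through a point of the torus. -/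
def genericCurve (x : Fin k → ℂ) (t : ℝ) : Fin k → ℂ := fun i => x i + t * 2 ^ (i : ℕ)

/-- The slopes `2^i` are distinct, so two given coordinates agree for at most one parameter, and
each coordinate meets a countable set for countably many parameters. -/
theorem genericCurve_countable (x : Fin k → ℂ) {C : Set ℂ} (hC : C.Countable) :
    {t : ℝ | ¬ ((∀ i, genericCurve x t i ∉ C) ∧ Function.Injective (genericCurve x t))}.Countable := by
  have h1 : ∀ i : Fin k, {t : ℝ | genericCurve x t i ∈ C}.Countable := fun i => by
    refine hC.preimage_of_injOn (f := fun t : ℝ => genericCurve x t i) ?_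
    intro s _ t _ hst
    simpa [genericCurve] using hst
  have h2 : ∀ i j : Fin k, i ≠ j → {t : ℝ | genericCurve x t i = genericCurve x t j}.Countable := by
    intro i j hij
    refine Set.Subsingleton.countable fun s hs t ht => ?_
    have hs' : x i + s * 2 ^ (i : ℕ) = x j + s * 2 ^ (j : ℕ) := hs
    have ht' : x i + t * 2 ^ (i : ℕ) = x j + t * 2 ^ (j : ℕ) := ht
    have h3 : ((s : ℂ) - t) * ((2 : ℂ) ^ (i : ℕ) - 2 ^ (j : ℕ)) = 0 := by
      linear_combination hs' - ht'
    rcases mul_eq_zero.1 h3 with h | h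
    · exact_mod_cast sub_eq_zero.1 h
    · exfalso
      apply hij
      have h4 : (2 : ℕ) ^ (i : ℕ) = 2 ^ (j : ℕ) := by exact_mod_cast sub_eq_zero.1 h
      exact Fin.ext (Nat.pow_right_injective le_rfl h4)
  refine ((Set.countable_iUnion h1).union (Set.countable_iUnion fun i => Set.countable_iUnion
    fun j => Set.countable_iUnion fun hij => h2 i j hij)).mono ?_
  intro t ht
  by_contra hcon
  simp only [Set.mem_union, Set.mem_iUnion, not_or, not_exists] at hcon
  refine ht ⟨hcon.1, fun i j hij => ?_⟩
  by_contra hne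
  exact hcon.2 i j hne hij

/-- The points with pairwise distinct coordinates outside a countable set are dense. -/
theorem mem_closure_generic (x : Fin k → ℂ) {C : Set ℂ} (hC : C.Countable) :
    x ∈ closure {y : Fin k → ℂ | (∀ i, y i ∉ C) ∧ Function.Injective y} := by
  refine dense_of_curve (genericCurve x) (by ext; simp [genericCurve]) ?_
    (genericCurve_countable x hC)
  unfold genericCurve
  fun_prop

theorem mem_closure_regularTorus (x : Fin k → ℂ) : x ∈ closure (regularTorus k) := by
  simpa [regularTorus] using mem_closure_generic x (Set.countable_singleton (0 : ℂ))

/-- The extension of the alternant quotient to the torus. -/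
def altExt (G : Fin k → ℂ → ℂ) : (Fin k → ℂ) → ℂ := extendFrom (regularTorus k) (altQuot G)

theorem differentiableAt_det {E : Type*} [NormedAddCommGroup E] [NormedSpace ℂ E] {x : E}
    {M : E → Matrix (Fin k) (Fin k) ℂ} (h : ∀ i j, DifferentiableAt ℂ (fun y => M y i j) x) :
    DifferentiableAt ℂ (fun y => (M y).det) x := by
  have h1 : (fun y => (M y).det) = fun y => ∑ σ : Equiv.Perm (Fin k),
      ((σ.sign : ℤ) : ℂ) * ∏ i, M y (σ i) i := funext fun y => Matrix.det_apply' _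
  rw [h1]
  have h2 : ∀ σ : Equiv.Perm (Fin k), DifferentiableAt ℂ (fun y => ∏ i, M y (σ i) i) x := fun σ =>
    (HasFDerivAt.finsetProd fun i _ => (h (σ i) i).hasFDerivAt).differentiableAt
  exact DifferentiableAt.fun_sum fun σ _ => (h2 σ).const_mul _

theorem tendsto_det {ι : Type*} {l : Filter ι} {M : ι → Matrix (Fin k) (Fin k) ℂ}
    {A : Matrix (Fin k) (Fin k) ℂ} (h : ∀ i j, Tendsto (fun p => M p i j) l (𝓝 (A i j))) :
    Tendsto (fun p => (M p).det) l (𝓝 A.det) :=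
  ((continuous_id.matrix_det).tendsto A).comp
    (tendsto_pi_nhds.2 fun i => tendsto_pi_nhds.2 fun j => h i j)

theorem differentiableOn_det_ddMat {r R : ℝ} (hr : 0 < r) {G : Fin k → ℂ → ℂ}
    (hG : ∀ j, DifferentiableOn ℂ (G j) {0}ᶜ) :
    DifferentiableOn ℂ (fun x => (ddMat r R G x).det) (polyAnn k r R) := by
  intro x hx
  have hc : ∀ j, ∀ ρ : ℝ, 0 < ρ → ContinuousOn (G j) (Metric.sphere 0 ρ) := fun j ρ hρ =>
    (hG j).continuousOn.mono fun z hz h => by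
      rw [h, mem_sphere_zero_iff_norm, norm_zero] at hz
      exact hρ.ne hz
  refine DifferentiableAt.differentiableWithinAt ?_
  refine differentiableAt_det fun i j => ?_
  simp only [ddMat, Matrix.of_apply, ddInt]
  have hR : 0 < R := hr.trans ((hx i).1.trans (hx i).2)
  exact ((differentiableAt_ddCirc hR (hc _ R hR) _ fun s => (hx s).2.ne).sub
    (differentiableAt_ddCirc hr (hc _ r hr) _ fun s => (hx s).1.ne')).const_mul _

/-- The determinant is continuous on the whole poly-annulus, diagonals included, and agrees with the
quotient off them. So it computes the extension by continuity. -/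
theorem altExt_eq_det_ddMat {r R : ℝ} (hr : 0 < r) {G : Fin k → ℂ → ℂ}
    (hG : ∀ j, DifferentiableOn ℂ (G j) {0}ᶜ) {x : Fin k → ℂ} (hx : x ∈ polyAnn k r R) :
    altExt G x = (ddMat r R G x).det := by
  refine extendFrom_eq (mem_closure_regularTorus x) ?_
  have h1 : Tendsto (fun x => (ddMat r R G x).det) (𝓝[regularTorus k] x)
      (𝓝 (ddMat r R G x).det) :=
    ((differentiableOn_det_ddMat hr hG).continuousOn.continuousAt
      ((isOpen_polyAnn r R).mem_nhds hx)).tendsto.mono_left nhdsWithin_le_nhds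
  refine h1.congr' ?_
  filter_upwards [self_mem_nhdsWithin,
    mem_nhdsWithin_of_mem_nhds ((isOpen_polyAnn r R).mem_nhds hx)] with y hy1 hy2
  exact (altQuot_eq_det_ddMat hr hG hy1.2 (fun s => (hy2 s).1) (fun s => (hy2 s).2)).symm

theorem differentiableOn_altExt {G : Fin k → ℂ → ℂ} (hG : ∀ j, DifferentiableOn ℂ (G j) {0}ᶜ) :
    DifferentiableOn ℂ (altExt G) (torus k) := by
  intro x hx
  obtain ⟨r, R, hr, hxr⟩ := exists_polyAnn hx
  have h1 := (differentiableOn_det_ddMat hr hG).differentiableAt ((isOpen_polyAnn r R).mem_nhds hxr)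
  refine (h1.congr_of_eventuallyEq ?_).differentiableWithinAt
  filter_upwards [(isOpen_polyAnn r R).mem_nhds hxr] with y hy
  exact altExt_eq_det_ddMat hr hG hy

theorem altExt_eq {G : Fin k → ℂ → ℂ} (hG : ∀ j, DifferentiableOn ℂ (G j) {0}ᶜ) {x : Fin k → ℂ}
    (hx : x ∈ regularTorus k) : altExt G x = altQuot G x := by
  obtain ⟨r, R, hr, hxr⟩ := exists_polyAnn hx.1
  rw [altExt_eq_det_ddMat hr hG hxr,
    altQuot_eq_det_ddMat hr hG hx.2 (fun s => (hxr s).1) (fun s => (hxr s).2)]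

theorem tendsto_ddInt {ι : Type*} {l : Filter ι} {r R : ℝ} {F : ι → ℂ → ℂ} {g : ℂ → ℂ}
    {S : Finset (Fin k)} {X : ι → Fin k → ℂ} {x : Fin k → ℂ}
    (h1 : Tendsto (fun p => ddCirc R (F p) S (X p)) l (𝓝 (ddCirc R g S x)))
    (h2 : Tendsto (fun p => ddCirc r (F p) S (X p)) l (𝓝 (ddCirc r g S x))) :
    Tendsto (fun p => ddInt r R (F p) S (X p)) l (𝓝 (ddInt r R g S x)) :=
  (h1.sub h2).const_mul (2 * Real.pi * Complex.I : ℂ)⁻¹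

/-- Near a given point the extension is a polynomial in Cauchy integrals over two fixed circles, and
each of these converges by `tendsto_ddCirc`. -/
theorem contConv_altExt {F : ℕ → Fin k → ℂ → ℂ} {G : Fin k → ℂ → ℂ}
    (hF : ∀ᶠ n in atTop, ∀ j, DifferentiableOn ℂ (F n j) {0}ᶜ)
    (hG : ∀ j, DifferentiableOn ℂ (G j) {0}ᶜ)
    (h : ∀ j, ContConv (fun n => F n j) (G j) {0}ᶜ) :
    ContConv (fun n => altExt (F n)) (altExt G) (torus k) := by
  intro x hx
  obtain ⟨r, R, hr, hxr⟩ := exists_polyAnn hx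
  have hsub : ∀ ρ : ℝ, 0 < ρ → Metric.sphere (0 : ℂ) ρ ⊆ {0}ᶜ := fun ρ hρ z hz h => by
    rw [h, mem_sphere_zero_iff_norm, norm_zero] at hz
    exact hρ.ne hz
  rw [altExt_eq_det_ddMat hr hG hxr]
  have h1 : Tendsto (fun p : ℕ × (Fin k → ℂ) => (ddMat r R (F p.1) p.2).det) (atTop ×ˢ 𝓝 x)
      (𝓝 (ddMat r R G x).det) := by
    have hcirc : ∀ i j, ∀ ρ : ℝ, 0 < ρ → (∀ s, ‖x s‖ ≠ ρ) →
        Tendsto (fun p : ℕ × (Fin k → ℂ) => ddCirc ρ (F p.1 j) (Finset.Iic i) p.2) (atTop ×ˢ 𝓝 x)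
          (𝓝 (ddCirc ρ (G j) (Finset.Iic i) x)) := by
      intro i j ρ hρ hs
      refine tendsto_ddCirc (G := fun n => F n j) hρ ?_ ?_ ?_ _ hs
      · filter_upwards [hF] with n hn using (hn j).continuousOn.mono (hsub ρ hρ)
      -- Uniform convergence to a continuous function on the circle supplies the bound required for
      -- domination.
      · have hK := isCompact_sphere (0 : ℂ) ρ
        obtain ⟨C, hC⟩ := hK.exists_bound_of_continuousOn ((hG j).continuousOn.mono (hsub ρ hρ))
        have hu := (h j).tendstoUniformlyOn (hG j).continuousOn hK (hsub ρ hρ)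
        refine ⟨C + 1, ?_⟩
        filter_upwards [Metric.tendstoUniformlyOn_iff.1 hu 1 one_pos] with n hn z hz
        have h2 := hn z hz
        have h3 := hC z hz
        rw [dist_comm, dist_eq_norm] at h2
        calc ‖F n j z‖ = ‖G j z + (F n j z - G j z)‖ := by ring_nf
          _ ≤ ‖G j z‖ + ‖F n j z - G j z‖ := norm_add_le _ _
          _ ≤ C + 1 := by linarith
      · exact fun z hz => (h j).tendsto (hsub ρ hρ hz)
    have hent : ∀ i j, Tendsto (fun p : ℕ × (Fin k → ℂ) => ddMat r R (F p.1) p.2 i j)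
        (atTop ×ˢ 𝓝 x) (𝓝 (ddMat r R G x i j)) := by
      intro i j
      have hR : 0 < R := hr.trans ((hxr i).1.trans (hxr i).2)
      have a := hcirc i j R hR fun s => (hxr s).2.ne
      have b := hcirc i j r hr fun s => (hxr s).1.ne'
      exact tendsto_ddInt a b
    exact tendsto_det hent
  refine h1.congr' ?_
  filter_upwards [hF.prod_mk ((isOpen_polyAnn r R).mem_nhds hxr)] with p hp
  exact (altExt_eq_det_ddMat hr hp.1 hp.2).symm

end
end QSchur

namespace QSchur
noncomputable section
variable {k N : ℕ}

/-! ### Replacing a window of rows of a matrix -/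

/-- `A' = B * A`, where `B` is the identity outside the window rows. Hence `B` is block triangular
and its determinant is the window minor. -/
theorem det_replace_window (A : Matrix (Fin N) (Fin N) ℂ) {b : ℕ} (hb : b + k ≤ N)
    (C : Fin k → Fin N → ℂ) (A' : Matrix (Fin N) (Fin N) ℂ)
    (h1 : ∀ (i : Fin k) m, A' ⟨b + i, by omega⟩ m = ∑ n, C i n * A n m)
    (h2 : ∀ i : Fin N, ¬ (b ≤ (i : ℕ) ∧ (i : ℕ) < b + k) → ∀ m, A' i m = A i m) :
    A'.det = (Matrix.of fun i j : Fin k => C i ⟨b + j, by omega⟩).det * A.det := by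
  set p : Fin N → Prop := fun i => b ≤ (i : ℕ) ∧ (i : ℕ) < b + k with hp
  set B : Matrix (Fin N) (Fin N) ℂ := Matrix.of fun i m =>
    if h : b ≤ (i : ℕ) ∧ (i : ℕ) < b + k then C ⟨i - b, by omega⟩ m else if i = m then 1 else 0
    with hB
  have e1 : A' = B * A := by
    ext i m
    rw [Matrix.mul_apply]
    by_cases hi : b ≤ (i : ℕ) ∧ (i : ℕ) < b + k
    · have := h1 ⟨i - b, by omega⟩ m
      rw [show (⟨b + (⟨i - b, by omega⟩ : Fin k), by simp; omega⟩ : Fin N) = i from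
        Fin.ext (by simp; omega)] at this
      simp [hB, hi, this]
    · simp [hB, hi, h2 i hi m]
  have e2 : B.det = (Matrix.of fun i j : Fin k => C i ⟨b + j, by omega⟩).det := by
    rw [Matrix.twoBlockTriangular_det B p (by
      intro i hi j hj
      simp only [hB, Matrix.of_apply]
      rw [dif_neg hi, if_neg]
      rintro rfl
      exact hi hj)]
    have e3 : Matrix.toSquareBlockProp B (fun i => ¬ p i) = 1 := by
      ext ⟨i, hi⟩ ⟨j, hj⟩
      simp only [Matrix.toSquareBlockProp_def, hB, Matrix.of_apply, Matrix.one_apply, Subtype.mk.injEq]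
      rw [dif_neg hi]
    rw [e3, Matrix.det_one, mul_one]
    let e : Fin k ≃ {i : Fin N // p i} :=
      { toFun := fun i => ⟨⟨b + i, by omega⟩, by simp [hp]⟩
        invFun := fun i => ⟨i.1 - b, by have := i.2; simp only [hp] at this; omega⟩
        left_inv := fun i => by ext; simp
        right_inv := fun i => by
          have := i.2
          simp only [hp] at this
          ext; simp; omega }
    rw [← Matrix.det_submatrix_equiv_self e]
    congr 1
    ext i j
    simp [hB, e, Matrix.toSquareBlockProp_def]
  rw [e1, Matrix.det_mul, e2]

/-! ### Lagrange interpolation -/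

theorem eval_lagrange_basis (v : Fin N → ℂ) (n : Fin N) (z : ℂ) :
    (Lagrange.basis Finset.univ v n).eval z = ∏ m ∈ Finset.univ.erase n, (z - v m) / (v n - v m) := by
  rw [Lagrange.basis, Polynomial.eval_prod]
  refine Finset.prod_congr rfl fun m _ => ?_
  simp only [Lagrange.basisDivisor, Polynomial.eval_mul, Polynomial.eval_C, Polynomial.eval_sub,
    Polynomial.eval_X]
  rw [div_eq_inv_mul]

theorem natDegree_lagrange_basis_lt {v : Fin N → ℂ} (hv : Function.Injective v) (n : Fin N) :
    (Lagrange.basis Finset.univ v n).natDegree < N := by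
  rw [Lagrange.natDegree_basis hv.injOn (Finset.mem_univ n)]
  have := n.2
  simp
  omega

/-- A vector is the combination of the rows `(v_m ^ i)_m` with the coefficients of its
interpolation polynomial. -/
theorem lagrange_row {v : Fin N → ℂ} (hv : Function.Injective v) (f : Fin N → ℂ) (m : Fin N) :
    f m = ∑ i : Fin N, (∑ n, f n * (Lagrange.basis Finset.univ v n).coeff i) * v m ^ (i : ℕ) := by
  have h1 : ∀ n, ∑ i : Fin N, (Lagrange.basis Finset.univ v n).coeff i * v m ^ (i : ℕ)
      = if n = m then 1 else 0 := by
    intro n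
    rw [Fin.sum_univ_eq_sum_range
      (fun i => (Lagrange.basis Finset.univ v n).coeff i * v m ^ i) N,
      ← Polynomial.eval_eq_sum_range' (natDegree_lagrange_basis_lt hv n)]
    split_ifs with h
    · subst h
      exact Lagrange.eval_basis_self hv.injOn (Finset.mem_univ n)
    · exact Lagrange.eval_basis_of_ne h (Finset.mem_univ m)
  calc f m = ∑ n, f n * ∑ i : Fin N, (Lagrange.basis Finset.univ v n).coeff i * v m ^ (i : ℕ) := by
        simp [h1]
    _ = _ := by
        simp only [Finset.mul_sum, Finset.sum_mul]
        rw [Finset.sum_comm]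
        exact Finset.sum_congr rfl fun _ _ => Finset.sum_congr rfl fun _ _ => by ring

/-- Powers of degree below the number of nodes are their own interpolation polynomials. -/
theorem lagrange_pow {w : Fin N → ℂ} (hw : Function.Injective w) (z : ℂ) (m : Fin N) :
    z ^ (m : ℕ) = ∑ n, (Lagrange.basis Finset.univ w n).eval z * w n ^ (m : ℕ) := by
  have h := Lagrange.eq_interpolate (f := (Polynomial.X : Polynomial ℂ) ^ (m : ℕ)) (s := Finset.univ)
    hw.injOn (by
      rw [Polynomial.degree_X_pow, Finset.card_univ, Fintype.card_fin]
      exact_mod_cast m.2)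
  have h2 := congrArg (Polynomial.eval z) h
  simp only [Lagrange.interpolate_apply, Polynomial.eval_finsetSum, Polynomial.eval_pow,
    Polynomial.eval_X, Polynomial.eval_mul, Polynomial.eval_C] at h2
  rw [h2]
  exact Finset.sum_congr rfl fun _ _ => mul_comm _ _

theorem det_vandermonde_eq_vdm (z : Fin N → ℂ) : (Matrix.vandermonde z).det = vdm z := by
  rw [Matrix.det_vandermonde, vdm]
  exact Finset.prod_comm' (by simp)

theorem prod_Iio_eq (f : ℕ → ℂ) (j : Fin k) :
    ∏ s ∈ Finset.Iio j, f s = ∏ s ∈ Finset.range j, f s := by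
  refine Finset.prod_bij (fun s _ => (s : ℕ)) ?_ ?_ ?_ ?_
  · intro s hs; simpa using hs
  · intro a _ c _ h; exact Fin.ext h
  · intro c hc
    have hc' := Finset.mem_range.1 hc
    exact ⟨⟨c, by omega⟩, by simpa [Fin.lt_def] using hc', rfl⟩
  · intro s _; rfl

/-! ### The scalar identity -/

/-- Replaces the truncated quotient in the exponent by a sum that can be handled by induction. -/
theorem sum_sq_range (k : ℕ) : k * (k - 1) * (2 * k - 1) / 6 = ∑ s ∈ Finset.range k, s ^ 2 := by
  refine Nat.div_eq_of_eq_mul_left (by norm_num) ?_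
  induction k with
  | zero => simp
  | succ n ih =>
    rw [Finset.sum_range_succ, add_mul (∑ s ∈ Finset.range n, s ^ 2), ← ih]
    rcases n with _ | n
    · simp
    · simp only [Nat.add_sub_cancel]
      rw [show 2 * (n + 1 + 1) - 1 = 2 * n + 3 by omega, show 2 * (n + 1) - 1 = 2 * n + 1 by omega]
      ring

/-- The balance of powers of `q` in `det_windowProd`: the constant of the formula and the
Vandermonde product of the powers of `q` on the left, the factors `q^(-s)` of the window products on
the right. -/
theorem exponent_identity (k : ℕ) :
    k * (k - 1) * (2 * k - 1) / 6 + ∑ j ∈ Finset.range k, ∑ s ∈ Finset.range j, s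
      = ∑ j ∈ Finset.range k, ∑ s ∈ (Finset.range k).erase j, s := by
  have h1 : ∀ n : ℕ, ∑ j ∈ Finset.range n, ∑ s ∈ (Finset.range n).erase j, s
      = (n - 1) * ∑ s ∈ Finset.range n, s := by
    intro n
    have h2 : ∑ j ∈ Finset.range n, ∑ s ∈ (Finset.range n).erase j, s + ∑ s ∈ Finset.range n, s
        = n * ∑ s ∈ Finset.range n, s := by
      rw [← Finset.sum_add_distrib, Finset.sum_congr rfl fun j hj =>
        Finset.sum_erase_add (Finset.range n) (fun s => s) hj]
      simp
    rcases n with _ | n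
    · simp
    · rw [Nat.add_sub_cancel]
      have : (n + 1) * ∑ s ∈ Finset.range (n + 1), s
        = n * ∑ s ∈ Finset.range (n + 1), s + ∑ s ∈ Finset.range (n + 1), s := by ring
      omega
  rw [h1, sum_sq_range]
  induction k with
  | zero => simp
  | succ n ih =>
    rw [Finset.sum_range_succ, Finset.sum_range_succ]
    have : ∑ x ∈ Finset.range n, x ^ 2 + n ^ 2 +
        (∑ j ∈ Finset.range n, ∑ s ∈ Finset.range j, s + ∑ s ∈ Finset.range n, s)
        = (n - 1) * ∑ s ∈ Finset.range n, s + ∑ s ∈ Finset.range n, s + n ^ 2 := by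
      rw [← ih]; ring
    rw [this, Finset.sum_range_succ, Nat.add_sub_cancel]
    rcases n with _ | n
    · simp
    · rw [Nat.add_sub_cancel]; ring

/-- The product `∏_{s ≠ j} (x q^(-s) - 1)`. -/
def windowProd (q : ℝ) (j : Fin k) (x : ℂ) : ℂ :=
  ∏ s ∈ Finset.univ.erase j, (x * (q : ℂ) ^ (-((s : ℕ) : ℤ)) - 1)

theorem qpow_injective {q : ℝ} (hq0 : 0 < q) (hq1 : q < 1) :
    Function.Injective fun i : Fin N => (q : ℂ) ^ (i : ℕ) := by
  intro i j h
  beta_reduce at h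
  have h1 : q ^ (i : ℕ) = q ^ (j : ℕ) := by exact_mod_cast h
  exact Fin.ext (pow_right_injective₀ hq0 hq1.ne h1)

theorem qzpow_injective {q : ℝ} (hq0 : 0 < q) (hq1 : q < 1) :
    Function.Injective fun i : ℤ => (q : ℂ) ^ i := by
  intro i j h
  beta_reduce at h
  have h1 : q ^ i = q ^ j := by exact_mod_cast h
  exact zpow_right_injective₀ hq0 hq1.ne h1

theorem vdm_eq_lagrange {w : Fin k → ℂ} (hw : Function.Injective w) (x : Fin k → ℂ) :
    vdm x = (Matrix.of fun i j => (Lagrange.basis Finset.univ w j).eval (x i)).det * vdm w := by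
  rw [← det_vandermonde_eq_vdm, ← det_vandermonde_eq_vdm, ← Matrix.det_mul]
  congr 1
  ext i m
  rw [Matrix.mul_apply]
  exact lagrange_pow hw (x i) m

/-- Both sides vanish at `q^s` for `s ≠ j`; the scalar compares their leading coefficients. -/
theorem windowProd_eq {q : ℝ} (hq0 : 0 < q) (hq1 : q < 1) (j : Fin k) (x : ℂ) :
    windowProd q j x = (∏ s ∈ Finset.univ.erase j, ((q : ℂ) ^ (j : ℕ) - (q : ℂ) ^ (s : ℕ)) *
        ((q : ℂ) ^ (s : ℕ))⁻¹) *
      (Lagrange.basis Finset.univ (fun i : Fin k => (q : ℂ) ^ (i : ℕ)) j).eval x := by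
  have hq : (q : ℂ) ≠ 0 := by exact_mod_cast hq0.ne'
  rw [eval_lagrange_basis, windowProd, ← Finset.prod_mul_distrib]
  refine Finset.prod_congr rfl fun s hs => ?_
  have h1 : (q : ℂ) ^ (j : ℕ) - (q : ℂ) ^ (s : ℕ) ≠ 0 := sub_ne_zero.2 fun h =>
    (Finset.ne_of_mem_erase hs).symm (qpow_injective hq0 hq1 h)
  rw [zpow_neg, zpow_natCast]
  field_simp

/-- The constant in the determinantal formula. -/
def detConst (q : ℝ) (k : ℕ) : ℂ :=
  (q : ℂ) ^ (k * (k - 1) * (2 * k - 1) / 6) / ∏ i ∈ Finset.range k, qPoch (q : ℂ) q i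

theorem qPoch_ne_zero {q : ℝ} (hq0 : 0 < q) (hq1 : q < 1) (n : ℕ) : qPoch (q : ℂ) q n ≠ 0 := by
  refine Finset.prod_ne_zero_iff.2 fun i _ => ?_
  have : q * q ^ i < 1 := by
    rw [← pow_succ']
    exact pow_lt_one₀ hq0.le hq1 (by omega)
  have h2 : (1 - q * q ^ i : ℝ) ≠ 0 := by linarith
  exact_mod_cast h2

theorem vandermonde_qpow (q : ℝ) :
    (∏ j : Fin k, ∏ s ∈ Finset.Iio j, ((q : ℂ) ^ (s : ℕ) - (q : ℂ) ^ (j : ℕ)))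
      = (q : ℂ) ^ (∑ j ∈ Finset.range k, ∑ s ∈ Finset.range j, s) *
        ∏ i ∈ Finset.range k, qPoch (q : ℂ) q i := by
  have h1 : ∀ j : ℕ, ∏ s ∈ Finset.range j, ((q : ℂ) ^ s - (q : ℂ) ^ j)
      = (q : ℂ) ^ (∑ s ∈ Finset.range j, s) * qPoch (q : ℂ) q j := by
    intro j
    rw [qPoch, ← Finset.prod_range_reflect (fun i => 1 - (q : ℂ) * (q : ℂ) ^ i),
      ← Finset.prod_pow_eq_pow_sum, ← Finset.prod_mul_distrib]
    refine Finset.prod_congr rfl fun s hs => ?_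
    have := Finset.mem_range.1 hs
    rw [mul_sub, mul_one, ← pow_succ', ← pow_add, show s + (j - 1 - s + 1) = j by omega]
  have h2 : ∀ j : Fin k, ∏ s ∈ Finset.Iio j, ((q : ℂ) ^ (s : ℕ) - (q : ℂ) ^ (j : ℕ))
      = (fun j : ℕ => (q : ℂ) ^ (∑ s ∈ Finset.range j, s) * qPoch (q : ℂ) q j) j := fun j =>
    (prod_Iio_eq (fun s => (q : ℂ) ^ s - (q : ℂ) ^ (j : ℕ)) j).trans (h1 j)
  rw [Finset.prod_congr rfl fun j _ => h2 j, Fin.prod_univ_eq_prod_range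
    (fun j : ℕ => (q : ℂ) ^ (∑ s ∈ Finset.range j, s) * qPoch (q : ℂ) q j), Finset.prod_mul_distrib,
    Finset.prod_pow_eq_pow_sum]

/-- This is the determinantal formula with all one-variable functions replaced by `1`; it shows that
the constant is the correct normalization. The window products are multiples of the Lagrange basis
polynomials at `1, q, …, q^(k-1)`, whose determinant is a quotient of two Vandermonde products. -/
theorem det_windowProd {q : ℝ} (hq0 : 0 < q) (hq1 : q < 1) (x : Fin k → ℂ) :
    detConst q k * (Matrix.of fun i j : Fin k => windowProd q j (x i)).det = vdm x := by
  have hq : (q : ℂ) ≠ 0 := by exact_mod_cast hq0.ne'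
  set w : Fin k → ℂ := fun i => (q : ℂ) ^ (i : ℕ) with hw
  have hwi : Function.Injective w := qpow_injective hq0 hq1
  have h1 : (Matrix.of fun i j : Fin k => windowProd q j (x i)).det =
      (∏ j, ∏ s ∈ Finset.univ.erase j, (w j - w s) * (w s)⁻¹) *
        (Matrix.of fun i j => (Lagrange.basis Finset.univ w j).eval (x i)).det := by
    rw [← Matrix.det_mul_row]
    congr 1
    ext i j
    exact windowProd_eq hq0 hq1 j (x i)
  have h2 : (∏ j, ∏ s ∈ Finset.univ.erase j, (w j - w s)) =
      vdm w * ∏ j : Fin k, ∏ s ∈ Finset.Iio j, ((q : ℂ) ^ (s : ℕ) - (q : ℂ) ^ (j : ℕ)) := by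
    have h3 : ∀ j : Fin k, ∏ s ∈ Finset.univ.erase j, (w j - w s)
        = (∏ s ∈ Finset.Iio j, (w j - w s)) * ∏ s ∈ Finset.Ioi j, (w j - w s) := by
      intro j
      rw [← Finset.prod_union]
      · congr 1
        ext s
        simp [lt_or_lt_iff_ne]
      · rw [Finset.disjoint_left]
        intro a ha hb
        exact lt_asymm (Finset.mem_Iio.1 ha) (Finset.mem_Ioi.1 hb)
    rw [Finset.prod_congr rfl fun j _ => h3 j, Finset.prod_mul_distrib, vdm]
    congr 1
    exact Finset.prod_comm' (by simp)
  have h4 : ∏ j, ∏ s ∈ Finset.univ.erase j, (w s)⁻¹ =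
      ((q : ℂ) ^ (∑ j ∈ Finset.range k, ∑ s ∈ (Finset.range k).erase j, s))⁻¹ := by
    simp only [Finset.prod_inv_distrib]
    congr 1
    rw [← Finset.prod_pow_eq_pow_sum, ← Fin.prod_univ_eq_prod_range
      (fun j => (q : ℂ) ^ ∑ s ∈ (Finset.range k).erase j, s)]
    refine Finset.prod_congr rfl fun j _ => ?_
    rw [← Finset.prod_pow_eq_pow_sum]
    refine Finset.prod_bij (fun s _ => (s : ℕ)) ?_ ?_ ?_ ?_
    · intro s hs; simpa [Fin.ext_iff] using hs
    · intro a _ c _ h; exact Fin.ext h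
    · intro c hc
      simp only [Finset.mem_erase, Finset.mem_range] at hc
      exact ⟨⟨c, hc.2⟩, by simpa [Fin.ext_iff] using hc.1, rfl⟩
    · intro s _; rfl
  have h5 := vdm_eq_lagrange hwi x
  rw [h1]
  simp only [Finset.prod_mul_distrib] at h2 h4 ⊢
  rw [h2, h4, vandermonde_qpow q, ← exponent_identity, detConst, h5, pow_add]
  have h6 : ∏ i ∈ Finset.range k, qPoch (q : ℂ) q i ≠ 0 :=
    Finset.prod_ne_zero_iff.2 fun i _ => qPoch_ne_zero hq0 hq1 i
  field_simp

end
end QSchur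

namespace QSchur
noncomputable section
variable {k N : ℕ}

/-! ### Schur functions on the torus -/

/-- The strictly decreasing exponents of the alternant of a signature. -/
def ex (l : Fin N → ℤ) (j : Fin N) : ℤ := l j + (N : ℤ) - ((j : ℤ) + 1)

theorem ex_strictAnti {l : Fin N → ℤ} (hl : Antitone l) : StrictAnti (ex l) := by
  intro i j hij
  have := hl hij.le
  have h2 : (i : ℤ) < j := by exact_mod_cast hij
  unfold ex
  omega

theorem differentiableOn_zpow' (n : ℤ) : DifferentiableOn ℂ (fun z : ℂ => z ^ n) {0}ᶜ :=
  fun _ hz => (differentiableAt_zpow.2 (Or.inl hz)).differentiableWithinAt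

/-- The Schur functions and the limit functions in `k` variables are both defined by extension from
the regular points; this identifies either with a constant times `altExt`, which is known to be
holomorphic. -/
theorem extendFrom_const_mul_altQuot {G : Fin N → ℂ → ℂ} (hG : ∀ j, DifferentiableOn ℂ (G j) {0}ᶜ)
    {f : (Fin N → ℂ) → ℂ} {c : ℂ} (hf : ∀ z ∈ regularTorus N, f z = c * altQuot G z)
    {z : Fin N → ℂ} (hz : z ∈ torus N) : extendFrom (regularTorus N) f z = c * altExt G z := by
  refine extendFrom_eq (mem_closure_regularTorus z) ?_
  have h1 : Tendsto (fun z => c * altExt G z) (𝓝[regularTorus N] z) (𝓝 (c * altExt G z)) :=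
    (((differentiableOn_altExt hG).continuousOn.continuousAt
      (isOpen_torus.mem_nhds hz)).tendsto.mono_left nhdsWithin_le_nhds).const_mul c
  refine h1.congr' ?_
  filter_upwards [self_mem_nhdsWithin] with y hy
  rw [hf y hy, altExt_eq hG hy]

theorem schur_eq_altExt (l : Fin N → ℤ) {z : Fin N → ℂ} (hz : z ∈ torus N) :
    schur l z = (∏ i : Fin N, ∏ _j ∈ Finset.Iio i, (-1 : ℂ))⁻¹ *
      altExt (fun j z => z ^ ex l j) z := by
  refine extendFrom_const_mul_altQuot (fun j => differentiableOn_zpow' _) (fun y _ => ?_) hz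
  rw [vandermonde_eq_vdm, altQuot, ← div_div, div_eq_inv_mul _ (∏ i : Fin N, _), mul_div_assoc]
  rfl

theorem differentiableOn_schur (l : Fin N → ℤ) : DifferentiableOn ℂ (schur l) (torus N) :=
  ((differentiableOn_altExt fun j => differentiableOn_zpow' (ex l j)).const_mul _).congr
    fun _ hz => schur_eq_altExt l hz

theorem schur_eq (l : Fin N → ℤ) {z : Fin N → ℂ} (hz : z ∈ regularTorus N) :
    schur l z = (Matrix.of fun i j => z i ^ ex l j).det / vandermonde z := by
  rw [schur_eq_altExt l hz.1, altExt_eq (fun j => differentiableOn_zpow' _) hz, altQuot,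
    vandermonde_eq_vdm, ← div_div, div_eq_inv_mul _ (∏ i : Fin N, _), mul_div_assoc]

theorem insertedVars_window (q : ℝ) {b : ℕ} (hb : b + k ≤ N) (x : Fin k → ℂ) (i : Fin k) :
    insertedVars q N b x ⟨b + i, by omega⟩ = (q : ℂ) ^ b * x i := by
  simp [insertedVars]

theorem insertedVars_outside (q : ℝ) {b : ℕ} (x : Fin k → ℂ) {i : Fin N}
    (hi : ¬ (b ≤ (i : ℕ) ∧ (i : ℕ) < b + k)) : insertedVars q N b x i = (q : ℂ) ^ (i : ℕ) := by
  simp [insertedVars, hi]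

theorem insertedVars_mem_torus {q : ℝ} (hq0 : 0 < q) (b : ℕ) {x : Fin k → ℂ} (hx : x ∈ torus k) :
    insertedVars q N b x ∈ torus N := by
  have hq : (q : ℂ) ≠ 0 := by exact_mod_cast hq0.ne'
  intro i
  unfold insertedVars
  split_ifs with h
  · exact mul_ne_zero (pow_ne_zero _ hq) (hx _)
  · exact pow_ne_zero _ hq

theorem differentiable_insertedVars (q : ℝ) (b : ℕ) :
    Differentiable ℂ (insertedVars q N b : (Fin k → ℂ) → Fin N → ℂ) := by
  refine differentiable_pi.2 fun i => ?_
  unfold insertedVars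
  split_ifs with h
  · exact (differentiable_apply _).const_mul _
  · exact differentiable_const _

theorem differentiableOn_normSchur {q : ℝ} (hq0 : 0 < q) (l : Fin N → ℤ) (b : ℕ) :
    DifferentiableOn ℂ (normSchur q l b : (Fin k → ℂ) → ℂ) (torus k) := by
  unfold normSchur
  simp only [div_eq_mul_inv]
  exact ((differentiableOn_schur l).comp (differentiable_insertedVars q b).differentiableOn
    fun x hx => insertedVars_mem_torus hq0 b hx).mul_const _

/-- The powers of `q`, together with `0`. -/
def badSet (q : ℝ) : Set ℂ := insert 0 (Set.range fun n : ℤ => (q : ℂ) ^ n)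

theorem badSet_countable (q : ℝ) : (badSet q).Countable := (Set.countable_range _).insert _

/-- A coordinate that is neither `0` nor an integer power of `q` cannot collide, after
multiplication by `q^b`, with one of the remaining variables. -/
theorem insertedVars_injective {q : ℝ} (hq0 : 0 < q) (hq1 : q < 1) {b : ℕ} (hb : b + k ≤ N)
    {x : Fin k → ℂ} (hx : ∀ i, x i ∉ badSet q) (hxi : Function.Injective x) :
    Function.Injective (insertedVars q N b x) := by
  have hq : (q : ℂ) ≠ 0 := by exact_mod_cast hq0.ne'
  have key : ∀ (i : Fin k) (m : ℕ), (q : ℂ) ^ b * x i ≠ (q : ℂ) ^ m := by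
    intro i m h
    apply hx i
    refine Or.inr ⟨(m : ℤ) - b, ?_⟩
    simp only [zpow_sub₀ hq, zpow_natCast]
    rw [← h]
    field_simp
  intro i j h
  have hsplit : ∀ i : Fin N, (b ≤ (i : ℕ) ∧ (i : ℕ) < b + k) →
      ∃ i' : Fin k, i = ⟨b + i', by omega⟩ := fun i hi =>
    ⟨⟨i - b, by omega⟩, Fin.ext (by simp; omega)⟩
  by_cases hi : b ≤ (i : ℕ) ∧ (i : ℕ) < b + k <;> by_cases hj : b ≤ (j : ℕ) ∧ (j : ℕ) < b + k
  · obtain ⟨i', rfl⟩ := hsplit i hi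
    obtain ⟨j', rfl⟩ := hsplit j hj
    rw [insertedVars_window q hb, insertedVars_window q hb] at h
    rw [hxi (mul_left_cancel₀ (pow_ne_zero b hq) h)]
  · obtain ⟨i', rfl⟩ := hsplit i hi
    rw [insertedVars_window q hb, insertedVars_outside q x hj] at h
    exact absurd h (key _ _)
  · obtain ⟨j', rfl⟩ := hsplit j hj
    rw [insertedVars_window q hb, insertedVars_outside q x hi] at h
    exact absurd h.symm (key _ _)
  · rw [insertedVars_outside q x hi, insertedVars_outside q x hj] at h
    exact qpow_injective hq0 hq1 h

theorem qpow_mem_regularTorus {q : ℝ} (hq0 : 0 < q) (hq1 : q < 1) :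
    (fun i : Fin N => (q : ℂ) ^ (i : ℕ)) ∈ regularTorus N :=
  ⟨fun _ => pow_ne_zero _ (by exact_mod_cast hq0.ne'), qpow_injective hq0 hq1⟩

/-- The coefficient of the row `(q ^ (n e_m))_m` in the vector `(z ^ e_m)_m`. -/
def rowPoly (q : ℝ) (e : Fin N → ℤ) (n : ℕ) (z : ℂ) : ℂ :=
  ∑ m, z ^ e m * (Lagrange.basis Finset.univ (fun m => (q : ℂ) ^ e m) m).coeff n

/-- The Lagrange basis polynomials at the nodes `q ^ m`, `m < N`. -/
def nodePoly (q : ℝ) (N : ℕ) (n : Fin N) (z : ℂ) : ℂ :=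
  (Lagrange.basis Finset.univ (fun m : Fin N => (q : ℂ) ^ (m : ℕ)) n).eval z

/-- `det_replace_window` is applied twice: to the alternant, interpolating at the nodes `q^(e_m)`,
and to the Vandermonde matrix, interpolating at the nodes `q^n`. The determinants of the unmodified
matrices cancel in the normalized quotient. -/
theorem normSchur_generic {q : ℝ} (hq0 : 0 < q) (hq1 : q < 1) {l : Fin N → ℤ} (hl : Antitone l)
    {b : ℕ} (hb : b + k ≤ N) {x : Fin k → ℂ} (hx : ∀ i, x i ∉ badSet q)
    (hxi : Function.Injective x) :
    normSchur q l b x =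
      (Matrix.of fun i j : Fin k => rowPoly q (ex l) (b + j) ((q : ℂ) ^ b * x i)).det /
      (Matrix.of fun i j : Fin k => nodePoly q N ⟨b + j, by omega⟩ ((q : ℂ) ^ b * x i)).det := by
  have hq : (q : ℂ) ≠ 0 := by exact_mod_cast hq0.ne'
  have hx0 : x ∈ torus k := fun i h => hx i (Or.inl h)
  have hins : insertedVars q N b x ∈ regularTorus N :=
    ⟨insertedVars_mem_torus hq0 b hx0, insertedVars_injective hq0 hq1 hb hx hxi⟩
  have hstd := qpow_mem_regularTorus (N := N) hq0 hq1
  have hv : Function.Injective fun m => (q : ℂ) ^ ex l m :=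
    (qzpow_injective hq0 hq1).comp (ex_strictAnti hl).injective
  have hzp : ∀ (i : ℕ) (m : Fin N), ((q : ℂ) ^ i) ^ ex l m = ((q : ℂ) ^ ex l m) ^ i := by
    intro i m
    rw [← zpow_natCast, ← zpow_natCast, zpow_comm]
  have d1 := det_replace_window (Matrix.of fun i j => ((q : ℂ) ^ (i : ℕ)) ^ ex l j) hb
    (fun i n => rowPoly q (ex l) n ((q : ℂ) ^ b * x i))
    (Matrix.of fun i j => insertedVars q N b x i ^ ex l j) (by
      intro i m
      simp only [Matrix.of_apply]
      rw [insertedVars_window q hb, lagrange_row hv (fun m => ((q : ℂ) ^ b * x i) ^ ex l m) m]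
      exact Finset.sum_congr rfl fun n _ => by rw [hzp]; rfl) (by
      intro i hi m
      simp only [Matrix.of_apply]
      rw [insertedVars_outside q x hi])
  have d2 := det_replace_window (Matrix.vandermonde fun i : Fin N => (q : ℂ) ^ (i : ℕ)) hb
    (fun i n => nodePoly q N n ((q : ℂ) ^ b * x i))
    (Matrix.vandermonde (insertedVars q N b x)) (by
      intro i m
      simp only [Matrix.vandermonde_apply]
      rw [insertedVars_window q hb, lagrange_pow (qpow_injective hq0 hq1) _ m]
      rfl) (by
      intro i hi m
      simp only [Matrix.vandermonde_apply]
      rw [insertedVars_outside q x hi])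
  rw [det_vandermonde_eq_vdm, det_vandermonde_eq_vdm] at d2
  have hV := vdm_ne_zero (qpow_injective (N := N) hq0 hq1)
  have hV' := vdm_ne_zero hins.2
  have hA : (Matrix.of fun i j : Fin N => ((q : ℂ) ^ (i : ℕ)) ^ ex l j).det ≠ 0 := by
    -- With variables `q^i` the alternant is itself a transposed Vandermonde matrix in the points
    -- `q^(e_j)`, which are distinct since the exponents are strictly decreasing.
    have : (Matrix.of fun i j : Fin N => ((q : ℂ) ^ (i : ℕ)) ^ ex l j)
        = (Matrix.vandermonde fun j => (q : ℂ) ^ ex l j).transpose := by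
      ext i j
      simp [hzp]
    rw [this, Matrix.det_transpose, det_vandermonde_eq_vdm]
    exact vdm_ne_zero hv
  have hsgn : (∏ i : Fin N, ∏ _j ∈ Finset.Iio i, (-1 : ℂ)) ≠ 0 :=
    Finset.prod_ne_zero_iff.2 fun _ _ => Finset.prod_ne_zero_iff.2 fun _ _ => by norm_num
  have hL : (Matrix.of fun i j : Fin k =>
      nodePoly q N ⟨b + j, by omega⟩ ((q : ℂ) ^ b * x i)).det ≠ 0 := by
    intro h
    rw [h, zero_mul] at d2
    exact hV' d2
  rw [normSchur, schur_eq l hins, schur_eq l hstd, vandermonde_eq_vdm, vandermonde_eq_vdm, d1, d2]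
  field_simp

/-! ### Reduction to one variable -/

/-- The normalized Schur function in one variable. -/
def oneVar (q : ℝ) (l : Fin N → ℤ) (b : ℕ) (x : ℂ) : ℂ := normSchur q l b fun _ : Fin 1 => x

theorem differentiableOn_oneVar {q : ℝ} (hq0 : 0 < q) (l : Fin N → ℤ) (b : ℕ) :
    DifferentiableOn ℂ (oneVar q l b) {0}ᶜ :=
  (differentiableOn_normSchur hq0 l b).comp
    (differentiable_pi.2 fun _ => differentiable_id).differentiableOn fun _ hx _ => hx

theorem oneVar_generic {q : ℝ} (hq0 : 0 < q) (hq1 : q < 1) {l : Fin N → ℤ} (hl : Antitone l)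
    {b : ℕ} (hb : b < N) {x : ℂ} (hx : x ∉ badSet q) :
    oneVar q l b x = rowPoly q (ex l) b ((q : ℂ) ^ b * x) / nodePoly q N ⟨b, hb⟩ ((q : ℂ) ^ b * x) := by
  rw [oneVar, normSchur_generic hq0 hq1 hl (by omega) (fun _ => hx) fun i j _ => Subsingleton.elim i j]
  simp

theorem badSet_mul {q : ℝ} (hq0 : 0 < q) {x : ℂ} (hx : x ∉ badSet q) (n : ℤ) :
    x * (q : ℂ) ^ n ∉ badSet q := by
  have hq : (q : ℂ) ≠ 0 := by exact_mod_cast hq0.ne'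
  rintro (h | ⟨m, hm⟩)
  · rcases mul_eq_zero.1 h with h | h
    · exact hx (Or.inl h)
    · exact zpow_ne_zero _ hq h
  · refine hx (Or.inr ⟨m - n, ?_⟩)
    simp only at hm ⊢
    rw [zpow_sub₀ hq, hm, mul_div_cancel_right₀ _ (zpow_ne_zero _ hq)]

/-- The entries of the determinantal formula built on the one-variable functions `G j`. -/
def hatFun (q : ℝ) (G : Fin k → ℂ → ℂ) (j : Fin k) (x : ℂ) : ℂ :=
  G j (x * (q : ℂ) ^ (-((j : ℕ) : ℤ))) * windowProd q j x

theorem differentiable_windowProd (q : ℝ) (j : Fin k) : Differentiable ℂ (windowProd q j) := by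
  unfold windowProd
  fun_prop

theorem differentiableOn_hatFun {q : ℝ} (hq0 : 0 < q) {G : Fin k → ℂ → ℂ}
    (hG : ∀ j, DifferentiableOn ℂ (G j) {0}ᶜ) (j : Fin k) :
    DifferentiableOn ℂ (hatFun q G j) {0}ᶜ := by
  have hq : (q : ℂ) ≠ 0 := by exact_mod_cast hq0.ne'
  refine DifferentiableOn.mul ((hG j).comp (by fun_prop) fun x hx => ?_)
    (differentiable_windowProd q j).differentiableOn
  exact mul_ne_zero hx (zpow_ne_zero _ hq)

/-- Up to factors depending on one index only, `∏_{s ≠ j} (x q^(-s) - 1)` is a Lagrange basis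
polynomial at the nodes `q ^ m`. -/
theorem windowProd_factor {q : ℝ} (hq0 : 0 < q) (hq1 : q < 1) {b : ℕ} (hb : b + k ≤ N) :
    ∃ (α : Fin k → ℂ) (β : ℂ → ℂ), (∀ j, α j ≠ 0) ∧ ∀ x ∉ badSet q, β x ≠ 0 ∧
      ∀ j : Fin k, nodePoly q N ⟨b + j, by omega⟩ ((q : ℂ) ^ b * x) ≠ 0 ∧ windowProd q j x =
        α j * (β x * nodePoly q N ⟨b + j, by omega⟩ ((q : ℂ) ^ b * x)) := by
  have hq : (q : ℂ) ≠ 0 := by exact_mod_cast hq0.ne'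
  have hw := qpow_injective (N := N) hq0 hq1
  set D : Fin N → ℂ := fun n =>
    ∏ m ∈ Finset.univ.erase n, ((q : ℂ) ^ (n : ℕ) - (q : ℂ) ^ (m : ℕ)) with hD
  have hD0 : ∀ n, D n ≠ 0 := fun n => Finset.prod_ne_zero_iff.2 fun m hm =>
    sub_ne_zero.2 fun h => (Finset.ne_of_mem_erase hm).symm (hw h)
  refine ⟨fun j => (q : ℂ) ^ (b + (j : ℕ)) * D ⟨b + j, by omega⟩,
    fun x => (∏ s : Fin k, (x * (q : ℂ) ^ (-((s : ℕ) : ℤ)) - 1)) *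
      (∏ m : Fin N, ((q : ℂ) ^ b * x - (q : ℂ) ^ (m : ℕ)))⁻¹,
    fun j => mul_ne_zero (pow_ne_zero _ hq) (hD0 _), fun x hx => ?_⟩
  have h1 : ∀ s : ℕ, x * (q : ℂ) ^ (-(s : ℤ)) - 1 ≠ 0 := fun s h => hx (Or.inr ⟨s, by
    have := sub_eq_zero.1 h
    rw [zpow_neg] at this
    field_simp at this
    exact this.symm⟩)
  have h2 : ∀ m : Fin N, (q : ℂ) ^ b * x - (q : ℂ) ^ (m : ℕ) ≠ 0 := fun m h =>
    hx (Or.inr ⟨(m : ℤ) - b, by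
      have := sub_eq_zero.1 h
      simp only [zpow_sub₀ hq, zpow_natCast]
      rw [← this]
      field_simp⟩)
  have h3 : ∀ n : Fin N, nodePoly q N n ((q : ℂ) ^ b * x)
      = (∏ m ∈ Finset.univ.erase n, ((q : ℂ) ^ b * x - (q : ℂ) ^ (m : ℕ))) / D n := fun n => by
    rw [nodePoly, eval_lagrange_basis, Finset.prod_div_distrib]
  have h4 : ∀ n : Fin N, ∏ m ∈ Finset.univ.erase n, ((q : ℂ) ^ b * x - (q : ℂ) ^ (m : ℕ)) ≠ 0 :=
    fun n => Finset.prod_ne_zero_iff.2 fun m _ => h2 m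
  refine ⟨mul_ne_zero (Finset.prod_ne_zero_iff.2 fun s _ => h1 s)
    (inv_ne_zero (Finset.prod_ne_zero_iff.2 fun m _ => h2 m)), fun j => ⟨?_, ?_⟩⟩
  · rw [h3]
    exact div_ne_zero (h4 _) (hD0 _)
  · beta_reduce
    rw [h3, windowProd, ← Finset.mul_prod_erase Finset.univ
        (fun s : Fin k => x * (q : ℂ) ^ (-((s : ℕ) : ℤ)) - 1) (Finset.mem_univ j),
      ← Finset.mul_prod_erase Finset.univ (fun m : Fin N => (q : ℂ) ^ b * x - (q : ℂ) ^ (m : ℕ))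
        (Finset.mem_univ ⟨b + j, by omega⟩)]
    have e1 : (q : ℂ) ^ b * x - (q : ℂ) ^ (b + (j : ℕ))
        = (q : ℂ) ^ (b + (j : ℕ)) * (x * (q : ℂ) ^ (-((j : ℕ) : ℤ)) - 1) := by
      rw [zpow_neg, zpow_natCast, pow_add]
      field_simp
    rw [e1]
    have h5 := h1 j
    have h6 := h4 ⟨b + j, by omega⟩
    have h7 := hD0 ⟨b + j, by omega⟩
    have h8 : (q : ℂ) ^ (b + (j : ℕ)) ≠ 0 := pow_ne_zero _ hq
    generalize ∏ m ∈ Finset.univ.erase (⟨b + j, by omega⟩ : Fin N),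
      ((q : ℂ) ^ b * x - (q : ℂ) ^ (m : ℕ)) = Z at h6 ⊢
    field_simp

/-- Passing to the one-variable quotients multiplies entry `(i, j)` by a factor in `i` and a factor
in `j`. The same factors appear in the determinant of the window products, which is the Vandermonde
product up to `detConst`, so they cancel. -/
theorem normSchur_eq_altQuot {q : ℝ} (hq0 : 0 < q) (hq1 : q < 1) {l : Fin N → ℤ} (hl : Antitone l)
    {b : ℕ} (hb : b + k ≤ N) {x : Fin k → ℂ} (hx : ∀ i, x i ∉ badSet q)
    (hxi : Function.Injective x) :
    normSchur q l b x =
      detConst q k * altQuot (hatFun q fun j : Fin k => oneVar q l (b + j)) x := by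
  have hq : (q : ℂ) ≠ 0 := by exact_mod_cast hq0.ne'
  obtain ⟨α, β, hα, hβ⟩ := windowProd_factor hq0 hq1 hb
  have e1 : (Matrix.of fun i j => hatFun q (fun j : Fin k => oneVar q l (b + j)) j (x i)).det =
      (∏ j, α j) * ((∏ i, β (x i)) * (Matrix.of fun i j : Fin k =>
        rowPoly q (ex l) (b + j) ((q : ℂ) ^ b * x i)).det) := by
    rw [← Matrix.det_mul_column, ← Matrix.det_mul_row]
    congr 1
    ext i j
    simp only [Matrix.of_apply, hatFun]
    rw [oneVar_generic hq0 hq1 hl (show b + (j : ℕ) < N by omega) (badSet_mul hq0 (hx i) _),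
      ((hβ _ (hx i)).2 j).2]
    have h1 := ((hβ _ (hx i)).2 j).1
    -- The argument `x_i q^(-j)` compensates for moving the insertion point from `b` to `b + j`.
    have e : (q : ℂ) ^ (b + (j : ℕ)) * (x i * (q : ℂ) ^ (-((j : ℕ) : ℤ))) = (q : ℂ) ^ b * x i := by
      rw [zpow_neg, zpow_natCast, pow_add]
      field_simp
    rw [e]
    field_simp
  have e2 : (Matrix.of fun i j : Fin k => windowProd q j (x i)).det =
      (∏ j, α j) * ((∏ i, β (x i)) * (Matrix.of fun i j : Fin k =>
        nodePoly q N ⟨b + j, by omega⟩ ((q : ℂ) ^ b * x i)).det) := by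
    rw [← Matrix.det_mul_column, ← Matrix.det_mul_row]
    congr 1
    ext i j
    exact ((hβ _ (hx i)).2 j).2
  have h1 := det_windowProd hq0 hq1 x
  have h2 := vdm_ne_zero hxi
  rw [normSchur_generic hq0 hq1 hl hb hx hxi, altQuot, e1, ← h1, e2]
  rw [← h1, e2] at h2
  have h3 : (∏ j, α j) ≠ 0 := Finset.prod_ne_zero_iff.2 fun j _ => hα j
  have h4 : (∏ i, β (x i)) ≠ 0 := Finset.prod_ne_zero_iff.2 fun i _ => (hβ _ (hx i)).1
  have h5 : detConst q k ≠ 0 := left_ne_zero_of_mul h2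
  have h6 := right_ne_zero_of_mul (right_ne_zero_of_mul (right_ne_zero_of_mul h2))
  field_simp

/-- Both sides are continuous on the torus and agree at the generic points, which are dense. -/
theorem normSchur_eq_altExt {q : ℝ} (hq0 : 0 < q) (hq1 : q < 1) {l : Fin N → ℤ} (hl : Antitone l)
    {b : ℕ} (hb : b + k ≤ N) {x : Fin k → ℂ} (hx : x ∈ torus k) :
    normSchur q l b x =
      detConst q k * altExt (hatFun q fun j : Fin k => oneVar q l (b + j)) x := by
  have hG := differentiableOn_hatFun hq0 fun j : Fin k => differentiableOn_oneVar hq0 l (b + j)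
  set A : Set (Fin k → ℂ) := {y | (∀ i, y i ∉ badSet q) ∧ Function.Injective y}
  have hA : x ∈ closure A := mem_closure_generic x (badSet_countable q)
  have := mem_closure_iff_nhdsWithin_neBot.1 hA
  have t1 : Tendsto (normSchur q l b) (𝓝[A] x) (𝓝 (normSchur q l b x)) :=
    (((differentiableOn_normSchur hq0 l b).continuousOn).continuousAt
      (isOpen_torus.mem_nhds hx)).tendsto.mono_left nhdsWithin_le_nhds
  have t2 : Tendsto (fun x => detConst q k *
      altExt (hatFun q fun j : Fin k => oneVar q l (b + j)) x) (𝓝[A] x)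
      (𝓝 (detConst q k * altExt (hatFun q fun j : Fin k => oneVar q l (b + j)) x)) :=
    (((differentiableOn_altExt hG).continuousOn.continuousAt
      (isOpen_torus.mem_nhds hx)).tendsto.mono_left nhdsWithin_le_nhds).const_mul _
  refine tendsto_nhds_unique (t1.congr' ?_) t2
  filter_upwards [self_mem_nhdsWithin] with y hy
  rw [normSchur_eq_altQuot hq0 hq1 hl hb hy.1 hy.2,
    altExt_eq hG ⟨fun i h => hy.1 i (Or.inl h), hy.2⟩]

theorem phiDet_eq (q : ℝ) (t : ℤ → ℤ) (x : Fin k → ℂ) :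
    phiDet q t x = detConst q k *
      altQuot (hatFun q fun j : Fin k => Phi q (shift (((j : ℕ) : ℤ) + 1) t)) x := by
  rw [phiDet, vandermonde_rev, detConst, altQuot, ← div_div, mul_div_assoc', div_mul_eq_mul_div]
  rfl

theorem PhiMulti_eq {q : ℝ} (hq0 : 0 < q) (t : ℤ → ℤ)
    (hP : ∀ j : Fin k, DifferentiableOn ℂ (Phi q (shift (((j : ℕ) : ℤ) + 1) t)) {0}ᶜ)
    {x : Fin k → ℂ} (hx : x ∈ torus k) :
    PhiMulti q t k x = detConst q k *
      altExt (hatFun q fun j : Fin k => Phi q (shift (((j : ℕ) : ℤ) + 1) t)) x :=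
  extendFrom_const_mul_altQuot (differentiableOn_hatFun hq0 hP) (fun y _ => phiDet_eq q t y) hx

end
end QSchur

namespace QSchur
noncomputable section
variable {k N : ℕ}

/-! ### A residue theorem on a horizontal strip -/

theorem tendsto_log_add_sub_log (c : ℂ) :
    Tendsto (fun R : ℝ => Complex.log (R + c) - Real.log R) atTop (𝓝 0) := by
  have h1 : Tendsto (fun R : ℝ => 1 + c / (R : ℂ)) atTop (𝓝 1) := by
    have : Tendsto (fun R : ℝ => c / (R : ℂ)) atTop (𝓝 0) := by
      simp only [div_eq_mul_inv, ← Complex.ofReal_inv]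
      have h := ((Complex.continuous_ofReal.tendsto 0).comp
        (tendsto_inv_atTop_zero (𝕜 := ℝ))).const_mul c
      simpa using h
    simpa using this.const_add 1
  have h2 : Tendsto (fun R : ℝ => Complex.log (1 + c / (R : ℂ))) atTop (𝓝 0) := by
    have h := (continuousAt_clog (x := 1) (by simp)).tendsto.comp h1
    simpa [Function.comp_def] using h
  refine h2.congr' ?_
  filter_upwards [eventually_gt_atTop 0, h1.eventually_ne one_ne_zero] with R hR hne
  have hR' : (R : ℂ) ≠ 0 := by exact_mod_cast hR.ne'
  rw [show (R : ℂ) + c = R * (1 + c / R) by field_simp, Complex.log_ofReal_mul hR hne]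
  ring

theorem tendsto_log_neg_add_sub_log_of_pos {c : ℂ} (hc : 0 < c.im) :
    Tendsto (fun R : ℝ => Complex.log (-R + c) - Real.log R) atTop (𝓝 (Real.pi * Complex.I)) := by
  have h1 := tendsto_log_add_sub_log (-c)
  have h2 : Tendsto (fun R : ℝ => Complex.log (R + -c) - Real.log R + Real.pi * Complex.I) atTop
      (𝓝 (Real.pi * Complex.I)) := by simpa using h1.add_const (Real.pi * Complex.I)
  refine h2.congr fun R => ?_
  have h3 : (-((R : ℂ) + -c)).im = c.im := by simp
  have e : (-(R : ℂ) + c) = -(R + -c) := by ring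
  rw [e, Complex.log, Complex.log, norm_neg, Complex.arg_neg_eq_arg_add_pi_of_im_neg (by simpa using hc)]
  push_cast
  ring

theorem tendsto_log_neg_add_sub_log_of_neg {c : ℂ} (hc : c.im < 0) :
    Tendsto (fun R : ℝ => Complex.log (-R + c) - Real.log R) atTop
      (𝓝 (-(Real.pi * Complex.I))) := by
  have h1 := tendsto_log_add_sub_log (-c)
  have h2 : Tendsto (fun R : ℝ => Complex.log (R + -c) - Real.log R - Real.pi * Complex.I) atTop
      (𝓝 (-(Real.pi * Complex.I))) := by simpa using h1.sub_const (Real.pi * Complex.I)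
  refine h2.congr fun R => ?_
  have e : (-(R : ℂ) + c) = -(R + -c) := by ring
  rw [e, Complex.log, Complex.log, norm_neg, Complex.arg_neg_eq_arg_sub_pi_of_im_pos (by simpa using hc)]
  push_cast
  ring

theorem integral_inv_add {c : ℂ} (hc : c.im ≠ 0) (R : ℝ) :
    ∫ r in (-R)..R, ((r : ℂ) + c)⁻¹ = Complex.log (R + c) - Complex.log (-R + c) := by
  have hmem : ∀ r : ℝ, (r : ℂ) + c ∈ Complex.slitPlane := fun r => Or.inr (by simpa using hc)
  have h1 : ∀ r : ℝ, HasDerivAt (fun r : ℝ => Complex.log (r + c)) ((r : ℂ) + c)⁻¹ r := fun r => by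
    have h := ((Complex.ofRealCLM.hasDerivAt (x := r)).add_const c).clog_real (hmem r)
    simpa using h
  rw [intervalIntegral.integral_eq_sub_of_hasDerivAt fun r _ => h1 r]
  · simp
  · refine Continuous.intervalIntegrable ?_ _ _
    exact (by fun_prop : Continuous fun r : ℝ => (r : ℂ) + c).inv₀ fun r =>
      Complex.slitPlane_ne_zero (hmem r)

/-- The principal logarithm is a primitive on each line. The right ends contribute nothing in the
limit; at the left ends the two lines lie on opposite sides of the cut and contribute `πi` each. -/
theorem tendsto_integral_inv_strip {h : ℝ} {p : ℂ} (hp : |p.im| < h) :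
    Tendsto (fun R : ℝ => (∫ r in (-R)..R, ((r : ℂ) + ((-h : ℝ) : ℂ) * Complex.I - p)⁻¹)
      - ∫ r in (-R)..R, ((r : ℂ) + (h : ℂ) * Complex.I - p)⁻¹) atTop
      (𝓝 (2 * Real.pi * Complex.I)) := by
  obtain ⟨h1, h2⟩ := abs_lt.1 hp
  have i1 : (((-h : ℝ) : ℂ) * Complex.I - p).im < 0 := by simp; linarith
  have i2 : 0 < ((h : ℂ) * Complex.I - p).im := by simp; linarith
  simp only [add_sub_assoc]
  simp only [integral_inv_add i1.ne, integral_inv_add i2.ne']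
  have t := ((tendsto_log_add_sub_log (((-h : ℝ) : ℂ) * Complex.I - p)).sub
    (tendsto_log_neg_add_sub_log_of_neg i1)).sub
    ((tendsto_log_add_sub_log ((h : ℂ) * Complex.I - p)).sub
      (tendsto_log_neg_add_sub_log_of_pos i2))
  refine (t.congr fun R => ?_).trans (le_of_eq ?_)
  · ring
  · congr 1; ring

/-- The closed strip. -/
def strip (h : ℝ) : Set ℂ := {u | |u.im| ≤ h}

theorem tendsto_side_of_bound {h : ℝ} {G : ℂ → ℂ} {B : ℝ → ℝ} (hB : Tendsto B atTop (𝓝 0))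
    (hG : ∀ᶠ R in atTop, ∀ u ∈ strip h, |u.re| = R → ‖G u‖ ≤ B R) (hh : 0 < h) (σ : ℝ) (hσ : |σ| = 1) :
    Tendsto (fun R : ℝ => ∫ y in (-h)..h, G (((σ * R : ℝ) : ℂ) + y * Complex.I)) atTop (𝓝 0) := by
  have hB2 : Tendsto (fun R => B R * |h - -h|) atTop (𝓝 0) := by simpa using hB.mul_const |h - -h|
  refine squeeze_zero_norm' ?_ hB2
  filter_upwards [hG, eventually_gt_atTop 0] with R hR hR0
  refine intervalIntegral.norm_integral_le_of_norm_le_const fun y hy => hR _ ?_ ?_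
  · rw [Set.uIoc_of_le (by linarith)] at hy
    simp only [strip, Set.mem_ofPred_eq]
    simpa using abs_le.2 ⟨hy.1.le, hy.2⟩
  · simp [abs_mul, hσ, abs_of_pos hR0]

/-- Cauchy's theorem on rectangles is applied to the holomorphic part `F` only; the simple poles are
integrated explicitly by logarithms. The left-hand side is the boundary integral in the positive
direction: lower line minus upper line. -/
theorem strip_residue {h : ℝ} (hh : 0 < h) {ι : Type*} (S : Finset ι) (p ρ : ι → ℂ)
    (hp : ∀ i ∈ S, |(p i).im| < h) {F G : ℂ → ℂ} (hF : DifferentiableOn ℂ F (strip h))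
    (hG : ∀ u ∈ strip h, (∀ i ∈ S, u ≠ p i) → G u = F u + ∑ i ∈ S, ρ i / (u - p i))
    (hdec : ∃ C R₀, ∀ u ∈ strip h, R₀ ≤ |u.re| → ‖G u‖ ≤ C * Real.exp (-|u.re|))
    (hi : ∀ c ∈ ({h, -h} : Set ℝ), Integrable fun r : ℝ => G (linePt c r)) :
    (∫ r : ℝ, G (linePt (-h) r)) - ∫ r : ℝ, G (linePt h r)
      = 2 * Real.pi * Complex.I * ∑ i ∈ S, ρ i := by
  obtain ⟨C, R₀, hC⟩ := hdec
  have hrect : ∀ R : ℝ, ((∫ x in (-R)..R, F ((x : ℂ) + ((-h : ℝ) : ℂ) * Complex.I))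
      - ∫ x in (-R)..R, F ((x : ℂ) + (h : ℂ) * Complex.I))
      + Complex.I • (∫ y in (-h)..h, F (((1 * R : ℝ) : ℂ) + y * Complex.I))
      - Complex.I • (∫ y in (-h)..h, F ((((-1) * R : ℝ) : ℂ) + y * Complex.I)) = 0 := by
    intro R
    have := Complex.integral_boundary_rect_eq_zero_of_differentiableOn F
      ⟨-R, -h⟩ ⟨R, h⟩ (hF.mono fun u hu => by
        rw [Complex.mem_reProdIm] at hu
        have h2 := hu.2
        simp only at h2
        rw [Set.uIcc_of_le (by linarith)] at h2
        exact abs_le.2 h2)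
    simpa using this
  -- bottom and top sides
  have hline : ∀ c ∈ ({h, -h} : Set ℝ), ∀ r : ℝ, linePt c r ∈ strip h ∧ ∀ i ∈ S, linePt c r ≠ p i := by
    intro c hc r
    have hc' : |c| = h := by
      rcases hc with rfl | rfl
      · exact abs_of_pos hh
      · rw [abs_neg, abs_of_pos hh]
    have him : (linePt c r).im = c := by simp [linePt]
    refine ⟨by simp [strip, him, hc'], fun i hi h => ?_⟩
    have := hp i hi
    rw [← h, him, hc'] at this
    exact lt_irrefl _ this
  have hdec0 : Tendsto (fun R : ℝ => C * Real.exp (-R)) atTop (𝓝 0) := by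
    simpa using (Real.tendsto_exp_neg_atTop_nhds_zero).const_mul C
  have hGside : ∀ σ : ℝ, |σ| = 1 →
      Tendsto (fun R : ℝ => ∫ y in (-h)..h, G (((σ * R : ℝ) : ℂ) + y * Complex.I)) atTop (𝓝 0) := by
    intro σ hσ
    refine tendsto_side_of_bound hdec0 ?_ hh σ hσ
    filter_upwards [eventually_ge_atTop R₀] with R hR u hu hR2
    rw [← hR2]
    exact hC u hu (hR2 ▸ hR)
  have hpside : ∀ σ : ℝ, |σ| = 1 → ∀ i, Tendsto (fun R : ℝ => ∫ y in (-h)..h,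
      ρ i / ((((σ * R : ℝ) : ℂ) + y * Complex.I) - p i)) atTop (𝓝 0) := by
    intro σ hσ i
    have hB : Tendsto (fun R : ℝ => ‖ρ i‖ * (R - |(p i).re|)⁻¹) atTop (𝓝 0) := by
      simpa [sub_eq_add_neg] using ((tendsto_atTop_add_const_right _ (-|(p i).re|)
        tendsto_id).inv_tendsto_atTop).const_mul ‖ρ i‖
    refine tendsto_side_of_bound (G := fun u => ρ i / (u - p i)) hB ?_ hh σ hσ
    filter_upwards [eventually_gt_atTop |(p i).re|] with R hR u hu hR2
    rw [norm_div, div_eq_mul_inv]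
    refine mul_le_mul_of_nonneg_left (inv_anti₀ (by linarith) ?_) (norm_nonneg _)
    calc R - |(p i).re| = |u.re| - |(p i).re| := by rw [hR2]
      _ ≤ |u.re - (p i).re| := abs_sub_abs_le_abs_sub _ _
      _ = |(u - p i).re| := by simp
      _ ≤ ‖u - p i‖ := Complex.abs_re_le_norm _
  have hfin : ∀ c ∈ ({h, -h} : Set ℝ), ∀ R : ℝ,
      ∫ x in (-R)..R, G (linePt c x) = (∫ x in (-R)..R, F (linePt c x))
        + ∑ i ∈ S, ρ i * ∫ x in (-R)..R, (linePt c x - p i)⁻¹ := by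
    intro c hc R
    have hcl : Continuous (linePt c) := by unfold linePt; fun_prop
    have cF : Continuous fun x => F (linePt c x) :=
      hF.continuousOn.comp_continuous hcl fun x => (hline c hc x).1
    have cp : ∀ i ∈ S, Continuous fun x => ρ i * (linePt c x - p i)⁻¹ := fun i hi =>
      continuous_const.mul ((hcl.sub continuous_const).inv₀ fun x =>
        sub_ne_zero.2 ((hline c hc x).2 i hi))
    rw [intervalIntegral.integral_congr (g := fun x => F (linePt c x) +
      ∑ i ∈ S, ρ i * (linePt c x - p i)⁻¹) fun x _ => by
        simpa only [div_eq_mul_inv] using hG _ (hline c hc x).1 (hline c hc x).2,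
      intervalIntegral.integral_add (cF.intervalIntegrable _ _)
        ((continuous_finsetSum _ cp).intervalIntegrable _ _),
      intervalIntegral.integral_finsetSum fun i hi => (cp i hi).intervalIntegrable _ _]
    simp only [intervalIntegral.integral_const_mul]
  have hside : ∀ σ : ℝ, |σ| = 1 → ∀ᶠ R : ℝ in atTop,
      ∫ y in (-h)..h, G (((σ * R : ℝ) : ℂ) + y * Complex.I)
        = (∫ y in (-h)..h, F (((σ * R : ℝ) : ℂ) + y * Complex.I))
        + ∑ i ∈ S, ∫ y in (-h)..h, ρ i / ((((σ * R : ℝ) : ℂ) + y * Complex.I) - p i) := by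
    intro σ hσ
    have hev : ∀ᶠ R : ℝ in atTop, ∀ i ∈ S, |(p i).re| < R :=
      (Finset.eventually_all S).2 fun i _ => eventually_gt_atTop _
    filter_upwards [hev, eventually_gt_atTop 0] with R hR hR0
    have hne : ∀ i ∈ S, ∀ y : ℝ, (((σ * R : ℝ) : ℂ) + y * Complex.I) ≠ p i := by
      intro i hi y h
      have h1 := hR i hi
      rw [← h] at h1
      simp [abs_mul, hσ, abs_of_pos hR0] at h1
    have hst : ∀ y ∈ Set.uIcc (-h) h, (((σ * R : ℝ) : ℂ) + y * Complex.I) ∈ strip h := by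
      intro y hy
      rw [Set.uIcc_of_le (by linarith)] at hy
      simpa [strip] using abs_le.2 hy
    have hcl : Continuous fun y : ℝ => (((σ * R : ℝ) : ℂ) + y * Complex.I) := by fun_prop
    have cF : ContinuousOn (fun y : ℝ => F (((σ * R : ℝ) : ℂ) + y * Complex.I)) (Set.uIcc (-h) h) :=
      hF.continuousOn.comp hcl.continuousOn hst
    have cp : ∀ i ∈ S, Continuous fun y : ℝ => ρ i / ((((σ * R : ℝ) : ℂ) + y * Complex.I) - p i) :=
      fun i hi => continuous_const.div (hcl.sub continuous_const) fun y =>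
        sub_ne_zero.2 (hne i hi y)
    rw [intervalIntegral.integral_congr fun y hy => hG _ (hst y hy) fun i hi => hne i hi y,
      intervalIntegral.integral_add cF.intervalIntegrable
        ((continuous_finsetSum _ cp).intervalIntegrable _ _),
      intervalIntegral.integral_finsetSum fun i hi => (cp i hi).intervalIntegrable _ _]
  -- limits
  have hlimG : ∀ c ∈ ({h, -h} : Set ℝ), Tendsto (fun R : ℝ => ∫ x in (-R)..R, G (linePt c x)) atTop
      (𝓝 (∫ r : ℝ, G (linePt c r))) := fun c hc =>
    intervalIntegral_tendsto_integral (hi c hc) tendsto_neg_atTop_atBot tendsto_id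
  have T1 := (hlimG (-h) (by simp)).sub (hlimG h (by simp))
  have T2 : Tendsto (fun R : ℝ => ∑ i ∈ S, ρ i * ((∫ x in (-R)..R, (linePt (-h) x - p i)⁻¹)
      - ∫ x in (-R)..R, (linePt h x - p i)⁻¹)) atTop
      (𝓝 (∑ i ∈ S, ρ i * (2 * Real.pi * Complex.I))) :=
    tendsto_finsetSum _ fun i hi => (tendsto_integral_inv_strip (hp i hi)).const_mul (ρ i)
  -- `F` need not decay as fast as `G`: its integrals over the short sides vanish as differences of
  -- those of `G` and of the polar parts.
  have T3 : ∀ σ : ℝ, |σ| = 1 → Tendsto (fun R : ℝ => Complex.I *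
      ((∫ y in (-h)..h, G (((σ * R : ℝ) : ℂ) + y * Complex.I)) -
        ∑ i ∈ S, ∫ y in (-h)..h, ρ i / ((((σ * R : ℝ) : ℂ) + y * Complex.I) - p i))) atTop (𝓝 0) := by
    intro σ hσ
    have := ((hGside σ hσ).sub (tendsto_finsetSum S fun i _ => hpside σ hσ i)).const_mul Complex.I
    simpa using this
  have T4 := (T2.sub (T3 1 (by simp))).add (T3 (-1) (by simp))
  have T5 : Tendsto (fun R : ℝ => (∫ x in (-R)..R, G (linePt (-h) x))
      - ∫ x in (-R)..R, G (linePt h x)) atTop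
      (𝓝 (∑ i ∈ S, ρ i * (2 * Real.pi * Complex.I) - 0 + 0)) := by
    refine T4.congr' ?_
    filter_upwards [hside 1 (by simp), hside (-1) (by simp)] with R h1 h2
    have h3 := hrect R
    rw [hfin (-h) (by simp), hfin h (by simp), h1, h2]
    simp only [mul_sub, Finset.sum_sub_distrib, smul_eq_mul] at h3 ⊢
    unfold linePt at *
    linear_combination -h3
  rw [tendsto_nhds_unique T1 T5, Finset.mul_sum, sub_zero, add_zero]
  exact Finset.sum_congr rfl fun i _ => mul_comm _ _

end
end QSchur

namespace QSchur
noncomputable section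
variable {k N K : ℕ}

/-! ### Quotients by products of exponential factors -/

/-- `exp (L u)`. -/
def W (L : ℝ) (u : ℂ) : ℂ := Complex.exp (L * u)

theorem W_ne_zero (L : ℝ) (u : ℂ) : W L u ≠ 0 := Complex.exp_ne_zero _

theorem norm_W (L : ℝ) (u : ℂ) : ‖W L u‖ = Real.exp (L * u.re) := by
  rw [W, Complex.norm_exp]
  simp

theorem differentiable_W (L : ℝ) : Differentiable ℂ (W L) := by
  unfold W; fun_prop

theorem deriv_W (L : ℝ) (u : ℂ) : deriv (W L) u = L * W L u := by
  have : HasDerivAt (W L) (Complex.exp (L * u) * (L * 1)) u :=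
    ((hasDerivAt_id u).const_mul (L : ℂ)).cexp
  rw [this.deriv, W]
  ring

/-- Equality of exponentials of two points whose imaginary parts are close. -/
theorem W_inj {L : ℝ} (hL : L ≠ 0) {u v : ℂ} (h : W L u = W L v)
    (him : |L * (u.im - v.im)| < 2 * Real.pi) : u = v := by
  have hL' : (L : ℂ) ≠ 0 := by exact_mod_cast hL
  obtain ⟨n, hn⟩ := Complex.exp_eq_exp_iff_exists_int.1 h
  have h2 : L * (u.im - v.im) = n * (2 * Real.pi) := by
    have := congrArg Complex.im hn
    simp at this
    linarith
  rw [h2, abs_mul, abs_of_pos Real.two_pi_pos] at him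
  have h3 : |(n : ℝ)| < 1 := by
    by_contra hcon
    push Not at hcon
    nlinarith [Real.two_pi_pos]
  have h4 : n = 0 := by
    rw [← Int.cast_abs] at h3
    have : |n| < 1 := by exact_mod_cast h3
    exact Int.abs_lt_one_iff.1 this
  rw [h4] at hn
  simp at hn
  exact hn.resolve_right hL

theorem integrable_exp_neg_abs : Integrable fun r : ℝ => Real.exp (-|r|) := by
  have h1 : IntegrableOn (fun r : ℝ => Real.exp (-|r|)) (Set.Ioi 0) :=
    (integrableOn_exp_neg_Ioi 0).congr_fun (fun r hr => by
      rw [abs_of_pos (Set.mem_Ioi.1 hr)]) measurableSet_Ioi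
  have h2 : IntegrableOn (fun r : ℝ => Real.exp (-|r|)) (Set.Iic 0) :=
    (integrableOn_exp_Iic 0).congr_fun (fun r hr => by
      rw [abs_of_nonpos (Set.mem_Iic.1 hr), neg_neg]) measurableSet_Iic
  have h3 := h2.union h1
  rwa [Set.Iic_union_Ioi, integrableOn_univ] at h3

theorem integrable_of_continuous_of_bound {f : ℝ → ℂ} (hf : Continuous f) {C R₀ : ℝ}
    (hb : ∀ r, R₀ ≤ |r| → ‖f r‖ ≤ C * Real.exp (-|r|)) : Integrable f := by
  obtain ⟨C₁, hC₁⟩ := (isCompact_Icc (a := -R₀) (b := R₀)).exists_bound_of_continuousOn hf.continuousOn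
  refine (integrable_exp_neg_abs.const_mul (max C (C₁ * Real.exp R₀))).mono'
    hf.aestronglyMeasurable (Eventually.of_forall fun r => ?_)
  rcases le_total R₀ |r| with h | h
  · exact (hb r h).trans (mul_le_mul_of_nonneg_right (le_max_left _ _) (Real.exp_pos _).le)
  · have h1 := hC₁ r (abs_le.1 h)
    have h0 : 0 ≤ C₁ := (norm_nonneg _).trans h1
    have h2 : C₁ ≤ (C₁ * Real.exp R₀) * Real.exp (-|r|) := by
      rw [mul_assoc, ← Real.exp_add]
      exact le_mul_of_one_le_right h0 (Real.one_le_exp (by linarith))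
    exact (h1.trans h2).trans (mul_le_mul_of_nonneg_right (le_max_right _ _) (Real.exp_pos _).le)

/-- A quotient of an entire function by a product of exponential factors. -/
def quot (L : ℝ) (A : ℂ → ℂ) (p : Fin K → ℂ) (u : ℂ) : ℂ := A u * ∏ i, (W L u - W L (p i))⁻¹

theorem norm_cpow_le_strip {x : ℂ} (hx : x ≠ 0) {h : ℝ} {u : ℂ} (hu : u ∈ strip h) :
    ‖x ^ u‖ ≤ Real.exp (Real.log ‖x‖ * u.re) * Real.exp (Real.pi * h) := by
  rw [Complex.norm_cpow_of_ne_zero hx, Real.rpow_def_of_pos (norm_pos_iff.2 hx), div_eq_mul_inv,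
    ← Real.exp_neg]
  refine mul_le_mul_of_nonneg_left (Real.exp_le_exp.2 ?_) (Real.exp_pos _).le
  calc -(x.arg * u.im) ≤ |x.arg * u.im| := neg_le_abs _
    _ = |x.arg| * |u.im| := abs_mul _ _
    _ ≤ Real.pi * h := mul_le_mul (Complex.abs_arg_le_pi x) hu (abs_nonneg _) Real.pi_pos.le

/-- For `Re u → +∞` the denominators tend to constants, and `x^u W^n` decays by `h1`. For `Re u →
-∞` each of the `K` denominators grows like `W`, and `h2` gives the decay. -/
theorem quot_decay {L : ℝ} (hL : L < 0) {h : ℝ} {x : ℂ} (hx : x ≠ 0) (c : ℂ) (n : ℕ) (p : Fin K → ℂ)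
    (h1 : Real.log ‖x‖ + L * n ≤ -1) (h2 : 1 ≤ Real.log ‖x‖ + L * n - L * K) :
    ∃ C R₀, ∀ u ∈ strip h, R₀ ≤ |u.re| →
      ‖quot L (fun u => c * x ^ u * W L u ^ n) p u‖ ≤ C * Real.exp (-|u.re|) := by
  have t1 : Tendsto (fun R : ℝ => Real.exp (L * R)) atTop (𝓝 0) :=
    Real.tendsto_exp_atBot.comp (tendsto_id.const_mul_atTop_of_neg hL)
  have t2 : Tendsto (fun R : ℝ => Real.exp (L * -R)) atTop atTop := by
    have : Tendsto (fun R : ℝ => (-L) * R) atTop atTop :=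
      tendsto_id.const_mul_atTop (by linarith)
    exact Real.tendsto_exp_atTop.comp (this.congr fun R => by ring)
  have hev : ∀ᶠ R : ℝ in atTop, ∀ i, Real.exp (L * R) ≤ ‖W L (p i)‖ / 2 ∧
      2 * ‖W L (p i)‖ ≤ Real.exp (L * -R) := by
    refine eventually_all.2 fun i => ?_
    have h0 : 0 < ‖W L (p i)‖ / 2 := half_pos (norm_pos_iff.2 (W_ne_zero _ _))
    filter_upwards [t1.eventually_le_const h0, t2.eventually_ge_atTop (2 * ‖W L (p i)‖)] with R a b
      using ⟨a, b⟩
  obtain ⟨R₁, hR₁⟩ := eventually_atTop.1 hev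
  set E := ‖c‖ * Real.exp (Real.pi * h) with hE
  have hE0 : 0 ≤ E := by positivity
  refine ⟨max (E * ∏ i, (‖W L (p i)‖ / 2)⁻¹) (E * 2 ^ K), max R₁ 0, fun u hu hR => ?_⟩
  have hR1 : R₁ ≤ |u.re| := (le_max_left _ _).trans hR
  have hbase : ‖c * x ^ u * W L u ^ n‖ ≤ E * Real.exp ((Real.log ‖x‖ + L * n) * u.re) := by
    rw [norm_mul, norm_mul, norm_pow, norm_W, ← Real.exp_nat_mul]
    have e : Real.exp ((Real.log ‖x‖ + L * n) * u.re) =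
        Real.exp (Real.log ‖x‖ * u.re) * Real.exp (n * (L * u.re)) := by
      rw [← Real.exp_add]; congr 1; ring
    rw [e, hE]
    calc ‖c‖ * ‖x ^ u‖ * Real.exp (n * (L * u.re))
        ≤ ‖c‖ * (Real.exp (Real.log ‖x‖ * u.re) * Real.exp (Real.pi * h)) *
          Real.exp (n * (L * u.re)) := by
          gcongr
          exact norm_cpow_le_strip hx hu
      _ = _ := by ring
  rw [quot, norm_mul, norm_prod]
  simp only [norm_inv]
  rcases le_total 0 u.re with hs | hs
  · rw [abs_of_nonneg hs] at hR1 ⊢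
    have hprod : ∏ i, ‖W L u - W L (p i)‖⁻¹ ≤ ∏ i, (‖W L (p i)‖ / 2)⁻¹ := by
      refine Finset.prod_le_prod (fun _ _ => by positivity) fun i _ => ?_
      refine inv_anti₀ (half_pos (norm_pos_iff.2 (W_ne_zero _ _))) ?_
      have h3 := (hR₁ _ hR1 i).1
      have h4 := norm_sub_norm_le (W L (p i)) (W L u)
      rw [norm_sub_rev, norm_W L u] at h4
      linarith
    calc _ ≤ (E * Real.exp ((Real.log ‖x‖ + L * n) * u.re)) * ∏ i, (‖W L (p i)‖ / 2)⁻¹ := by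
          gcongr
      _ ≤ (E * Real.exp (-u.re)) * ∏ i, (‖W L (p i)‖ / 2)⁻¹ := by
          gcongr
          nlinarith
      _ = (E * ∏ i, (‖W L (p i)‖ / 2)⁻¹) * Real.exp (-u.re) := by ring
      _ ≤ _ := mul_le_mul_of_nonneg_right (le_max_left _ _) (Real.exp_pos _).le
  · rw [abs_of_nonpos hs] at hR1 ⊢
    have hprod : ∏ i, ‖W L u - W L (p i)‖⁻¹ ≤ ∏ _i : Fin K, (Real.exp (L * u.re) / 2)⁻¹ := by
      refine Finset.prod_le_prod (fun _ _ => by positivity) fun i _ => ?_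
      refine inv_anti₀ (by positivity) ?_
      have h3 := (hR₁ _ hR1 i).2
      have h4 := norm_sub_norm_le (W L u) (W L (p i))
      rw [norm_W L u] at h4
      rw [neg_neg] at h3
      linarith
    have e2 : ∏ _i : Fin K, (Real.exp (L * u.re) / 2)⁻¹ = 2 ^ K * Real.exp (-(L * K) * u.re) := by
      rw [Finset.prod_const, Finset.card_univ, Fintype.card_fin, inv_div, div_pow,
        ← Real.exp_nat_mul, div_eq_mul_inv, ← Real.exp_neg]
      congr 2; ring
    rw [e2] at hprod
    calc _ ≤ (E * Real.exp ((Real.log ‖x‖ + L * n) * u.re)) *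
          (2 ^ K * Real.exp (-(L * K) * u.re)) := by gcongr
      _ = (E * 2 ^ K) * Real.exp ((Real.log ‖x‖ + L * n - L * K) * u.re) := by
          rw [show (Real.log ‖x‖ + L * n - L * K) * u.re
            = (Real.log ‖x‖ + L * n) * u.re + -(L * K) * u.re by ring, Real.exp_add]
          ring
      _ ≤ (E * 2 ^ K) * Real.exp (- -u.re) := by
          gcongr
          nlinarith
      _ ≤ _ := mul_le_mul_of_nonneg_right (le_max_right _ _) (Real.exp_pos _).le

/-- The residue of `quot L A p` at `p i`. -/
def quotRes (L : ℝ) (A : ℂ → ℂ) (p : Fin K → ℂ) (i : Fin K) : ℂ :=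
  (∏ j ∈ Finset.univ.erase i, (W L (p i) - W L (p j))⁻¹) * (A (p i) / (L * W L (p i)))

/-- The period of `W` is `4h`, so `W - W p` has no zero in the strip other than `p`. Dividing `A` by
the slope of `W` therefore leaves a holomorphic function over `u - p`, and its own slope is the
regular part. -/
theorem quot_pole {L h : ℝ} (hL : L < 0) (hLh : -L * h = Real.pi / 2) {A : ℂ → ℂ}
    (hA : Differentiable ℂ A) {p : ℂ} (hp : |p.im| < h) :
    ∃ F : ℂ → ℂ, DifferentiableOn ℂ F (strip h) ∧ ∀ u ∈ strip h, u ≠ p →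
      A u * (W L u - W L p)⁻¹ = F u + (A p / (L * W L p)) / (u - p) := by
  have hL' : (L : ℂ) ≠ 0 := by exact_mod_cast hL.ne
  set E := dslope (W L) p with hE
  have hEd : Differentiable ℂ E := by
    rw [← differentiableOn_univ, hE, Complex.differentiableOn_dslope univ_mem]
    exact (differentiable_W L).differentiableOn
  have hEp : E p = L * W L p := by rw [hE, dslope_same, deriv_W]
  have hEne : ∀ u, u ≠ p → E u = (W L u - W L p) / (u - p) := fun u hu => by
    rw [hE, dslope_of_ne _ hu, slope_def_field]
  have hWne : ∀ u ∈ strip h, u ≠ p → W L u - W L p ≠ 0 := by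
    intro u hu hne h0
    refine hne (W_inj hL.ne (sub_eq_zero.1 h0) ?_)
    have h1 : |u.im - p.im| < 2 * h := by
      calc |u.im - p.im| ≤ |u.im| + |p.im| := abs_sub _ _
        _ < 2 * h := by have : |u.im| ≤ h := hu; linarith
    rw [abs_mul, abs_of_neg hL]
    nlinarith [Real.pi_pos]
  have hE0 : ∀ u ∈ strip h, E u ≠ 0 := by
    intro u hu
    by_cases hup : u = p
    · rw [hup, hEp]; exact mul_ne_zero hL' (W_ne_zero _ _)
    · rw [hEne u hup]
      exact div_ne_zero (hWne u hu hup) (sub_ne_zero.2 hup)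
  set U : Set ℂ := {u | E u ≠ 0} with hU
  have hUo : IsOpen U := isOpen_ne_fun hEd.continuous continuous_const
  set B : ℂ → ℂ := fun u => A u / E u with hB
  have hBd : DifferentiableOn ℂ B U := hA.differentiableOn.div hEd.differentiableOn fun u hu => hu
  have hpU : U ∈ 𝓝 p := hUo.mem_nhds (hE0 p hp.le)
  refine ⟨dslope B p, ((Complex.differentiableOn_dslope hpU).2 hBd).mono hE0, fun u hu hne => ?_⟩
  have h1 := sub_ne_zero.2 hne
  have h2 := hWne u hu hne
  have h3 : (L : ℂ) * W L p ≠ 0 := mul_ne_zero hL' (W_ne_zero _ _)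
  rw [dslope_of_ne _ hne, slope_def_field]
  simp only [hB]
  rw [hEp, hEne u hne]
  field_simp
  ring

/-- Partial fractions in the variable `W` reduce to one pole at a time. The alternative `h < |Im p|
≤ 2h` is needed for the pole at `v`, which leaves the strip on half of the `v`-segment; since
imaginary parts then differ by less than the period, no translate of it enters. -/
theorem strip_residue_quot {L h : ℝ} (hL : L < 0) (hLh : -L * h = Real.pi / 2) {A : ℂ → ℂ}
    (hA : Differentiable ℂ A) (hK : 0 < K) {p : Fin K → ℂ} (hinj : Function.Injective fun i => W L (p i))
    (hp : ∀ i, |(p i).im| < h ∨ (h < |(p i).im| ∧ |(p i).im| ≤ 2 * h))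
    (hdec : ∃ C R₀, ∀ u ∈ strip h, R₀ ≤ |u.re| → ‖quot L A p u‖ ≤ C * Real.exp (-|u.re|)) :
    (∫ r : ℝ, quot L A p (linePt (-h) r)) - ∫ r : ℝ, quot L A p (linePt h r)
      = 2 * Real.pi * Complex.I * ∑ i with |(p i).im| < h, quotRes L A p i := by
  have hh : 0 < h := by
    by_contra hcon
    push Not at hcon
    nlinarith [Real.pi_pos]
  have hne : ∀ u ∈ strip h, (∀ i, |(p i).im| < h → u ≠ p i) → ∀ i, W L u - W L (p i) ≠ 0 := by
    intro u hu hup i h0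
    have hui : |u.im| ≤ h := hu
    have : u = p i := by
      refine W_inj hL.ne (sub_eq_zero.1 h0) ?_
      have h1 : |u.im - (p i).im| < 4 * h := by
        have := abs_sub u.im (p i).im
        rcases hp i with h2 | h2 <;> linarith
      rw [abs_mul, abs_of_neg hL]
      nlinarith [Real.pi_pos]
    rcases hp i with h2 | h2
    · exact hup i h2 this
    · rw [this] at hui; linarith
  have hsplit : ∀ u ∈ strip h, (∀ i, |(p i).im| < h → u ≠ p i) → quot L A p u
      = ∑ i, (∏ j ∈ Finset.univ.erase i, (W L (p i) - W L (p j))⁻¹) *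
        (A u * (W L u - W L (p i))⁻¹) := by
    intro u hu hup
    rw [quot, prod_inv_sub_eq_sum ⟨⟨0, hK⟩, Finset.mem_univ _⟩ hinj (hne u hu hup), Finset.mul_sum]
    exact Finset.sum_congr rfl fun i _ => by ring
  have hF : ∀ i, ∃ F : ℂ → ℂ, DifferentiableOn ℂ F (strip h) ∧ ∀ u ∈ strip h,
      (∀ i, |(p i).im| < h → u ≠ p i) → A u * (W L u - W L (p i))⁻¹ =
        F u + if |(p i).im| < h then (A (p i) / (L * W L (p i))) / (u - p i) else 0 := by
    intro i
    rcases hp i with h2 | h2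
    · obtain ⟨F, hF1, hF2⟩ := quot_pole hL hLh hA h2
      exact ⟨F, hF1, fun u hu hup => by rw [if_pos h2]; exact hF2 u hu (hup i h2)⟩
    · refine ⟨fun u => A u * (W L u - W L (p i))⁻¹, ?_, fun u hu hup => by
        rw [if_neg (not_lt.2 h2.1.le), add_zero]⟩
      refine hA.differentiableOn.mul (((differentiable_W L).sub_const _).differentiableOn.inv
        fun u hu h0 => ?_)
      have hui : |u.im| ≤ h := hu
      have : u = p i := by
        refine W_inj hL.ne (sub_eq_zero.1 h0) ?_
        have h1 : |u.im - (p i).im| < 4 * h := by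
          have := abs_sub u.im (p i).im
          linarith
        rw [abs_mul, abs_of_neg hL]
        nlinarith [Real.pi_pos]
      rw [this] at hui
      linarith
  choose F hF1 hF2 using hF
  have key := strip_residue hh (Finset.univ.filter fun i => |(p i).im| < h) p (quotRes L A p)
    (fun i hi => (Finset.mem_filter.1 hi).2)
    (F := fun u => ∑ i, (∏ j ∈ Finset.univ.erase i, (W L (p i) - W L (p j))⁻¹) * F i u)
    (G := quot L A p)
    (DifferentiableOn.fun_sum fun i _ => (hF1 i).const_mul _) ?_ hdec ?_
  · exact key
  · intro u hu hup
    have hup' : ∀ i, |(p i).im| < h → u ≠ p i := fun i hi =>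
      hup i (Finset.mem_filter.2 ⟨Finset.mem_univ _, hi⟩)
    rw [hsplit u hu hup', Finset.sum_filter, ← Finset.sum_add_distrib]
    refine Finset.sum_congr rfl fun i _ => ?_
    rw [hF2 i u hu hup', mul_add]
    congr 1
    split_ifs
    · rw [quotRes, mul_div_assoc]
    · ring
  · intro c hc
    have hc' : |c| = h := by
      rcases hc with rfl | rfl
      · exact abs_of_pos hh
      · rw [abs_neg, abs_of_pos hh]
    have him : ∀ r, (linePt c r).im = c := fun r => by simp [linePt]
    have hre : ∀ r, (linePt c r).re = r := fun r => by simp [linePt]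
    have hst : ∀ r, linePt c r ∈ strip h := fun r => by simp [strip, him, hc']
    have hcl : Continuous (linePt c) := by unfold linePt; fun_prop
    obtain ⟨C, R₀, hC⟩ := hdec
    refine integrable_of_continuous_of_bound (C := C) (R₀ := R₀) ?_ fun r hr => by
      have := hC _ (hst r) (by rwa [hre])
      rwa [hre] at this
    unfold quot
    refine (hA.continuous.comp hcl).mul (continuous_finsetProd _ fun i _ => Continuous.inv₀
      (((differentiable_W L).continuous.comp hcl).sub continuous_const) fun r => ?_)
    refine hne _ (hst r) (fun j hj h0 => ?_) i
    rw [← h0, him, hc'] at hj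
    exact lt_irrefl _ hj

end
end QSchur

namespace QSchur
noncomputable section
variable {k N K : ℕ}

/-! ### The contour integral formula for finitely many nodes -/

/-- The integrand with the products truncated to `B` and `M` factors. -/
def integrandFin (q : ℝ) (t : ℤ → ℤ) (B M : ℕ) (x v u : ℂ) : ℂ :=
  x ^ u / (1 - (q : ℂ) ^ (v - u))
    * (∏ n ∈ Finset.range B, (1 - (q : ℂ) ^ ((t ((n : ℤ) + 1) : ℂ) + (n : ℂ) - v))
        / (1 - (q : ℂ) ^ ((t ((n : ℤ) + 1) : ℂ) + (n : ℂ) - u)))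
    * ∏ n ∈ Finset.range M, (1 - (q : ℂ) ^ ((n : ℂ) + 1 + v - (t (-(n : ℤ)) : ℂ)))
        / (1 - (q : ℂ) ^ ((n : ℂ) + 1 + u - (t (-(n : ℤ)) : ℂ)))

theorem q_cpow {q : ℝ} (hq0 : 0 < q) (z : ℂ) : (q : ℂ) ^ z = W (Real.log q) z := by
  rw [Complex.cpow_def_of_ne_zero (by exact_mod_cast hq0.ne'), W, Complex.ofReal_log hq0.le]

theorem W_add (L : ℝ) (u v : ℂ) : W L (u + v) = W L u * W L v := by
  rw [W, W, W, ← Complex.exp_add, mul_add]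

theorem W_sub (L : ℝ) (u v : ℂ) : W L (u - v) = W L u / W L v := by
  rw [W, W, W, ← Complex.exp_sub, mul_sub]

theorem W_int {q : ℝ} (hq0 : 0 < q) (n : ℤ) : W (Real.log q) n = (q : ℂ) ^ n := by
  rw [← q_cpow hq0, Complex.cpow_intCast]

/-- The nodes `t_i + i - 1`, `1 - M ≤ i ≤ B`, in decreasing order of `i`. -/
def nodes (t : ℤ → ℤ) (B M : ℕ) (j : Fin (B + M)) : ℤ := t ((B : ℤ) - (j : ℕ)) + ((B : ℤ) - (j : ℕ)) - 1

theorem prod_nodes (t : ℤ → ℤ) (B M : ℕ) (f : ℤ → ℂ) :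
    ∏ j, f (nodes t B M j) = (∏ n ∈ Finset.range B, f (t ((n : ℤ) + 1) + n)) *
      ∏ n ∈ Finset.range M, f (t (-(n : ℤ)) - n - 1) := by
  simp only [nodes]
  rw [Fin.prod_univ_eq_prod_range
    (fun j : ℕ => f (t ((B : ℤ) - (j : ℕ)) + ((B : ℤ) - (j : ℕ)) - 1)) (B + M), Finset.prod_range_add,
    ← Finset.prod_range_reflect]
  congr 1
  · refine Finset.prod_congr rfl fun n hn => ?_
    have h : n < B := Finset.mem_range.1 hn
    rw [show (B : ℤ) - ((B - 1 - n : ℕ) : ℤ) = n + 1 by omega]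
    congr 1
    ring
  · refine Finset.prod_congr rfl fun n _ => ?_
    rw [show (B : ℤ) - ((B + n : ℕ) : ℤ) = -(n : ℤ) by push_cast; ring]
    congr 1

/-- Each of the first `B` factors produces `W u / W v`, and the kernel `1 / (1 - q^(v-u))` produces
one more `W u`: hence the exponent `B + 1`. The kernel also adds the pole `v`, listed as the node
with index `0`. -/
theorem integrandFin_eq_quot {q : ℝ} (hq0 : 0 < q) (t : ℤ → ℤ) (B M : ℕ) (x v u : ℂ) :
    integrandFin q t B M x v u = quot (Real.log q)
      (fun u => ((W (Real.log q) v)⁻¹ ^ B * ∏ m, (W (Real.log q) v - (q : ℂ) ^ nodes t B M m)) *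
        x ^ u * W (Real.log q) u ^ (B + 1))
      (Fin.cons v fun m => (nodes t B M m : ℂ)) u := by
  set L := Real.log q with hL
  have hWi : ∀ n : ℤ, W L n = (q : ℂ) ^ n := fun n => W_int hq0 n
  have hv := W_ne_zero L v
  have hu := W_ne_zero L u
  have e1 : ∀ n : ℕ, (1 - (q : ℂ) ^ ((t ((n : ℤ) + 1) : ℂ) + (n : ℂ) - v)) /
      (1 - (q : ℂ) ^ ((t ((n : ℤ) + 1) : ℂ) + (n : ℂ) - u)) =
      (W L v - (q : ℂ) ^ (t ((n : ℤ) + 1) + n)) * (W L u - (q : ℂ) ^ (t ((n : ℤ) + 1) + n))⁻¹ *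
        (W L u * (W L v)⁻¹) := by
    intro n
    rw [q_cpow hq0, q_cpow hq0, W_sub, W_sub]
    have : (t ((n : ℤ) + 1) : ℂ) + (n : ℂ) = ((t ((n : ℤ) + 1) + n : ℤ) : ℂ) := by push_cast; ring
    rw [this, W_int hq0, ← hL, one_sub_div hv, one_sub_div hu, div_div_div_eq]
    rw [div_eq_mul_inv, mul_inv]
    ring
  have e2 : ∀ n : ℕ, (1 - (q : ℂ) ^ ((n : ℂ) + 1 + v - (t (-(n : ℤ)) : ℂ)))
        / (1 - (q : ℂ) ^ ((n : ℂ) + 1 + u - (t (-(n : ℤ)) : ℂ))) =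
      (W L v - (q : ℂ) ^ (t (-(n : ℤ)) - n - 1)) * (W L u - (q : ℂ) ^ (t (-(n : ℤ)) - n - 1))⁻¹ := by
    intro n
    have h0 : (q : ℂ) ^ (t (-(n : ℤ)) - n - 1) ≠ 0 := zpow_ne_zero _ (by exact_mod_cast hq0.ne')
    have : ∀ z : ℂ, (n : ℂ) + 1 + z - (t (-(n : ℤ)) : ℂ)
      = z - ((t (-(n : ℤ)) - n - 1 : ℤ) : ℂ) := fun z => by push_cast; ring
    rw [this, this, q_cpow hq0, q_cpow hq0, W_sub, W_sub, W_int hq0, ← hL, one_sub_div h0,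
      one_sub_div h0, div_div_div_cancel_right₀ h0, div_eq_mul_inv,
      ← neg_sub (W L v), ← neg_sub (W L u), inv_neg, neg_mul_neg]
  rw [integrandFin, quot, Fin.prod_univ_succ]
  simp only [Fin.cons_zero, Fin.cons_succ, hWi, e1, e2]
  rw [prod_nodes t B M fun m => W L v - (q : ℂ) ^ m,
    prod_nodes t B M fun m => (W L u - (q : ℂ) ^ m)⁻¹]
  simp only [Finset.prod_mul_distrib, Finset.prod_const, Finset.card_range]
  rw [q_cpow hq0, W_sub, ← hL, one_sub_div hu, div_div_eq_mul_div, div_eq_mul_inv (x ^ u * W L u)]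
  ring

/-- The coefficient `y_m^b [y^b] ℓ_m(y)` at the nodes `y_m = q^(a_m)`, with `ℓ_m` the Lagrange basis
polynomials. -/
def coef (q : ℝ) (a : Fin N → ℤ) (b : ℕ) (m : Fin N) : ℂ :=
  ((q : ℂ) ^ a m) ^ b * (Lagrange.basis Finset.univ (fun m => (q : ℂ) ^ a m) m).coeff b

theorem quotRes_node {q : ℝ} (hq0 : 0 < q) (t : ℤ → ℤ) (B M : ℕ)
    (hinj : Function.Injective (nodes t B M)) (hq1 : q < 1) (x v : ℂ)
    (hv : ∀ m, W (Real.log q) v ≠ (q : ℂ) ^ nodes t B M m) (m : Fin (B + M)) :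
    quotRes (Real.log q)
      (fun u => ((W (Real.log q) v)⁻¹ ^ B * ∏ m, (W (Real.log q) v - (q : ℂ) ^ nodes t B M m)) *
        x ^ u * W (Real.log q) u ^ (B + 1))
      (Fin.cons v fun m => (nodes t B M m : ℂ)) m.succ =
    -(Real.log q : ℂ)⁻¹ * (x ^ nodes t B M m * (((q : ℂ) ^ nodes t B M m) ^ B *
      ((W (Real.log q) v)⁻¹ ^ B *
      (Lagrange.basis Finset.univ (fun m => (q : ℂ) ^ nodes t B M m) m).eval (W (Real.log q) v)))) := by
  set L := Real.log q with hL
  set a := nodes t B M with ha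
  have hWi : ∀ n : ℤ, W L n = (q : ℂ) ^ n := fun n => W_int hq0 n
  have hL0 : (L : ℂ) ≠ 0 := by exact_mod_cast (Real.log_neg hq0 hq1).ne
  have hy0 : (q : ℂ) ^ a m ≠ 0 := zpow_ne_zero _ (by exact_mod_cast hq0.ne')
  have hyi : ∀ j ∈ Finset.univ.erase m, (q : ℂ) ^ a m - (q : ℂ) ^ a j ≠ 0 := fun j hj =>
    sub_ne_zero.2 fun h => (Finset.ne_of_mem_erase hj).symm (hinj (qzpow_injective hq0 hq1 h))
  have e1 : (Finset.univ.erase m.succ : Finset (Fin (B + M + 1)))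
      = insert 0 ((Finset.univ.erase m).map (Fin.succEmb _)) := by
    ext j
    refine Fin.cases ?_ (fun j => ?_) j
    · simp [(Fin.succ_ne_zero m).symm]
    · simp [Fin.succ_ne_zero]
  rw [quotRes, e1, Finset.prod_insert (by simp [Fin.succ_ne_zero]), Finset.prod_map, eval_lagrange_basis]
  simp only [Fin.cons_succ, Fin.cons_zero, Fin.coe_succEmb, hWi, Complex.cpow_intCast]
  rw [Finset.prod_div_distrib, Finset.prod_inv_distrib, ← Finset.mul_prod_erase Finset.univ
    (fun m => W L v - (q : ℂ) ^ a m) (Finset.mem_univ m)]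
  have h1 : ∏ j ∈ Finset.univ.erase m, ((q : ℂ) ^ a m - (q : ℂ) ^ a j) ≠ 0 :=
    Finset.prod_ne_zero_iff.2 hyi
  have h2 := sub_ne_zero.2 (hv m)
  have h3 : (q : ℂ) ^ a m - W L v ≠ 0 := sub_ne_zero.2 (hv m).symm
  have e : (q : ℂ) ^ a m - W L v = -(W L v - (q : ℂ) ^ a m) := by ring
  rw [e]
  generalize ∏ j ∈ Finset.univ.erase m, ((q : ℂ) ^ a m - (q : ℂ) ^ a j) = Z1 at h1 ⊢
  generalize ∏ j ∈ Finset.univ.erase m, (W L v - (q : ℂ) ^ a j) = Z2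
  generalize W L v - (q : ℂ) ^ a m = Z3 at h2 ⊢
  generalize (W L v)⁻¹ ^ B = Z4
  rw [pow_succ]
  field_simp

/-- At `u = v` all factors of the products cancel, so only the residue of the kernel is left. -/
theorem quotRes_zero {q : ℝ} (hq0 : 0 < q) (t : ℤ → ℤ) (B M : ℕ) (hq1 : q < 1) (x v : ℂ)
    (hv : ∀ m, W (Real.log q) v ≠ (q : ℂ) ^ nodes t B M m) :
    quotRes (Real.log q)
      (fun u => ((W (Real.log q) v)⁻¹ ^ B * ∏ m, (W (Real.log q) v - (q : ℂ) ^ nodes t B M m)) *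
        x ^ u * W (Real.log q) u ^ (B + 1))
      (Fin.cons v fun m => (nodes t B M m : ℂ)) 0 = x ^ v / (Real.log q : ℂ) := by
  set L := Real.log q with hL
  set a := nodes t B M with ha
  have hWi : ∀ n : ℤ, W L n = (q : ℂ) ^ n := fun n => W_int hq0 n
  have hL0 : (L : ℂ) ≠ 0 := by exact_mod_cast (Real.log_neg hq0 hq1).ne
  have hw := W_ne_zero L v
  have e1 : (Finset.univ.erase 0 : Finset (Fin (B + M + 1)))
      = Finset.univ.map (Fin.succEmb _) := by
    ext j
    refine Fin.cases ?_ (fun j => ?_) j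
    · simp [Fin.succ_ne_zero]
    · simp [Fin.succ_ne_zero]
  rw [quotRes, e1, Finset.prod_map]
  simp only [Fin.cons_succ, Fin.cons_zero, Fin.coe_succEmb, hWi]
  rw [Finset.prod_inv_distrib]
  have h1 : ∏ j, (W L v - (q : ℂ) ^ a j) ≠ 0 :=
    Finset.prod_ne_zero_iff.2 fun j _ => sub_ne_zero.2 (hv j)
  generalize ∏ j, (W L v - (q : ℂ) ^ a j) = Z at h1 ⊢
  rw [pow_succ, inv_pow]
  field_simp

theorem log_mul_half {q : ℝ} (hq0 : 0 < q) (hq1 : q < 1) :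
    -Real.log q * -(Real.pi / (2 * Real.log q)) = Real.pi / 2 := by
  have := (Real.log_neg hq0 hq1).ne
  field_simp

/-- The residues at the nodes appear as Lagrange basis polynomials evaluated at `W v`. The residue
at `v` occurs only for `|s| < h`, exactly on the range of the single integral. The size conditions
on `B` and `M` ensure decay along the lines. -/
theorem lineIntegral_integrandFin {q : ℝ} (hq0 : 0 < q) (hq1 : q < 1) {t : ℤ → ℤ} {B M : ℕ}
    (hinj : Function.Injective (nodes t B M)) {x : ℂ} (hx : x ≠ 0)
    (h1 : Real.log ‖x‖ + Real.log q * (B + 1) ≤ -1) (h2 : 1 ≤ Real.log ‖x‖ - Real.log q * M)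
    {h : ℝ} (hh : h = -(Real.pi / (2 * Real.log q))) {s : ℝ} (hs0 : s ≠ 0) (hs1 : |s| ≠ h)
    (hs2 : |s| ≤ 2 * h) :
    lineIntegral q (fun u => integrandFin q t B M x (s * Complex.I) u) =
      (if |s| < h then x ^ ((s : ℂ) * Complex.I) / (Real.log q : ℂ) else 0) +
      -(Real.log q : ℂ)⁻¹ * ∑ m, (x ^ nodes t B M m * (((q : ℂ) ^ nodes t B M m) ^ B *
      ((W (Real.log q) (s * Complex.I))⁻¹ ^ B *
      (Lagrange.basis Finset.univ (fun m => (q : ℂ) ^ nodes t B M m) m).eval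
        (W (Real.log q) (s * Complex.I))))) := by
  set L := Real.log q with hL
  have hLneg : L < 0 := Real.log_neg hq0 hq1
  have hLh : -L * h = Real.pi / 2 := by rw [hh]; exact log_mul_half hq0 hq1
  have hpos : 0 < h := by
    by_contra hcon
    push Not at hcon
    nlinarith [Real.pi_pos]
  set v : ℂ := (s : ℂ) * Complex.I with hv
  have hvim : v.im = s := by simp [hv]
  -- `|W v| = 1` on the imaginary axis, so a coincidence with `q^n` would force `n = 0`, and then `s
  -- = 0` because `|s|` is below one period.
  have hWv : ∀ n : ℤ, W L v ≠ (q : ℂ) ^ n := by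
    intro n hn
    rw [← W_int hq0, ← hL] at hn
    have hnorm := congrArg norm hn
    rw [norm_W, norm_W] at hnorm
    have e0 := Real.exp_injective hnorm
    simp [hv] at e0
    rcases e0 with e0 | e0
    · exact hLneg.ne e0
    · rw [e0] at hn
      have := W_inj hLneg.ne hn (by
        rw [hvim, abs_mul, abs_of_neg hLneg]
        simp
        nlinarith [Real.pi_pos])
      apply hs0
      have := congrArg Complex.im this
      simpa [hvim] using this
  set A : ℂ → ℂ := fun u => ((W L v)⁻¹ ^ B * ∏ m, (W L v - (q : ℂ) ^ nodes t B M m)) *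
        x ^ u * W L u ^ (B + 1) with hA
  set p : Fin (B + M + 1) → ℂ := Fin.cons v fun m => (nodes t B M m : ℂ) with hp
  have hAd : Differentiable ℂ A := by
    refine Differentiable.mul (Differentiable.const_mul ?_ _) ((differentiable_W L).pow _)
    exact fun u => (differentiableAt_id.const_cpow (Or.inl hx))
  have hpinj : Function.Injective fun i => W L (p i) := by
    intro i j hij
    revert hij
    refine Fin.cases ?_ (fun i => ?_) i <;> refine Fin.cases ?_ (fun j => ?_) j
    · intro _; rfl
    · intro hij
      simp only [hp, Fin.cons_zero, Fin.cons_succ, hL, W_int hq0] at hij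
      exact absurd hij (hWv _)
    · intro hij
      simp only [hp, Fin.cons_zero, Fin.cons_succ, hL, W_int hq0] at hij
      exact absurd hij.symm (hWv _)
    · intro hij
      simp only [hp, Fin.cons_succ, hL, W_int hq0] at hij
      rw [hinj (qzpow_injective hq0 hq1 hij)]
  have hpim : ∀ m : Fin (B + M), (p m.succ).im = 0 := fun m => by simp [hp]
  have hp0 : p 0 = v := rfl
  have hres := strip_residue_quot hLneg hLh hAd (Nat.succ_pos _) hpinj (by
    intro i
    refine Fin.cases ?_ (fun m => ?_) i
    · rw [hp0, hvim]
      rcases lt_or_gt_of_ne hs1 with hlt | hgt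
      · exact Or.inl hlt
      · exact Or.inr ⟨hgt, hs2⟩
    · left; rw [hpim]; simpa using hpos) (quot_decay hLneg hx _ (B + 1) p
        (by push_cast; exact h1) (by push_cast; linarith))
  have hfun : ∀ u, integrandFin q t B M x v u = quot L A p u := fun u =>
    integrandFin_eq_quot hq0 t B M x v u
  -- As `log q < 0`, the line with imaginary part `π / (2 log q)` is the lower one.
  have e1 : Real.pi / (2 * Real.log q) = -h := by rw [hh, neg_neg]
  simp only [lineIntegral, hfun]
  rw [e1, neg_neg, hres, mul_div_cancel_left₀ _ Complex.two_pi_I_ne_zero,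
    Finset.sum_filter, Fin.sum_univ_succ, hp0, hvim]
  congr 1
  · split_ifs
    · exact quotRes_zero hq0 t B M hq1 x v fun m => hWv _
    · rfl
  · rw [Finset.mul_sum]
    refine Finset.sum_congr rfl fun m _ => ?_
    rw [hpim, abs_zero, if_pos hpos]
    exact quotRes_node hq0 t B M hinj hq1 x v (fun m => hWv _) m

end
end QSchur

/-! ### The `v`-integral as extraction of a Lagrange coefficient -/

namespace QSchur
noncomputable section
variable {k N K : ℕ}

theorem integral_W_pow {L h : ℝ} (hL : L < 0) (hLh : -L * h = Real.pi / 2) {n : ℤ} (hn : n ≠ 0) :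
    ∫ s in (-(2 * h))..(2 * h), W L ((s : ℂ) * Complex.I) ^ n = 0 := by
  have hL' : (L : ℂ) ≠ 0 := by exact_mod_cast hL.ne
  have hn' : (n : ℂ) ≠ 0 := by exact_mod_cast hn
  have hc : (n * L * Complex.I : ℂ) ≠ 0 := mul_ne_zero (mul_ne_zero hn' hL') Complex.I_ne_zero
  have e1 : ∀ s : ℝ, W L ((s : ℂ) * Complex.I) ^ n = Complex.exp (n * L * Complex.I * s) := by
    intro s
    rw [W, ← Complex.exp_int_mul]
    congr 1; ring
  simp only [e1]
  rw [integral_exp_mul_complex hc, div_eq_zero_iff]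
  left
  rw [sub_eq_zero, Complex.exp_eq_exp_iff_exists_int]
  refine ⟨-n, ?_⟩
  have e2 : (-L * h : ℂ) = Real.pi / 2 := by exact_mod_cast hLh
  push_cast
  linear_combination (-4 * (n : ℂ) * Complex.I) * e2

theorem continuous_W_line (L : ℝ) : Continuous fun s : ℝ => W L ((s : ℂ) * Complex.I) :=
  (differentiable_W L).continuous.comp (by fun_prop)

/-- Orthogonality of characters over the full period `4h`. -/
theorem integral_W_coeff {L h : ℝ} (hL : L < 0) (hLh : -L * h = Real.pi / 2) (B : ℕ)
    (P : Polynomial ℂ) :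
    ∫ s in (-(2 * h))..(2 * h), (W L ((s : ℂ) * Complex.I))⁻¹ ^ B *
      P.eval (W L ((s : ℂ) * Complex.I)) = 4 * h * P.coeff B := by
  have hW := continuous_W_line L
  have e1 : ∀ s : ℝ, (W L ((s : ℂ) * Complex.I))⁻¹ ^ B * P.eval (W L ((s : ℂ) * Complex.I)) =
      ∑ i ∈ Finset.range (max (P.natDegree + 1) (B + 1)),
        P.coeff i * W L ((s : ℂ) * Complex.I) ^ ((i : ℤ) - B) := by
    intro s
    have hw := W_ne_zero L ((s : ℂ) * Complex.I)
    rw [Polynomial.eval_eq_sum_range' (n := max (P.natDegree + 1) (B + 1))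
      (lt_of_lt_of_le (Nat.lt_succ_self _) (le_max_left _ _)), Finset.mul_sum]
    refine Finset.sum_congr rfl fun i _ => ?_
    rw [zpow_sub₀ hw, zpow_natCast, zpow_natCast, inv_pow]
    field_simp
  have hint : ∀ i : ℕ, IntervalIntegrable (fun s : ℝ =>
      P.coeff i * W L ((s : ℂ) * Complex.I) ^ ((i : ℤ) - B)) volume (-(2 * h)) (2 * h) := fun i =>
    (continuous_const.mul (hW.zpow₀ _ fun s => Or.inl (W_ne_zero _ _))).intervalIntegrable _ _
  simp only [e1]
  rw [intervalIntegral.integral_finsetSum fun i _ => hint i,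
    Finset.sum_eq_single_of_mem B (Finset.mem_range.2 (lt_of_lt_of_le (Nat.lt_succ_self _)
      (le_max_right _ _)))]
  · simp only [sub_self, zpow_zero, mul_one, intervalIntegral.integral_const, Complex.real_smul]
    push_cast
    ring
  · intro i _ hiB
    rw [intervalIntegral.integral_const_mul, integral_W_pow hL hLh (by omega), mul_zero]

/-- The Laurent polynomial `∑ y_m^b [y^b] ℓ_m(y) x^(a_m)` with the nodes `y_m = q^(a_m)`. -/
def laurentSum (q : ℝ) (a : Fin N → ℤ) (b : ℕ) (x : ℂ) : ℂ := ∑ m, coef q a b m * x ^ a m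

/-- The difference of the double and of the single integral. -/
def contourDiff (q : ℝ) (x : ℂ) (f : ℂ → ℂ → ℂ) : ℂ :=
  imagIntegral (-(Real.pi / Real.log q)) (Real.pi / Real.log q) (fun v => lineIntegral q fun u => f v u)
    - imagIntegral (-(Real.pi / (2 * Real.log q))) (Real.pi / (2 * Real.log q))
      (fun v => x ^ v / (Real.log q : ℂ))

/-- The `v`-integral turns each interpolation polynomial into its coefficient of degree `B`, and the
residue at `u = v` cancels against the single integral. -/
theorem contourDiff_integrandFin {q : ℝ} (hq0 : 0 < q) (hq1 : q < 1) {t : ℤ → ℤ} {B M : ℕ}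
    (hinj : Function.Injective (nodes t B M)) {x : ℂ} (hx : x ≠ 0)
    (h1 : Real.log ‖x‖ + Real.log q * (B + 1) ≤ -1) (h2 : 1 ≤ Real.log ‖x‖ - Real.log q * M) :
    contourDiff q x (integrandFin q t B M x) =
      -((Real.log q : ℂ) ^ 2)⁻¹ * laurentSum q (nodes t B M) B x := by
  set L := Real.log q with hL
  have hLneg : L < 0 := Real.log_neg hq0 hq1
  have hL0 : (L : ℂ) ≠ 0 := by exact_mod_cast hLneg.ne
  obtain ⟨h, hh⟩ : ∃ h, h = -(Real.pi / (2 * L)) := ⟨_, rfl⟩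
  have hLh : -L * h = Real.pi / 2 := by rw [hh]; exact log_mul_half hq0 hq1
  have hpos : 0 < h := by
    by_contra hcon
    push Not at hcon
    nlinarith [Real.pi_pos]
  have e1 : Real.pi / L = -(2 * h) := by
    rw [hh]; field_simp
  have e2 : Real.pi / (2 * L) = -h := by rw [hh, neg_neg]
  set g : ℝ → ℂ := fun s => ∑ m, (x ^ nodes t B M m * (((q : ℂ) ^ nodes t B M m) ^ B *
      ((W L (s * Complex.I))⁻¹ ^ B *
      (Lagrange.basis Finset.univ (fun m => (q : ℂ) ^ nodes t B M m) m).eval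
        (W L (s * Complex.I))))) with hg
  set f : ℝ → ℂ := fun s => x ^ ((s : ℂ) * Complex.I) / (L : ℂ) with hf
  have hW := continuous_W_line L
  have hterm : ∀ m, Continuous fun s : ℝ => (W L (s * Complex.I))⁻¹ ^ B *
      (Lagrange.basis Finset.univ (fun m => (q : ℂ) ^ nodes t B M m) m).eval (W L (s * Complex.I)) :=
    fun m => ((hW.inv₀ fun s => W_ne_zero _ _).pow B).mul
      ((Polynomial.continuous _).comp hW)
  have hgc : Continuous g := continuous_finsetSum _ fun m _ =>
    continuous_const.mul (continuous_const.mul (hterm m))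
  have hfc : Continuous f := by
    have : Continuous fun s : ℝ => x ^ ((s : ℂ) * Complex.I) :=
      Continuous.const_cpow (by fun_prop) (Or.inl hx)
    exact this.div_const _
  have hgint : ∫ s in (-(2 * h))..(2 * h), g s = 4 * h * laurentSum q (nodes t B M) B x := by
    have hi : ∀ m ∈ Finset.univ, IntervalIntegrable (fun s : ℝ =>
        (x ^ nodes t B M m * (((q : ℂ) ^ nodes t B M m) ^ B * ((W L (s * Complex.I))⁻¹ ^ B *
        (Lagrange.basis Finset.univ (fun m => (q : ℂ) ^ nodes t B M m) m).eval
          (W L (s * Complex.I)))))) volume (-(2 * h)) (2 * h) := fun m _ =>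
      (continuous_const.mul (continuous_const.mul (hterm m))).intervalIntegrable _ _
    simp only [hg]
    rw [intervalIntegral.integral_finsetSum hi, laurentSum, Finset.mul_sum]
    refine Finset.sum_congr rfl fun m _ => ?_
    rw [intervalIntegral.integral_const_mul, intervalIntegral.integral_const_mul,
      integral_W_coeff hLneg hLh, coef]
    ring
  have hind : ∫ s in (-(2 * h))..(2 * h), (Set.Ioo (-h) h).indicator f s = ∫ s in (-h)..h, f s := by
    rw [intervalIntegral.integral_of_le (by linarith), intervalIntegral.integral_of_le (by linarith),
      setIntegral_indicator measurableSet_Ioo, integral_Ioc_eq_integral_Ioo]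
    congr 2
    ext s
    simp only [Set.mem_inter_iff, Set.mem_Ioc, Set.mem_Ioo]
    constructor
    · exact fun hs => hs.2
    · exact fun hs => ⟨⟨by linarith [hs.1], by linarith [hs.2]⟩, hs⟩
  have hmain : ∫ s in (-(2 * h))..(2 * h), lineIntegral q
      (fun u => integrandFin q t B M x ((s : ℂ) * Complex.I) u) =
      (∫ s in (-h)..h, f s) + -(L : ℂ)⁻¹ * (4 * h * laurentSum q (nodes t B M) B x) := by
    rw [← hgint, ← hind, ← intervalIntegral.integral_const_mul, ← intervalIntegral.integral_add]
    · refine intervalIntegral.integral_congr_ae ?_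
      -- At `s = 0` the point `v` may coincide with a node, and at `s = ±h` it lies on the
      -- `u`-contour; these values form a null set.
      have hae : ∀ᵐ s : ℝ, s ∉ ({0, h, -h} : Set ℝ) :=
        ((Set.toFinite ({0, h, -h} : Set ℝ)).countable).ae_notMem volume
      filter_upwards [hae] with s hs hs2
      rw [Set.uIoc_of_le (by linarith)] at hs2
      simp only [Set.mem_insert_iff, Set.mem_singleton_iff, not_or] at hs
      have hs3 : |s| ≠ h := by
        intro h3
        rcases (abs_eq hpos.le).1 h3 with h4 | h4
        · exact hs.2.1 h4
        · exact hs.2.2 h4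
      rw [lineIntegral_integrandFin hq0 hq1 hinj hx h1 h2 hh hs.1 hs3 (abs_le.2 ⟨hs2.1.le, hs2.2⟩)]
      congr 1
      by_cases h5 : |s| < h
      · rw [if_pos h5, Set.indicator_of_mem (Set.mem_Ioo.2 (abs_lt.1 h5))]
      · rw [if_neg h5, Set.indicator_of_notMem fun h6 => h5 (abs_lt.2 (Set.mem_Ioo.1 h6))]
    · rw [intervalIntegrable_iff]
      exact (intervalIntegrable_iff.1 (hfc.intervalIntegrable _ _)).indicator measurableSet_Ioo
    · exact (continuous_const.mul hgc).intervalIntegrable _ _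
  have hpi : (Real.pi : ℂ) ≠ 0 := by exact_mod_cast Real.pi_ne_zero
  rw [contourDiff, imagIntegral, imagIntegral, e1, e2, neg_neg, neg_neg,
    intervalIntegral.integral_symm, intervalIntegral.integral_symm (-h),
    intervalIntegral.integral_mul_const, intervalIntegral.integral_mul_const, hmain]
  have e3 : (h : ℂ) = -(Real.pi / (2 * L)) := by rw [hh]; push_cast; ring
  have e4 : (∫ s in (-h)..h, x ^ ((s : ℂ) * Complex.I) / (L : ℂ)) = ∫ s in (-h)..h, f s := rfl
  rw [e4, e3]
  generalize (∫ s in (-h)..h, f s) = J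
  generalize laurentSum q (nodes t B M) B x = Z
  field_simp
  ring

end
end QSchur

namespace QSchur
noncomputable section
variable {k N K : ℕ}

/-! ### Dominating the integrand -/

/-- The range up to `3π/4` is what is needed below: half of `|log q| · 3h = 3π/2`, where `3h` bounds
the vertical distance of `v` from the contour. -/
theorem abs_sin_lower {y : ℝ} (hy : |y| ≤ 3 * Real.pi / 4) : |y| / (2 * Real.pi) ≤ |Real.sin y| := by
  have hpi := Real.pi_pos
  rcases le_total |y| (Real.pi / 2) with h | h
  · refine le_trans ?_ (Real.mul_abs_le_abs_sin h)
    rw [div_mul_eq_mul_div, div_le_div_iff₀ (by positivity) hpi]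
    nlinarith [abs_nonneg y]
  · have h1 : |Real.sin y| = Real.sin (Real.pi - |y|) := by
      rw [Real.sin_pi_sub]
      rcases abs_choice y with h2 | h2 <;> rw [h2]
      · exact abs_of_nonneg (h2 ▸ Real.sin_nonneg_of_nonneg_of_le_pi (abs_nonneg y) (by linarith))
      · rw [Real.sin_neg, abs_of_nonpos]
        have := Real.sin_nonneg_of_nonneg_of_le_pi (abs_nonneg y) (by linarith)
        rw [h2, Real.sin_neg] at this
        linarith
    rw [h1]
    refine le_trans ?_ (Real.mul_le_sin (by linarith) (by linarith))
    rw [div_mul_eq_mul_div, div_le_div_iff₀ (by positivity) hpi]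
    nlinarith [abs_nonneg y]

theorem norm_one_sub_exp_ge_re (z : ℂ) : |z.re| * Real.exp (-|z.re|) ≤ ‖1 - Complex.exp z‖ := by
  have h1 : |1 - Real.exp z.re| ≤ ‖1 - Complex.exp z‖ := by
    have := abs_norm_sub_norm_le (1 : ℂ) (Complex.exp z)
    rwa [norm_one, Complex.norm_exp] at this
  refine le_trans ?_ h1
  rcases le_total 0 z.re with h | h
  · rw [abs_of_nonneg h, abs_sub_comm, abs_of_nonneg (by linarith [Real.one_le_exp h])]
    have h2 : z.re * Real.exp (-z.re) ≤ z.re := by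
      have : Real.exp (-z.re) ≤ 1 := Real.exp_le_one_iff.2 (by linarith)
      nlinarith
    linarith [Real.add_one_le_exp z.re]
  · rw [abs_of_nonpos h, neg_neg, abs_of_nonneg (by linarith [Real.exp_le_one_iff.2 h])]
    have h3 := Real.add_one_le_exp (-z.re)
    have h4 := Real.exp_pos z.re
    have h5 : Real.exp (-z.re) * Real.exp z.re = 1 := by rw [← Real.exp_add]; simp
    nlinarith

/-- From `1 - e^z = -2 e^(z/2) sinh(z/2)` and `|sinh(z/2)| ≥ |sin(Im z / 2)|`. -/
theorem norm_one_sub_exp_ge_im {z : ℂ} (hz : |z.im| ≤ 3 * Real.pi / 2) :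
    |z.im| / (2 * Real.pi) * Real.exp (-|z.re|) ≤ ‖1 - Complex.exp z‖ := by
  have e : 1 - Complex.exp z = -(2 * Complex.exp (z / 2) * Complex.sinh (z / 2)) := by
    have h1 : Complex.exp z = Complex.exp (z / 2) * Complex.exp (z / 2) := by
      rw [← Complex.exp_add]; congr 1; ring
    have h2 : Complex.exp (z / 2) * Complex.exp (-(z / 2)) = 1 := by
      rw [← Complex.exp_add]; simp
    rw [Complex.sinh, h1]
    linear_combination -h2
  have h1 : |Real.sin (z.im / 2)| ≤ ‖Complex.sinh (z / 2)‖ := by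
    refine le_trans ?_ (Complex.abs_im_le_norm _)
    have e1 : z / 2 = ((z.re / 2 : ℝ) : ℂ) + ((z.im / 2 : ℝ) : ℂ) * Complex.I := by
      apply Complex.ext <;> simp
    have e2 : (Complex.sinh (z / 2)).im = Real.cosh (z.re / 2) * Real.sin (z.im / 2) := by
      rw [e1]
      generalize z.re / 2 = a
      generalize z.im / 2 = b
      rw [Complex.sinh_add, Complex.cosh_mul_I, Complex.sinh_mul_I]
      simp
      exact Or.inl (Complex.sin_ofReal_re b)
    rw [e2, abs_mul, abs_of_pos (Real.cosh_pos _)]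
    exact le_mul_of_one_le_left (abs_nonneg _) (Real.one_le_cosh _)
  have h2 : Real.exp (-|z.re|) ≤ ‖Complex.exp (z / 2)‖ := by
    rw [Complex.norm_exp]
    refine Real.exp_le_exp.2 ?_
    have : (z / 2).re = z.re / 2 := by simp
    rw [this]
    have h3 := neg_abs_le z.re
    have h4 := abs_nonneg z.re
    rcases le_total 0 z.re with h5 | h5 <;> linarith
  have h3 := abs_sin_lower (y := z.im / 2) (by rw [abs_div, abs_two]; linarith)
  rw [e, norm_neg, norm_mul, norm_mul, Complex.norm_ofNat]
  rw [abs_div, abs_two] at h3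
  calc |z.im| / (2 * Real.pi) * Real.exp (-|z.re|)
      = 2 * Real.exp (-|z.re|) * (|z.im| / 2 / (2 * Real.pi)) := by ring
    _ ≤ 2 * ‖Complex.exp (z / 2)‖ * ‖Complex.sinh (z / 2)‖ := by
      refine mul_le_mul (by linarith) (h3.trans h1) (by positivity) (by positivity)

/-- The majorant `e^(-|r|) |r|^(-1/2)`. -/
def majo (r : ℝ) : ℝ := Real.exp (-|r|) * |r| ^ ((1 / 2 : ℝ) - 1)

theorem majo_nonneg (r : ℝ) : 0 ≤ majo r := by unfold majo; positivity

/-- On each half-line this is the Gamma integral at `1/2`. -/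
theorem integrable_majo : Integrable majo := by
  have h0 := Real.GammaIntegral_convergent (s := 1 / 2) (by norm_num)
  have h1 : IntegrableOn majo (Set.Ioi 0) := h0.congr_fun (fun r hr => by
    simp only [majo, abs_of_pos (Set.mem_Ioi.1 hr)]) measurableSet_Ioi
  have h2 : IntegrableOn majo (Set.Iic 0) := by
    have h3 : Integrable (Set.indicator (Set.Ioi 0) majo) := (integrable_indicator_iff measurableSet_Ioi).2 h1
    have h4 := h3.comp_neg
    have h5 : IntegrableOn majo (Set.Iio 0) := by
      rw [← integrable_indicator_iff measurableSet_Iio]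
      refine h4.congr (Eventually.of_forall fun r => ?_)
      simp only [Set.indicator, Set.mem_Ioi, Set.mem_Iio, Left.neg_pos_iff, majo, abs_neg]
    exact (integrableOn_Iic_iff_integrableOn_Iio (by simp)).2 h5
  have h3 := h2.union h1
  rwa [Set.Iic_union_Ioi, integrableOn_univ] at h3

/-- The geometric mean of the two lower bounds. It replaces the singularity at `u = v`, where the
`v`-segment crosses the lines of the `u`-contour, by a product of integrable functions of one
variable each. -/
theorem norm_inv_one_sub_exp_le {z : ℂ} (hz : |z.im| ≤ 3 * Real.pi / 2) (hr : z.re ≠ 0) (hi : z.im ≠ 0) :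
    ‖(1 - Complex.exp z)⁻¹‖ ≤ (2 * Real.pi) ^ (1 / 2 : ℝ) * Real.exp |z.re| *
      (|z.re| ^ ((1 / 2 : ℝ) - 1) * |z.im| ^ ((1 / 2 : ℝ) - 1)) := by
  have h1 := norm_one_sub_exp_ge_re z
  have h2 := norm_one_sub_exp_ge_im hz
  have hx : 0 < |z.re| := abs_pos.2 hr
  have hy : 0 < |z.im| := abs_pos.2 hi
  have hpi := Real.two_pi_pos
  set X := |z.re|
  set Y := |z.im|
  set D := ‖1 - Complex.exp z‖
  have hE := Real.exp_pos (-X)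
  have hD : 0 < D := lt_of_lt_of_le (by positivity) h1
  have h3 : (X * Real.exp (-X)) ^ (1 / 2 : ℝ) * (Y / (2 * Real.pi) * Real.exp (-X)) ^ (1 / 2 : ℝ) ≤ D := by
    calc _ ≤ D ^ (1 / 2 : ℝ) * D ^ (1 / 2 : ℝ) := by gcongr
      _ = D := by rw [← Real.rpow_add hD]; norm_num
  have h4 : (X * Real.exp (-X)) ^ (1 / 2 : ℝ) * (Y / (2 * Real.pi) * Real.exp (-X)) ^ (1 / 2 : ℝ) =
      X ^ (1 / 2 : ℝ) * Y ^ (1 / 2 : ℝ) * ((2 * Real.pi) ^ (1 / 2 : ℝ))⁻¹ * Real.exp (-X) := by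
    rw [Real.mul_rpow hx.le hE.le, Real.mul_rpow (by positivity) hE.le, Real.div_rpow hy.le hpi.le]
    have : Real.exp (-X) ^ (1 / 2 : ℝ) * Real.exp (-X) ^ (1 / 2 : ℝ) = Real.exp (-X) := by
      rw [← Real.rpow_add hE]; norm_num
    linear_combination (X ^ (1 / 2 : ℝ) * Y ^ (1 / 2 : ℝ) * ((2 * Real.pi) ^ (1 / 2 : ℝ))⁻¹) * this
  rw [h4] at h3
  rw [norm_inv]
  refine (inv_anti₀ (by positivity) h3).trans (le_of_eq ?_)
  have e : (1 / 2 : ℝ) - 1 = -(1 / 2) := by norm_num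
  rw [e, Real.rpow_neg hx.le, Real.rpow_neg hy.le, mul_inv, mul_inv, mul_inv, inv_inv, Real.exp_neg,
    inv_inv]
  ring

/-- The factor `(1 - A V) / (1 - A U)`. -/
def fac (A : ℝ) (V U : ℂ) : ℂ := (1 - A * V) / (1 - A * U)

/-- On the `u`-lines `q^u` is purely imaginary, so the denominators stay away from zero and grow
with `q^u`. -/
theorem one_le_norm_one_sub {z : ℂ} (hz : z.re = 0) : 1 ≤ ‖1 - z‖ ∧ ‖z‖ ≤ ‖1 - z‖ := by
  constructor
  · have := Complex.abs_re_le_norm (1 - z)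
    simpa [hz] using this
  · have h := Complex.abs_im_le_norm (1 - z)
    have h2 : ‖z‖ = |z.im| := by
      have : z = (z.im : ℂ) * Complex.I := by apply Complex.ext <;> simp [hz]
      rw [this]; simp
    rw [h2]
    simpa using h

theorem norm_fac_le {A : ℝ} (hA : 0 ≤ A) {V U : ℂ} (hV : ‖V‖ = 1) (hU : U.re = 0) :
    ‖fac A V U‖ ≤ 1 + A := by
  have h1 := (one_le_norm_one_sub (z := A * U) (by simp [hU])).1
  rw [fac, norm_div]
  refine (div_le_self (norm_nonneg _) h1).trans ?_
  refine (norm_sub_le _ _).trans ?_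
  simp [hV, abs_of_nonneg hA]

theorem norm_fac_le' {A δ : ℝ} (hδ : 0 < δ) (hA : δ ≤ A) {V U : ℂ} (hV : ‖V‖ = 1) (hU : U.re = 0)
    (hU0 : U ≠ 0) : ‖fac A V U‖ ≤ (1 + A) * (δ * ‖U‖)⁻¹ := by
  have hA0 : 0 < A := hδ.trans_le hA
  have hUp : 0 < ‖U‖ := norm_pos_iff.2 hU0
  have h1 := (one_le_norm_one_sub (z := A * U) (by simp [hU])).2
  rw [norm_mul, Complex.norm_real, Real.norm_of_nonneg hA0.le] at h1
  rw [fac, norm_div, div_eq_mul_inv]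
  refine mul_le_mul ((norm_sub_le _ _).trans (by simp [hV, abs_of_pos hA0]))
    (inv_anti₀ (by positivity) ((mul_le_mul_of_nonneg_right hA hUp.le).trans h1)) (by positivity)
    (by positivity)

theorem norm_fac_sub_one_le {A : ℝ} (hA : 0 ≤ A) {V U : ℂ} (hV : ‖V‖ = 1) (hU : U.re = 0) :
    ‖fac A V U - 1‖ ≤ A * (1 + ‖U‖) := by
  have h1 := (one_le_norm_one_sub (z := A * U) (by simp [hU])).1
  have h0 : (1 - (A : ℂ) * U) ≠ 0 := norm_pos_iff.1 (by linarith)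
  have e : fac A V U - 1 = A * (U - V) / (1 - A * U) := by
    rw [fac]; field_simp; ring
  rw [e, norm_div]
  refine (div_le_self (norm_nonneg _) h1).trans ?_
  rw [norm_mul, Complex.norm_real, Real.norm_of_nonneg hA]
  refine mul_le_mul_of_nonneg_left ((norm_sub_le _ _).trans ?_) hA
  rw [hV, add_comm]

/-- The first `P` factors each supply a power of `‖U‖⁻¹`; the numerators are controlled by `∏ (1 + A
n)`, which the geometric decay bounds independently of the length `B`. The case `P = 0` is the plain
bound. -/
theorem norm_prod_fac_le {q : ℝ} (hq0 : 0 < q) (hq1 : q < 1) {A : ℕ → ℝ} {α δ : ℝ} (hδ : 0 < δ) {P B : ℕ}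
    (hPB : P ≤ B) (hA0 : ∀ n < B, 0 ≤ A n) (hA : ∀ n < B, A n ≤ α * q ^ n) (hP : ∀ n < P, δ ≤ A n)
    {V U : ℂ} (hV : ‖V‖ = 1) (hU : U.re = 0) (hU0 : U ≠ 0) :
    ‖∏ n ∈ Finset.range B, fac (A n) V U‖ ≤ Real.exp (|α| * (1 - q)⁻¹) * ((δ * ‖U‖)⁻¹) ^ P := by
  have hUp : 0 < ‖U‖ := norm_pos_iff.2 hU0
  have h1 : ∀ n ∈ Finset.range B, ‖fac (A n) V U‖ ≤ (1 + A n) * if n < P then (δ * ‖U‖)⁻¹ else 1 := by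
    intro n hn
    have hn := Finset.mem_range.1 hn
    split_ifs with h
    · exact norm_fac_le' hδ (hP n h) hV hU hU0
    · rw [mul_one]; exact norm_fac_le (hA0 n hn) hV hU
  rw [norm_prod]
  refine (Finset.prod_le_prod (fun _ _ => norm_nonneg _) h1).trans ?_
  rw [Finset.prod_mul_distrib, Finset.prod_ite, Finset.prod_const, Finset.prod_const_one, mul_one]
  have e : (Finset.range B).filter (fun n => n < P) = Finset.range P := by
    ext n; simp only [Finset.mem_filter, Finset.mem_range]; omega
  rw [e, Finset.card_range]
  refine mul_le_mul_of_nonneg_right ?_ (by positivity)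
  have h2 : ∏ n ∈ Finset.range B, (1 + A n) ≤ Real.exp (∑ n ∈ Finset.range B, A n) := by
    rw [Real.exp_sum]
    refine Finset.prod_le_prod (fun n hn => ?_) fun n _ => by linarith [Real.add_one_le_exp (A n)]
    linarith [hA0 n (Finset.mem_range.1 hn)]
  refine h2.trans (Real.exp_le_exp.2 ?_)
  have hs := summable_geometric_of_lt_one hq0.le hq1
  calc ∑ n ∈ Finset.range B, A n ≤ ∑ n ∈ Finset.range B, |α| * q ^ n :=
        Finset.sum_le_sum fun n hn => (hA n (Finset.mem_range.1 hn)).trans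
          (mul_le_mul_of_nonneg_right (le_abs_self α) (by positivity))
    _ = |α| * ∑ n ∈ Finset.range B, q ^ n := by rw [Finset.mul_sum]
    _ ≤ |α| * (1 - q)⁻¹ := by
        refine mul_le_mul_of_nonneg_left ?_ (abs_nonneg _)
        rw [← tsum_geometric_of_lt_one hq0.le hq1]
        exact hs.sum_le_tsum _ fun n _ => by positivity

/-- Convergence of growing products of factors. -/
theorem tendsto_prod_fac {q : ℝ} (hq0 : 0 < q) (hq1 : q < 1) {A : ℕ → ℕ → ℝ} {A' : ℕ → ℝ} {α : ℝ}
    {B : ℕ → ℕ} (hB : Tendsto B atTop atTop) (hA0 : ∀ᶠ m in atTop, ∀ n < B m, 0 ≤ A m n)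
    (hA : ∀ᶠ m in atTop, ∀ n < B m, A m n ≤ α * q ^ n)
    (hlim : ∀ n, ∀ᶠ m in atTop, A m n = A' n)
    {V U : ℂ} (hV : ‖V‖ = 1) (hU : U.re = 0) :
    Tendsto (fun m => ∏ n ∈ Finset.range (B m), fac (A m n) V U) atTop
      (𝓝 (∏' n, fac (A' n) V U)) := by
  have key := tendsto_tprod_one_add_of_dominated_convergence (𝓕 := atTop)
    -- Beyond the truncation the factors are set to `1`, so that all products are infinite products
    -- with one majorant.
    (f := fun m n => if n < B m then fac (A m n) V U - 1 else 0) (g := fun n => fac (A' n) V U - 1)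
    (bound := fun n => |α| * (1 + ‖U‖) * q ^ n)
    ((summable_geometric_of_lt_one hq0.le hq1).mul_left _) ?_ ?_
  · have e : (fun n => 1 + (fac (A' n) V U - 1)) = fun n => fac (A' n) V U := by
      funext n; ring
    rw [e] at key
    refine key.congr fun m => ?_
    rw [tprod_eq_prod (s := Finset.range (B m))]
    · refine Finset.prod_congr rfl fun n hn => ?_
      rw [if_pos (Finset.mem_range.1 hn)]; ring
    · intro n hn
      rw [if_neg fun h => hn (Finset.mem_range.2 h), add_zero]
  · intro n
    refine tendsto_nhds_of_eventually_eq ?_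
    filter_upwards [hlim n, hB.eventually_gt_atTop n] with m h1 h2
    rw [if_pos h2, h1]
  · filter_upwards [hA0, hA] with m h1 h2 n
    split_ifs with h
    · refine (norm_fac_sub_one_le (h1 n h) hV hU).trans ?_
      have := (h2 n h).trans (mul_le_mul_of_nonneg_right (le_abs_self α) (by positivity))
      calc A m n * (1 + ‖U‖) ≤ |α| * q ^ n * (1 + ‖U‖) := by gcongr
        _ = _ := by ring
    · rw [norm_zero]; positivity

end
end QSchur

/-! ### A majorant uniform in the truncation -/

namespace QSchur
noncomputable section
variable {k N K : ℕ}

theorem integrandFin_eq_fac {q : ℝ} (hq0 : 0 < q) (t : ℤ → ℤ) (B M : ℕ) (x v u : ℂ) :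
    integrandFin q t B M x v u = x ^ u * (1 - W (Real.log q) (v - u))⁻¹ *
      (∏ n ∈ Finset.range B, fac (q ^ (t ((n : ℤ) + 1) + n)) (W (Real.log q) v)⁻¹ (W (Real.log q) u)⁻¹) *
      ∏ n ∈ Finset.range M, fac (q ^ ((n : ℤ) + 1 - t (-(n : ℤ)))) (W (Real.log q) v) (W (Real.log q) u) := by
  simp only [integrandFin, fac, q_cpow hq0]
  have e1 : ∀ (n : ℕ) (z : ℂ), W (Real.log q) ((t ((n : ℤ) + 1) : ℂ) + (n : ℂ) - z) =
      ((q ^ (t ((n : ℤ) + 1) + n) : ℝ) : ℂ) * (W (Real.log q) z)⁻¹ := by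
    intro n z
    rw [W_sub, div_eq_mul_inv]
    congr 1
    rw [Complex.ofReal_zpow, ← W_int hq0]
    congr 1; push_cast; ring
  have e2 : ∀ (n : ℕ) (z : ℂ), W (Real.log q) ((n : ℂ) + 1 + z - (t (-(n : ℤ)) : ℂ)) =
      ((q ^ ((n : ℤ) + 1 - t (-(n : ℤ))) : ℝ) : ℂ) * W (Real.log q) z := by
    intro n z
    rw [Complex.ofReal_zpow, ← W_int hq0, ← W_add]
    congr 1; push_cast; ring
  simp only [e1, e2, div_eq_mul_inv]

theorem integrand_eq_fac {q : ℝ} (hq0 : 0 < q) (t : ℤ → ℤ) (x v u : ℂ) :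
    integrand q t x v u = x ^ u * (1 - W (Real.log q) (v - u))⁻¹ *
      (∏' n : ℕ, fac (q ^ (t ((n : ℤ) + 1) + n)) (W (Real.log q) v)⁻¹ (W (Real.log q) u)⁻¹) *
      ∏' n : ℕ, fac (q ^ ((n : ℤ) + 1 - t (-(n : ℤ)))) (W (Real.log q) v) (W (Real.log q) u) := by
  simp only [integrand, fac, q_cpow hq0]
  have e1 : ∀ (n : ℕ) (z : ℂ), W (Real.log q) ((t ((n : ℤ) + 1) : ℂ) + (n : ℂ) - z) =
      ((q ^ (t ((n : ℤ) + 1) + n) : ℝ) : ℂ) * (W (Real.log q) z)⁻¹ := by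
    intro n z
    rw [W_sub, div_eq_mul_inv]
    congr 1
    rw [Complex.ofReal_zpow, ← W_int hq0]
    congr 1; push_cast; ring
  have e2 : ∀ (n : ℕ) (z : ℂ), W (Real.log q) ((n : ℂ) + 1 + z - (t (-(n : ℤ)) : ℂ)) =
      ((q ^ ((n : ℤ) + 1 - t (-(n : ℤ))) : ℝ) : ℂ) * W (Real.log q) z := by
    intro n z
    rw [Complex.ofReal_zpow, ← W_int hq0, ← W_add]
    congr 1; push_cast; ring
  simp only [e1, e2, div_eq_mul_inv]

theorem norm_W_imag (L s : ℝ) : ‖W L (s * Complex.I)‖ = 1 := by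
  rw [norm_W]; simp

/-- The contour lies at a quarter period, where the cosine vanishes. -/
theorem W_line_re {L h c : ℝ} (hLh : -L * h = Real.pi / 2) (hc : c = h ∨ c = -h) (r : ℝ) :
    (W L (linePt c r)).re = 0 ∧ ((W L (linePt c r))⁻¹).re = 0 := by
  have h1 : (W L (linePt c r)).re = 0 := by
    rw [W, Complex.exp_re]
    have : ((L : ℂ) * linePt c r).im = L * c := by simp [linePt]
    rw [this]
    have hcos : Real.cos (L * c) = 0 := by
      rcases hc with rfl | rfl
      · rw [show L * c = -(Real.pi / 2) by linarith, Real.cos_neg, Real.cos_pi_div_two]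
      · rw [show L * -h = Real.pi / 2 by linarith, Real.cos_pi_div_two]
    rw [hcos, mul_zero]
  exact ⟨h1, by rw [Complex.inv_re, h1, zero_div]⟩

theorem norm_W_line (L c r : ℝ) : ‖W L (linePt c r)‖ = Real.exp (L * r) := by
  rw [norm_W]; simp [linePt]

/-- The data of a window `1 - M, …, B` that agrees with `τ` near the origin. -/
structure Window (τ t : ℤ → ℤ) (P B M : ℕ) : Prop where
  hB : P ≤ B
  hM : P ≤ M
  eq : ∀ i : ℤ, |i| ≤ P → t i = τ i
  mono : MonotoneOn t (Set.Icc (1 - (M : ℤ)) B)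

namespace Window

variable {τ t : ℤ → ℤ} {P B M : ℕ}

/-- Agreement with `τ` at one index and monotonicity bound all further terms; this makes the factors
of the products geometrically small, uniformly in the window. -/
theorem le_right (hw : Window τ t P B M) (hP : 1 ≤ P) {n : ℕ} (hn : n < B) : τ 1 ≤ t ((n : ℤ) + 1) := by
  have := hw.hM
  rw [← hw.eq 1 (by rw [abs_one]; omega)]
  exact hw.mono ⟨by omega, by omega⟩ ⟨by omega, by omega⟩ (by omega)

theorem le_left (hw : Window τ t P B M) (hP : 1 ≤ P) {n : ℕ} (hn : n < M) : t (-(n : ℤ)) ≤ τ 0 := by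
  have := hw.hB
  rw [← hw.eq 0 (by simp)]
  exact hw.mono ⟨by omega, by omega⟩ ⟨by omega, by omega⟩ (by omega)

end Window

theorem zpow_le_geometric {q : ℝ} (hq0 : 0 < q) (hq1 : q < 1) {a b : ℤ} {n : ℕ} (h : b + n ≤ a) :
    q ^ a ≤ q ^ b * q ^ n := by
  rw [← zpow_natCast q n, ← zpow_add₀ hq0.ne']
  exact zpow_le_zpow_right_of_le_one₀ hq0 hq1.le h

theorem exists_lower_bound {q : ℝ} (hq0 : 0 < q) (a : ℕ → ℤ) (P : ℕ) :
    ∃ δ : ℝ, 0 < δ ∧ ∀ n < P, δ ≤ q ^ a n := by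
  induction P with
  | zero => exact ⟨1, one_pos, fun n hn => absurd hn (Nat.not_lt_zero n)⟩
  | succ P ih =>
    obtain ⟨δ, h1, h2⟩ := ih
    refine ⟨min δ (q ^ a P), lt_min h1 (zpow_pos hq0 _), fun n hn => ?_⟩
    rcases Nat.lt_succ_iff_lt_or_eq.1 hn with h | rfl
    · exact (min_le_left _ _).trans (h2 n h)
    · exact min_le_right _ _

-- For `r ≥ 0` the first product, and for `r ≤ 0` the second, supplies `P` exponentially small
-- factors, while the other product is merely bounded. With `P` large these beat the growth of `x^u`
-- and of the kernel bound. Only the values of `τ` on `|i| ≤ P` enter, so the constant serves every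
-- window that agrees with `τ` there.
set_option maxHeartbeats 1000000 in
theorem exists_integrandFin_bound {q : ℝ} (hq0 : 0 < q) (hq1 : q < 1) (τ : ℤ → ℤ) {ρ : ℝ} (hρ : 0 < ρ) :
    ∃ (P : ℕ) (C : ℝ), 0 ≤ C ∧ ∀ t B M x, ‖x‖ = ρ → Window τ t P B M →
      ∀ c, (c = -(Real.pi / (2 * Real.log q)) ∨ c = - -(Real.pi / (2 * Real.log q))) →
      ∀ s : ℝ, |s| ≤ 2 * -(Real.pi / (2 * Real.log q)) → s ≠ c → ∀ r : ℝ, r ≠ 0 →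
      ‖integrandFin q t B M x (s * Complex.I) (linePt c r)‖ ≤ C * (majo (s - c) * majo r) := by
  set L := Real.log q with hL
  have hLneg : L < 0 := Real.log_neg hq0 hq1
  obtain ⟨h, hh⟩ : ∃ h, h = -(Real.pi / (2 * L)) := ⟨_, rfl⟩
  have hLh : -L * h = Real.pi / 2 := by rw [hh]; exact log_mul_half hq0 hq1
  have hpos : 0 < h := by
    by_contra hcon
    push Not at hcon
    nlinarith [Real.pi_pos]
  rw [← hh]
  -- `P |L|` must exceed `|log ρ|` from `x^u`, plus `|L|` from the kernel, plus `1` for the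
  -- remaining factor `e^(-|r|)`.
  obtain ⟨P, hP⟩ := exists_nat_gt ((|Real.log ρ| + |L| + 1) / |L|)
  have hLabs : 0 < |L| := abs_pos.2 hLneg.ne
  rw [div_lt_iff₀ hLabs] at hP
  have hP1 : 1 ≤ P := by
    rcases Nat.eq_zero_or_pos P with h0 | h0
    · rw [h0] at hP
      have := abs_nonneg (Real.log ρ)
      simp at hP
      linarith
    · exact h0
  obtain ⟨δ₁, hδ₁, hδ₁'⟩ := exists_lower_bound hq0 (fun n : ℕ => τ ((n : ℤ) + 1) + n) P
  obtain ⟨δ₂, hδ₂, hδ₂'⟩ := exists_lower_bound hq0 (fun n : ℕ => (n : ℤ) + 1 - τ (-(n : ℤ))) P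
  set E₁ := Real.exp (|q ^ (τ 1)| * (1 - q)⁻¹)
  set E₂ := Real.exp (|q ^ (1 - τ 0)| * (1 - q)⁻¹)
  set G := (2 * Real.pi) ^ (1 / 2 : ℝ) * |L| ^ ((1 / 2 : ℝ) - 1) * |L| ^ ((1 / 2 : ℝ) - 1) *
    Real.exp (Real.pi * h) * E₁ * E₂ * (1 + (δ₁⁻¹) ^ P + (δ₂⁻¹) ^ P) * Real.exp (3 * h) with hG
  have hG0 : 0 ≤ G := by positivity
  refine ⟨P, G, hG0, fun t B M x hx hw c hc s hs hsc r hr => ?_⟩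
  have hx0 : x ≠ 0 := fun h0 => by rw [h0, norm_zero] at hx; exact hρ.ne hx
  have hcabs : |c| = h := by
    rcases hc with rfl | rfl
    · exact abs_of_pos hpos
    · rw [abs_neg, abs_of_pos hpos]
  have hsc' : |s - c| ≤ 3 * h := (abs_sub _ _).trans (by linarith)
  obtain ⟨hU, hUi⟩ := W_line_re hLh hc r
  have hV := norm_W_imag L s
  have hVi : ‖(W L (s * Complex.I))⁻¹‖ = 1 := by rw [norm_inv, hV, inv_one]
  have hUn := norm_W_line L c r
  have hUin : ‖(W L (linePt c r))⁻¹‖ = Real.exp (-(L * r)) := by rw [norm_inv, hUn, Real.exp_neg]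
  have hU0 := W_ne_zero L (linePt c r)
  have hPB := hw.hB
  have hPM := hw.hM
  -- the products
  have hA : ∀ n < B, q ^ (t ((n : ℤ) + 1) + n) ≤ q ^ τ 1 * q ^ n := fun n hn =>
    zpow_le_geometric hq0 hq1 (by have := hw.le_right hP1 hn; omega)
  have hB : ∀ n < M, q ^ ((n : ℤ) + 1 - t (-(n : ℤ))) ≤ q ^ (1 - τ 0) * q ^ n := fun n hn =>
    zpow_le_geometric hq0 hq1 (by have := hw.le_left hP1 hn; omega)
  have hδA : ∀ n < P, δ₁ ≤ q ^ (t ((n : ℤ) + 1) + n) := fun n hn => by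
    rw [hw.eq _ (by rw [abs_of_nonneg (by omega)]; omega)]; exact hδ₁' n hn
  have hδB : ∀ n < P, δ₂ ≤ q ^ ((n : ℤ) + 1 - t (-(n : ℤ))) := fun n hn => by
    rw [hw.eq _ (by rw [abs_neg, Nat.abs_cast]; omega)]; exact hδ₂' n hn
  have p1 := norm_prod_fac_le hq0 hq1 hδ₁ hPB (fun n _ => (zpow_pos hq0 _).le) hA hδA hVi hUi
    (inv_ne_zero hU0)
  have p1' := norm_prod_fac_le hq0 hq1 hδ₁ (Nat.zero_le B) (fun n _ => (zpow_pos hq0 _).le) hA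
    (fun n hn => absurd hn (Nat.not_lt_zero n)) hVi hUi (inv_ne_zero hU0)
  have p2 := norm_prod_fac_le hq0 hq1 hδ₂ hPM (fun n _ => (zpow_pos hq0 _).le) hB hδB hV hU hU0
  have p2' := norm_prod_fac_le hq0 hq1 hδ₂ (Nat.zero_le M) (fun n _ => (zpow_pos hq0 _).le) hB
    (fun n hn => absurd hn (Nat.not_lt_zero n)) hV hU hU0
  rw [pow_zero, mul_one] at p1' p2'
  rw [hUin, mul_inv, mul_pow, ← Real.exp_neg, neg_neg, ← Real.exp_nat_mul] at p1
  rw [hUn, mul_inv, mul_pow, ← Real.exp_neg, ← Real.exp_nat_mul] at p2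
  -- both products together
  have hprod : ‖∏ n ∈ Finset.range B, fac (q ^ (t ((n : ℤ) + 1) + n)) (W L (s * Complex.I))⁻¹
        (W L (linePt c r))⁻¹‖ * ‖∏ n ∈ Finset.range M, fac (q ^ ((n : ℤ) + 1 - t (-(n : ℤ))))
        (W L (s * Complex.I)) (W L (linePt c r))‖ ≤
      E₁ * E₂ * (1 + (δ₁⁻¹) ^ P + (δ₂⁻¹) ^ P) * Real.exp (-(P * |L| * |r|)) := by
    have d1 : 0 < (δ₁⁻¹) ^ P := by positivity
    have d2 : 0 < (δ₂⁻¹) ^ P := by positivity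
    rcases le_total 0 r with h0 | h0
    · refine (mul_le_mul p1 p2' (norm_nonneg _) (by positivity)).trans ?_
      rw [abs_of_neg hLneg, abs_of_nonneg h0, show (P : ℝ) * (L * r) = -(P * -L * r) by ring]
      have := Real.exp_pos (-(P * -L * r))
      calc _ = E₁ * E₂ * (δ₁⁻¹) ^ P * Real.exp (-(P * -L * r)) := by ring
        _ ≤ _ := by gcongr; linarith
    · refine (mul_le_mul p1' p2 (norm_nonneg _) (by positivity)).trans ?_
      rw [abs_of_neg hLneg, abs_of_nonpos h0, show (P : ℝ) * -(L * r) = -(P * -L * -r) by ring]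
      calc _ = E₁ * E₂ * (δ₂⁻¹) ^ P * Real.exp (-(P * -L * -r)) := by ring
        _ ≤ _ := by gcongr; linarith
  -- the power
  have hpow : ‖x ^ linePt c r‖ ≤ Real.exp (|Real.log ρ| * |r|) * Real.exp (Real.pi * h) := by
    have h1 := norm_cpow_le_strip hx0 (h := h) (u := linePt c r) (by simp [strip, linePt, hcabs])
    refine h1.trans (mul_le_mul_of_nonneg_right (Real.exp_le_exp.2 ?_) (Real.exp_pos _).le)
    rw [hx, ← abs_mul]
    simpa [linePt] using le_abs_self (Real.log ρ * r)
  -- the kernel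
  have hker : ‖(1 - W L (s * Complex.I - linePt c r))⁻¹‖ ≤ (2 * Real.pi) ^ (1 / 2 : ℝ) *
      Real.exp (|L| * |r|) * ((|L| ^ ((1 / 2 : ℝ) - 1) * |r| ^ ((1 / 2 : ℝ) - 1)) *
        (|L| ^ ((1 / 2 : ℝ) - 1) * |s - c| ^ ((1 / 2 : ℝ) - 1))) := by
    have hre : ((L : ℂ) * (s * Complex.I - linePt c r)).re = -(L * r) := by simp [linePt]
    have him : ((L : ℂ) * (s * Complex.I - linePt c r)).im = L * (s - c) := by simp [linePt]
    have h1 := norm_inv_one_sub_exp_le (z := (L : ℂ) * (s * Complex.I - linePt c r)) (by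
      rw [him, abs_mul, abs_of_neg hLneg]
      have := mul_le_mul_of_nonneg_left hsc' (neg_pos.2 hLneg).le
      linarith)
      (by rw [hre]; exact neg_ne_zero.2 (mul_ne_zero hLneg.ne hr))
      (by rw [him]; exact mul_ne_zero hLneg.ne (sub_ne_zero.2 hsc))
    rw [hre, him, abs_neg, abs_mul, abs_mul, Real.mul_rpow (abs_nonneg _) (abs_nonneg _),
      Real.mul_rpow (abs_nonneg _) (abs_nonneg _)] at h1
    exact h1
  rw [integrandFin_eq_fac hq0, norm_mul, norm_mul, norm_mul, mul_assoc (_ * _)]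
  refine (mul_le_mul (mul_le_mul hpow hker (norm_nonneg _) (by positivity)) hprod (by positivity)
    (by positivity)).trans ?_
  have hexp : Real.exp (|Real.log ρ| * |r|) * Real.exp (|L| * |r|) * Real.exp (-(P * |L| * |r|)) ≤
      Real.exp (-|r|) := by
    rw [← Real.exp_add, ← Real.exp_add]
    refine Real.exp_le_exp.2 ?_
    have := mul_le_mul_of_nonneg_right hP.le (abs_nonneg r)
    linarith
  -- The constant `e^(3h)` pays for the factor `e^(-|s-c|)` contained in `majo (s - c)`.
  have hexp2 : 1 ≤ Real.exp (3 * h) * Real.exp (-|s - c|) := by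
    rw [← Real.exp_add]; exact Real.one_le_exp (by linarith)
  calc _ = ((2 * Real.pi) ^ (1 / 2 : ℝ) * |L| ^ ((1 / 2 : ℝ) - 1) * |L| ^ ((1 / 2 : ℝ) - 1) *
        Real.exp (Real.pi * h) * E₁ * E₂ * (1 + (δ₁⁻¹) ^ P + (δ₂⁻¹) ^ P)) *
        (|r| ^ ((1 / 2 : ℝ) - 1) * |s - c| ^ ((1 / 2 : ℝ) - 1)) * 1 * (Real.exp (|Real.log ρ| * |r|) *
          Real.exp (|L| * |r|) * Real.exp (-(P * |L| * |r|))) := by ring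
    _ ≤ ((2 * Real.pi) ^ (1 / 2 : ℝ) * |L| ^ ((1 / 2 : ℝ) - 1) * |L| ^ ((1 / 2 : ℝ) - 1) *
        Real.exp (Real.pi * h) * E₁ * E₂ * (1 + (δ₁⁻¹) ^ P + (δ₂⁻¹) ^ P)) *
        (|r| ^ ((1 / 2 : ℝ) - 1) * |s - c| ^ ((1 / 2 : ℝ) - 1)) *
        (Real.exp (3 * h) * Real.exp (-|s - c|)) * Real.exp (-|r|) := by gcongr
    _ = _ := by rw [hG, majo, majo]; ring

theorem tendsto_integrandFin {q : ℝ} (hq0 : 0 < q) (hq1 : q < 1) {τ : ℤ → ℤ} {t : ℕ → ℤ → ℤ}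
    {B M : ℕ → ℕ} (hB : Tendsto B atTop atTop) (hM : Tendsto M atTop atTop)
    (hw : ∀ P, ∀ᶠ n in atTop, Window τ (t n) P (B n) (M n)) (x : ℂ) {c : ℝ}
    (hc : c = -(Real.pi / (2 * Real.log q)) ∨ c = - -(Real.pi / (2 * Real.log q))) (s r : ℝ) :
    Tendsto (fun n => integrandFin q (t n) (B n) (M n) x (s * Complex.I) (linePt c r)) atTop
      (𝓝 (integrand q τ x (s * Complex.I) (linePt c r))) := by
  obtain ⟨hU, hUi⟩ := W_line_re (log_mul_half hq0 hq1) hc r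
  have hV := norm_W_imag (Real.log q) s
  have hVi : ‖(W (Real.log q) (s * Complex.I))⁻¹‖ = 1 := by rw [norm_inv, hV, inv_one]
  simp only [integrandFin_eq_fac hq0, integrand_eq_fac hq0]
  refine (tendsto_const_nhds.mul ?_).mul ?_
  · refine tendsto_prod_fac hq0 hq1 (α := q ^ τ 1) hB (Eventually.of_forall fun m n _ =>
      (zpow_pos hq0 _).le) ?_ (fun n => ?_) hVi hUi
    · filter_upwards [hw 1] with m hm n hn
      exact zpow_le_geometric hq0 hq1 (by have := hm.le_right le_rfl hn; omega)
    · filter_upwards [hw (n + 1)] with m hm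
      rw [hm.eq _ (by rw [abs_of_nonneg (by omega)]; omega)]
  · refine tendsto_prod_fac hq0 hq1 (α := q ^ (1 - τ 0)) hM (Eventually.of_forall fun m n _ =>
      (zpow_pos hq0 _).le) ?_ (fun n => ?_) hV hU
    · filter_upwards [hw 1] with m hm n hn
      exact zpow_le_geometric hq0 hq1 (by have := hm.le_left le_rfl hn; omega)
    · filter_upwards [hw n] with m hm
      rw [hm.eq _ (by rw [abs_neg, Nat.abs_cast])]

theorem measurable_integrandFin (q : ℝ) (t : ℤ → ℤ) (B M : ℕ) (x : ℂ) (c : ℝ) :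
    Measurable fun p : ℝ × ℝ => integrandFin q t B M x ((p.1 : ℂ) * Complex.I) (linePt c p.2) := by
  unfold integrandFin linePt
  fun_prop

end
end QSchur

namespace QSchur
noncomputable section
variable {k N K : ℕ}

/-! ### Limits of the double integrals -/

/-- The product measure of the double integral. -/
def dblMeasure (q : ℝ) : Measure (ℝ × ℝ) :=
  (volume.restrict (Set.uIoc (-(Real.pi / Real.log q)) (Real.pi / Real.log q))).prod volume

/-- The double integral along one of the lines of the `u`-contour. -/
def dblInt (q c : ℝ) (f : ℂ → ℂ → ℂ) : ℂ :=
  ∫ p : ℝ × ℝ, f ((p.1 : ℂ) * Complex.I) (linePt c p.2) ∂dblMeasure q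

theorem half_period_pos {q : ℝ} (hq0 : 0 < q) (hq1 : q < 1) : 0 < -(Real.pi / (2 * Real.log q)) := by
  have := Real.log_neg hq0 hq1
  rw [neg_pos]
  exact div_neg_of_pos_of_neg Real.pi_pos (by linarith)

theorem pi_div_log (q : ℝ) : Real.pi / Real.log q = -(2 * -(Real.pi / (2 * Real.log q))) := by
  rw [mul_neg, neg_neg, mul_div_assoc', mul_div_mul_left _ _ two_ne_zero]

theorem ae_dblMeasure {q : ℝ} (hq0 : 0 < q) (hq1 : q < 1) (c : ℝ) :
    ∀ᵐ p ∂dblMeasure q, |p.1| ≤ 2 * -(Real.pi / (2 * Real.log q)) ∧ p.1 ≠ c ∧ p.2 ≠ 0 := by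
  have hpos := half_period_pos hq0 hq1
  have h1 : ∀ᵐ s ∂(volume.restrict (Set.uIoc (-(Real.pi / Real.log q)) (Real.pi / Real.log q))),
      |s| ≤ 2 * -(Real.pi / (2 * Real.log q)) ∧ s ≠ c := by
    have h2 : ∀ᵐ s : ℝ, s ≠ c := by
      have := (Set.countable_singleton c).ae_notMem (volume : Measure ℝ)
      simpa using this
    filter_upwards [ae_restrict_mem measurableSet_uIoc, ae_restrict_of_ae h2] with s hs hs2
    refine ⟨?_, hs2⟩
    rw [pi_div_log, neg_neg, Set.uIoc_of_ge (by linarith)] at hs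
    exact abs_le.2 ⟨hs.1.le, hs.2⟩
  have h2 : ∀ᵐ r : ℝ, r ≠ 0 := by
    have := (Set.countable_singleton (0 : ℝ)).ae_notMem (volume : Measure ℝ)
    simpa using this
  filter_upwards [Measure.quasiMeasurePreserving_fst.ae h1, Measure.quasiMeasurePreserving_snd.ae h2]
    with p hp1 hp2
  exact ⟨hp1.1, hp1.2, hp2⟩

theorem integrable_majo_prod (q c C : ℝ) :
    Integrable (fun p : ℝ × ℝ => C * (majo (p.1 - c) * majo p.2)) (dblMeasure q) :=
  ((integrable_majo.comp_sub_right c).restrict.mul_prod integrable_majo).const_mul C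

/-- The two lines of the contour. -/
def IsLine (q c : ℝ) : Prop :=
  c = -(Real.pi / (2 * Real.log q)) ∨ c = - -(Real.pi / (2 * Real.log q))

theorem integrable_integrandFin_and_bound {q : ℝ} (hq0 : 0 < q) (hq1 : q < 1) (τ : ℤ → ℤ) {ρ : ℝ}
    (hρ : 0 < ρ) : ∃ (P : ℕ) (C : ℝ), ∀ t B M x, ‖x‖ = ρ → Window τ t P B M → ∀ c, IsLine q c →
      Integrable (fun p : ℝ × ℝ => integrandFin q t B M x ((p.1 : ℂ) * Complex.I) (linePt c p.2))
        (dblMeasure q) ∧ ‖dblInt q c (integrandFin q t B M x)‖ ≤ C := by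
  obtain ⟨P, C, hC, hb⟩ := exists_integrandFin_bound hq0 hq1 τ hρ
  -- Summing the two majorants makes the constant independent of the line.
  refine ⟨P, ∑ c ∈ {-(Real.pi / (2 * Real.log q)), - -(Real.pi / (2 * Real.log q))},
    ∫ p : ℝ × ℝ, C * (majo (p.1 - c) * majo p.2) ∂dblMeasure q, fun t B M x hx hw c hc => ?_⟩
  have hle : ∀ᵐ p ∂dblMeasure q, ‖integrandFin q t B M x ((p.1 : ℂ) * Complex.I) (linePt c p.2)‖ ≤
      C * (majo (p.1 - c) * majo p.2) := by
    filter_upwards [ae_dblMeasure hq0 hq1 c] with p hp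
    exact hb t B M x hx hw c hc p.1 hp.1 hp.2.1 p.2 hp.2.2
  refine ⟨(integrable_majo_prod q c C).mono'
    (measurable_integrandFin q t B M x c).aestronglyMeasurable hle, ?_⟩
  refine (norm_integral_le_of_norm_le (integrable_majo_prod q c C) hle).trans ?_
  refine Finset.single_le_sum (f := fun c => ∫ p : ℝ × ℝ, C * (majo (p.1 - c) * majo p.2) ∂dblMeasure q)
    (fun c _ => integral_nonneg fun p => mul_nonneg hC (mul_nonneg (majo_nonneg _) (majo_nonneg _))) ?_
  rcases hc with h | h <;> simp [h]

theorem tendsto_dblInt {q : ℝ} (hq0 : 0 < q) (hq1 : q < 1) {τ : ℤ → ℤ} {t : ℕ → ℤ → ℤ}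
    {B M : ℕ → ℕ} (hB : Tendsto B atTop atTop) (hM : Tendsto M atTop atTop)
    (hw : ∀ P, ∀ᶠ n in atTop, Window τ (t n) P (B n) (M n)) {x : ℂ} (hx : x ≠ 0) {c : ℝ}
    (hc : IsLine q c) :
    Integrable (fun p : ℝ × ℝ => integrand q τ x ((p.1 : ℂ) * Complex.I) (linePt c p.2))
        (dblMeasure q) ∧
    Tendsto (fun n => dblInt q c (integrandFin q (t n) (B n) (M n) x)) atTop
      (𝓝 (dblInt q c (integrand q τ x))) := by
  obtain ⟨P, C, hC, hb⟩ := exists_integrandFin_bound hq0 hq1 τ (norm_pos_iff.2 hx)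
  have hlim : ∀ p : ℝ × ℝ, Tendsto (fun n => integrandFin q (t n) (B n) (M n) x
      ((p.1 : ℂ) * Complex.I) (linePt c p.2)) atTop
      (𝓝 (integrand q τ x ((p.1 : ℂ) * Complex.I) (linePt c p.2))) := fun p =>
    tendsto_integrandFin hq0 hq1 hB hM hw x hc p.1 p.2
  have hmeas : ∀ n, AEStronglyMeasurable (fun p : ℝ × ℝ => integrandFin q (t n) (B n) (M n) x
      ((p.1 : ℂ) * Complex.I) (linePt c p.2)) (dblMeasure q) := fun n =>
    (measurable_integrandFin q (t n) (B n) (M n) x c).aestronglyMeasurable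
  constructor
  -- Measurability and the bound for the infinite products are inherited from the finite ones
  -- through the pointwise limit.
  · refine (integrable_majo_prod q c C).mono'
      (aestronglyMeasurable_of_tendsto_ae atTop hmeas (Eventually.of_forall hlim)) ?_
    filter_upwards [ae_dblMeasure hq0 hq1 c] with p hp
    refine le_of_tendsto (hlim p).norm ?_
    filter_upwards [hw P] with n hn
    exact hb _ _ _ x rfl hn c hc p.1 hp.1 hp.2.1 p.2 hp.2.2
  · refine tendsto_integral_filter_of_dominated_convergence _ (Eventually.of_forall hmeas) ?_
      (integrable_majo_prod q c C) (Eventually.of_forall hlim)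
    filter_upwards [hw P] with n hn
    filter_upwards [ae_dblMeasure hq0 hq1 c] with p hp
    exact hb _ _ _ x rfl hn c hc p.1 hp.1 hp.2.1 p.2 hp.2.2

/-- Fubini. The minus sign arises because `log q < 0`, so the `v`-segment is traversed downwards. -/
theorem imagIntegral_lineIntegral {q : ℝ} (hq0 : 0 < q) (hq1 : q < 1) {f : ℂ → ℂ → ℂ}
    (hf : ∀ c, IsLine q c → Integrable (fun p : ℝ × ℝ => f ((p.1 : ℂ) * Complex.I) (linePt c p.2))
      (dblMeasure q)) :
    imagIntegral (-(Real.pi / Real.log q)) (Real.pi / Real.log q) (fun v => lineIntegral q fun u => f v u) =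
      -((dblInt q (Real.pi / (2 * Real.log q)) f - dblInt q (-(Real.pi / (2 * Real.log q))) f) /
        (2 * Real.pi * Complex.I) * Complex.I) / (2 * Real.pi * Complex.I) := by
  have hpos := half_period_pos hq0 hq1
  have h1 := hf (Real.pi / (2 * Real.log q)) (Or.inr (neg_neg _).symm)
  have h2 := hf (-(Real.pi / (2 * Real.log q))) (Or.inl rfl)
  have i1 := h1.integral_prod_left
  have i2 := h2.integral_prod_left
  have hab : ¬ (-(Real.pi / Real.log q) ≤ Real.pi / Real.log q) := by
    rw [pi_div_log]; linarith
  rw [imagIntegral, intervalIntegral.intervalIntegral_eq_integral_uIoc, if_neg hab, neg_one_smul]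
  simp only [lineIntegral]
  rw [integral_mul_const, integral_div, integral_sub i1 i2, dblInt, dblInt, dblMeasure,
    integral_prod _ h1, integral_prod _ h2]

/-- A family of windows that exhausts `ℤ` and eventually agrees with `τ`. -/
structure Exhausts (τ : ℤ → ℤ) (t : ℕ → ℤ → ℤ) (B M : ℕ → ℕ) : Prop where
  hB : Tendsto B atTop atTop
  hM : Tendsto M atTop atTop
  lim : ∀ i, ∀ᶠ n in atTop, t n i = τ i
  mono : ∀ᶠ n in atTop, MonotoneOn (t n) (Set.Icc (1 - (M n : ℤ)) (B n))

theorem Exhausts.window {τ : ℤ → ℤ} {t : ℕ → ℤ → ℤ} {B M : ℕ → ℕ} (he : Exhausts τ t B M) (P : ℕ) :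
    ∀ᶠ n in atTop, Window τ (t n) P (B n) (M n) := by
  have h1 : ∀ᶠ n in atTop, ∀ i ∈ Finset.Icc (-(P : ℤ)) P, t n i = τ i :=
    (Finset.eventually_all _).2 fun i _ => he.lim i
  filter_upwards [he.hB.eventually_ge_atTop P, he.hM.eventually_ge_atTop P, h1, he.mono]
    with n h2 h3 h4 h5
  exact ⟨h2, h3, fun i hi => h4 i (Finset.mem_Icc.2 (abs_le.1 hi)), h5⟩

theorem exhausts_const {τ : ℤ → ℤ} (hτ : Monotone τ) : Exhausts τ (fun _ => τ) id id :=
  ⟨tendsto_id, tendsto_id, fun _ => Eventually.of_forall fun _ => rfl, Eventually.of_forall fun _ => hτ.monotoneOn _⟩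

theorem nodes_injective {t : ℤ → ℤ} {B M : ℕ} (h : MonotoneOn t (Set.Icc (1 - (M : ℤ)) B)) :
    Function.Injective (nodes t B M) := by
  have key : ∀ i j : Fin (B + M), i < j → nodes t B M j < nodes t B M i := by
    intro i j hij
    have h1 : (i : ℕ) < j := hij
    have h2 := j.isLt
    have := h (a := (B : ℤ) - (j : ℕ)) (b := (B : ℤ) - (i : ℕ)) ⟨by omega, by omega⟩ ⟨by omega, by omega⟩
      (by omega)
    simp only [nodes]
    omega
  intro i j hij
  rcases lt_trichotomy i j with h1 | h1 | h1
  · exact absurd hij (key i j h1).ne'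
  · exact h1
  · exact absurd hij (key j i h1).ne

theorem integralConverges {q : ℝ} (hq0 : 0 < q) (hq1 : q < 1) {τ : ℤ → ℤ} (hτ : Monotone τ) {x : ℂ}
    (hx : x ≠ 0) : IntegralConverges q τ x := by
  have he := exhausts_const hτ
  intro c hc
  refine (tendsto_dblInt hq0 hq1 he.hB he.hM he.window hx ?_).1
  rcases hc with h | h
  · exact Or.inr (by rw [neg_neg]; exact h)
  · exact Or.inl h

/-- The truncation must be long relative to `|log ‖x‖|` before the residue computation applies. -/
theorem eventually_large {q : ℝ} (hq0 : 0 < q) (hq1 : q < 1) (a : ℝ) {B M : ℕ → ℕ}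
    (hB : Tendsto B atTop atTop) (hM : Tendsto M atTop atTop) :
    ∀ᶠ n in atTop, a + Real.log q * (B n + 1) ≤ -1 ∧ 1 ≤ a - Real.log q * M n := by
  have hL := Real.log_neg hq0 hq1
  obtain ⟨P, hP⟩ := exists_nat_gt ((|a| + 1) / -Real.log q)
  rw [div_lt_iff₀ (by linarith)] at hP
  filter_upwards [hB.eventually_ge_atTop P, hM.eventually_ge_atTop P] with n h1 h2
  have h1' : (P : ℝ) ≤ B n := by exact_mod_cast h1
  have h2' : (P : ℝ) ≤ M n := by exact_mod_cast h2
  have h3 := mul_le_mul_of_nonneg_right h1' (neg_pos.2 hL).le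
  have h4 := mul_le_mul_of_nonneg_right h2' (neg_pos.2 hL).le
  have h5 := le_abs_self a
  have h6 := neg_abs_le a
  constructor <;> linarith

theorem laurentSum_eq {q : ℝ} (hq0 : 0 < q) (hq1 : q < 1) {t : ℤ → ℤ} {B M : ℕ}
    (hinj : Function.Injective (nodes t B M)) {x : ℂ} (hx : x ≠ 0)
    (h : Real.log ‖x‖ + Real.log q * (B + 1) ≤ -1 ∧ 1 ≤ Real.log ‖x‖ - Real.log q * M) :
    laurentSum q (nodes t B M) B x =
      -(Real.log q : ℂ) ^ 2 * contourDiff q x (integrandFin q t B M x) := by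
  have hL0 : (Real.log q : ℂ) ≠ 0 := by exact_mod_cast (Real.log_neg hq0 hq1).ne
  rw [contourDiff_integrandFin hq0 hq1 hinj hx h.1 h.2]
  field_simp

theorem tendsto_laurentSum {q : ℝ} (hq0 : 0 < q) (hq1 : q < 1) {τ : ℤ → ℤ} {t : ℕ → ℤ → ℤ}
    {B M : ℕ → ℕ} (he : Exhausts τ t B M) {x : ℂ} (hx : x ≠ 0) :
    Tendsto (fun n => laurentSum q (nodes (t n) (B n) (M n)) (B n) x) atTop
      (𝓝 (-(Real.log q : ℂ) ^ 2 * contourDiff q x (integrand q τ x))) := by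
  have key : Tendsto (fun n => contourDiff q x (integrandFin q (t n) (B n) (M n) x)) atTop
      (𝓝 (contourDiff q x (integrand q τ x))) := by
    have l1 : IsLine q (Real.pi / (2 * Real.log q)) := Or.inr (neg_neg _).symm
    have l2 : IsLine q (-(Real.pi / (2 * Real.log q))) := Or.inl rfl
    have T1 := (tendsto_dblInt hq0 hq1 he.hB he.hM he.window hx l1).2
    have T2 := (tendsto_dblInt hq0 hq1 he.hB he.hM he.window hx l2).2
    unfold contourDiff
    rw [imagIntegral_lineIntegral hq0 hq1 fun c hc =>
      (tendsto_dblInt hq0 hq1 he.hB he.hM he.window hx hc).1]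
    refine Tendsto.sub ?_ tendsto_const_nhds
    refine Tendsto.congr' ?_ (((((T1.sub T2).div_const (2 * Real.pi * Complex.I)).mul_const
      Complex.I).neg).div_const (2 * Real.pi * Complex.I))
    obtain ⟨P, C, hPC⟩ := integrable_integrandFin_and_bound hq0 hq1 τ (norm_pos_iff.2 hx)
    filter_upwards [he.window P] with n hn
    rw [imagIntegral_lineIntegral hq0 hq1 fun c hc => (hPC _ _ _ x rfl hn c hc).1]
  refine (key.const_mul _).congr' ?_
  filter_upwards [eventually_large hq0 hq1 (Real.log ‖x‖) he.hB he.hM, he.mono] with n hn hm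
  rw [laurentSum_eq hq0 hq1 (nodes_injective hm) hx hn]

theorem norm_single_integral_le {q : ℝ} (hq0 : 0 < q) (hq1 : q < 1) {x : ℂ} (hx : x ≠ 0) :
    ‖imagIntegral (-(Real.pi / (2 * Real.log q))) (Real.pi / (2 * Real.log q))
      (fun v => x ^ v / (Real.log q : ℂ))‖ ≤
      Real.exp (Real.pi * -(Real.pi / (2 * Real.log q))) / |Real.log q| *
        |Real.pi / (2 * Real.log q) - -(Real.pi / (2 * Real.log q))| / (2 * Real.pi) := by
  have hpos := half_period_pos hq0 hq1
  have hd : ‖(2 * (Real.pi : ℂ) * Complex.I)‖ = 2 * Real.pi := by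
    simp [abs_of_pos Real.pi_pos]
  rw [imagIntegral, norm_div, hd]
  refine div_le_div_of_nonneg_right ?_ (by positivity)
  refine intervalIntegral.norm_integral_le_of_norm_le_const fun s hs => ?_
  rw [Set.uIoc_of_ge (by linarith)] at hs
  rw [norm_mul, Complex.norm_I, mul_one, norm_div, Complex.norm_real, Real.norm_eq_abs]
  refine div_le_div_of_nonneg_right ?_ (abs_nonneg _)
  have h1 := norm_cpow_le_strip hx (h := -(Real.pi / (2 * Real.log q))) (u := (s : ℂ) * Complex.I) (by
    simp only [strip, Set.mem_ofPred_eq]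
    have : ((s : ℂ) * Complex.I).im = s := by simp
    rw [this]
    exact abs_le.2 ⟨by linarith [hs.1], hs.2⟩)
  simpa using h1

theorem laurentSum_bounded {q : ℝ} (hq0 : 0 < q) (hq1 : q < 1) {τ : ℤ → ℤ} {t : ℕ → ℤ → ℤ}
    {B M : ℕ → ℕ} (he : Exhausts τ t B M) {ρ : ℝ} (hρ : 0 < ρ) :
    ∃ C, ∀ᶠ n in atTop, ∀ x, ‖x‖ = ρ → ‖laurentSum q (nodes (t n) (B n) (M n)) (B n) x‖ ≤ C := by
  obtain ⟨P, C, hPC⟩ := integrable_integrandFin_and_bound hq0 hq1 τ hρ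
  have l1 : IsLine q (Real.pi / (2 * Real.log q)) := Or.inr (neg_neg _).symm
  have l2 : IsLine q (-(Real.pi / (2 * Real.log q))) := Or.inl rfl
  have hd : ‖(2 * (Real.pi : ℂ) * Complex.I)‖ = 2 * Real.pi := by
    simp [abs_of_pos Real.pi_pos]
  have hpi := Real.pi_pos
  obtain ⟨E, hE⟩ : ∃ E : ℝ, E = Real.exp (Real.pi * -(Real.pi / (2 * Real.log q))) / |Real.log q| *
        |Real.pi / (2 * Real.log q) - -(Real.pi / (2 * Real.log q))| / (2 * Real.pi) := ⟨_, rfl⟩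
  refine ⟨|Real.log q| ^ 2 * ((C + C) / (2 * Real.pi) / (2 * Real.pi) + E), ?_⟩
  filter_upwards [eventually_large hq0 hq1 (Real.log ρ) he.hB he.hM, he.window P]
    with n h1 h2 x hx
  have hx0 : x ≠ 0 := fun h0 => by rw [h0, norm_zero] at hx; exact hρ.ne hx
  rw [laurentSum_eq hq0 hq1 (nodes_injective h2.mono) hx0 (by rw [hx]; exact h1), norm_mul,
    norm_neg, norm_pow, Complex.norm_real, Real.norm_eq_abs]
  refine mul_le_mul_of_nonneg_left ?_ (by positivity)
  have h3 := norm_single_integral_le hq0 hq1 hx0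
  rw [← hE] at h3
  rw [contourDiff, imagIntegral_lineIntegral hq0 hq1 fun c hc => (hPC _ _ _ x hx h2 c hc).1]
  refine (norm_sub_le _ _).trans (add_le_add ?_ h3)
  rw [norm_div, norm_neg, norm_mul, norm_div, hd, Complex.norm_I, mul_one]
  gcongr
  exact (norm_sub_le _ _).trans (add_le_add (hPC _ _ _ x hx h2 _ l1).2 (hPC _ _ _ x hx h2 _ l2).2)

end
end QSchur

namespace QSchur
noncomputable section
variable {k N K : ℕ}

/-! ### The normalized Schur polynomial in one variable -/

/-- Multiplying all nodes by `q^c` multiplies the coefficient of `y^b` in the basis polynomial by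
`q^(-cb)`, which the factor `y_m^b` undoes. -/
theorem coef_add {q : ℝ} (hq0 : 0 < q) (a : Fin N → ℤ) (c : ℤ) (b : ℕ) (m : Fin N) :
    coef q (fun m => a m + c) b m = coef q a b m := by
  have hq : (q : ℂ) ≠ 0 := by exact_mod_cast hq0.ne'
  have hκ : (q : ℂ) ^ c ≠ 0 := zpow_ne_zero _ hq
  have h1 : (Lagrange.basis Finset.univ (fun m => (q : ℂ) ^ (a m + c)) m).comp
      (Polynomial.C ((q : ℂ) ^ c) * Polynomial.X) =
      Lagrange.basis Finset.univ (fun m => (q : ℂ) ^ a m) m := by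
    rw [Lagrange.basis, Lagrange.basis, Polynomial.prod_comp]
    refine Finset.prod_congr rfl fun j _ => ?_
    have e : (q : ℂ) ^ (a m + c) - (q : ℂ) ^ (a j + c) =
        ((q : ℂ) ^ a m - (q : ℂ) ^ a j) * (q : ℂ) ^ c := by
      rw [zpow_add₀ hq, zpow_add₀ hq]; ring
    rw [Lagrange.basisDivisor, Lagrange.basisDivisor, Polynomial.mul_comp, Polynomial.C_comp,
      Polynomial.sub_comp, Polynomial.X_comp, Polynomial.C_comp, e, zpow_add₀ hq, mul_inv]
    simp only [map_mul]
    have h2 : Polynomial.C ((q : ℂ) ^ c)⁻¹ * Polynomial.C ((q : ℂ) ^ c) = 1 := by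
      rw [← map_mul, inv_mul_cancel₀ hκ, map_one]
    linear_combination (Polynomial.C ((q : ℂ) ^ a m - (q : ℂ) ^ a j)⁻¹ *
      (Polynomial.X - Polynomial.C ((q : ℂ) ^ a j))) * h2
  rw [coef, coef, ← h1, Polynomial.comp_C_mul_X_coeff, zpow_add₀ hq, mul_pow]
  ring

/-- The sequence `i ↦ l_(b+1-i)`. -/
def rowSeq (l : Fin N → ℤ) (b : ℕ) (i : ℤ) : ℤ := row l ((b : ℤ) + 1 - i)

/-- The exponents of the alternant and the nodes `t_i + i - 1` differ by the constant `M = N - b`.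
-/
theorem nodes_rowSeq {b M : ℕ} (l : Fin (b + M) → ℤ) (j : Fin (b + M)) :
    ex l j = nodes (rowSeq l b) b M j + M := by
  have := j.isLt
  rw [nodes, rowSeq, row, dif_pos (by omega), ex]
  have e : (⟨((b : ℤ) + 1 - ((b : ℤ) - (j : ℕ)) - 1).toNat, by omega⟩ : Fin (b + M)) = j := by
    apply Fin.ext
    simp only
    omega
  rw [e]
  push_cast
  ring

theorem monotoneOn_rowSeq {b M : ℕ} {l : Fin (b + M) → ℤ} (hl : Antitone l) :
    MonotoneOn (rowSeq l b) (Set.Icc (1 - (M : ℤ)) b) := by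
  intro i hi j hj hij
  obtain ⟨h1, h2⟩ := hi
  obtain ⟨h3, h4⟩ := hj
  rw [rowSeq, rowSeq, row, row, dif_pos (by omega), dif_pos (by omega)]
  refine hl ?_
  show ((b : ℤ) + 1 - j - 1).toNat ≤ ((b : ℤ) + 1 - i - 1).toNat
  omega

theorem rowPoly_eq {q : ℝ} (hq0 : 0 < q) {b M : ℕ} (l : Fin (b + M) → ℤ) {x : ℂ} (hx : x ≠ 0) :
    rowPoly q (ex l) b ((q : ℂ) ^ b * x) = x ^ M * laurentSum q (nodes (rowSeq l b) b M) b x := by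
  have h1 : ∀ m, coef q (ex l) b m = coef q (nodes (rowSeq l b) b M) b m := by
    intro m
    rw [← coef_add hq0 (nodes (rowSeq l b) b M) M]
    congr 1
    funext j
    exact nodes_rowSeq l j
  rw [rowPoly, laurentSum, Finset.mul_sum]
  refine Finset.sum_congr rfl fun m _ => ?_
  rw [← h1, coef, mul_zpow, ← zpow_natCast ((q : ℂ) ^ ex l m) b, ← zpow_natCast (q : ℂ) b, ← zpow_mul,
    ← zpow_mul, mul_comm (b : ℤ)]
  have e : x ^ ex l m = x ^ M * x ^ nodes (rowSeq l b) b M m := by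
    rw [nodes_rowSeq, zpow_add₀ hx, zpow_natCast, mul_comm]
  rw [e]
  ring

theorem prod_erase_middle (b M : ℕ) (f : ℕ → ℂ) :
    ∏ j ∈ Finset.univ.erase (⟨b, by omega⟩ : Fin (b + (M + 1))), f j =
      (∏ j ∈ Finset.range b, f (b - (j + 1))) * ∏ j ∈ Finset.range M, f (b + (j + 1)) := by
  have h1 : ∏ j ∈ Finset.univ.erase (⟨b, by omega⟩ : Fin (b + (M + 1))), f j =
      ∏ j : Fin (b + (M + 1)), Function.update f b 1 (j : ℕ) := by
    rw [← Finset.mul_prod_erase Finset.univ _ (Finset.mem_univ (⟨b, by omega⟩ : Fin (b + (M + 1))))]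
    simp only [Function.update_self, one_mul]
    refine Finset.prod_congr rfl fun j hj => ?_
    rw [Function.update_of_ne]
    intro h
    exact Finset.ne_of_mem_erase hj (Fin.ext h)
  rw [h1, Fin.prod_univ_eq_prod_range (fun j => Function.update f b 1 j), Finset.prod_range_add,
    Finset.prod_range_succ' (fun j => Function.update f b 1 (b + j)), add_zero, Function.update_self,
    mul_one, ← Finset.prod_range_reflect]
  congr 1
  · refine Finset.prod_congr rfl fun j hj => ?_
    have := Finset.mem_range.1 hj
    rw [Function.update_of_ne (by omega)]
    congr 1; omega
  · exact Finset.prod_congr rfl fun j _ => Function.update_of_ne (by omega) _ _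

theorem one_sub_qpow_ne_zero {q : ℝ} (hq0 : 0 < q) (hq1 : q < 1) (n : ℕ) : 1 - (q : ℂ) ^ (n + 1) ≠ 0 := by
  rw [sub_ne_zero]
  norm_cast
  exact (pow_lt_one₀ hq0.le hq1 (Nat.succ_ne_zero n)).ne'

/-- Nodes above and below the index `b` give the two q-Pochhammer quotients; these become the
prefactor of the contour integral formula. -/
theorem nodePoly_eq {q : ℝ} (hq0 : 0 < q) (hq1 : q < 1) (b M : ℕ) {x : ℂ} (hx : x ≠ 0) :
    nodePoly q (b + (M + 1)) ⟨b, by omega⟩ ((q : ℂ) ^ b * x) =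
      (qPoch (q * x) q b / qPoch q q b) * (x ^ M * (qPoch (q / x) q M / qPoch q q M)) := by
  have hq : (q : ℂ) ≠ 0 := by exact_mod_cast hq0.ne'
  rw [nodePoly, eval_lagrange_basis]
  simp only
  rw [prod_erase_middle b M fun j => ((q : ℂ) ^ b * x - (q : ℂ) ^ j) / ((q : ℂ) ^ b - (q : ℂ) ^ j)]
  simp only [qPoch]
  have hxM : x ^ M = ∏ _j ∈ Finset.range M, x := by simp
  rw [← Finset.prod_div_distrib, ← Finset.prod_div_distrib, hxM, ← Finset.prod_mul_distrib]
  congr 1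
  · refine Finset.prod_congr rfl fun j hj => ?_
    have hj' := Finset.mem_range.1 hj
    have h1 := one_sub_qpow_ne_zero hq0 hq1 j
    have h2 : (q : ℂ) ^ (b - (j + 1)) ≠ 0 := pow_ne_zero _ hq
    have e : (q : ℂ) ^ b = (q : ℂ) ^ (b - (j + 1)) * (q : ℂ) ^ (j + 1) := by
      rw [← pow_add]; congr 1; omega
    have e1 : (q : ℂ) ^ b * x - (q : ℂ) ^ (b - (j + 1)) =
        -(q : ℂ) ^ (b - (j + 1)) * (1 - q * x * (q : ℂ) ^ j) := by rw [e, pow_succ]; ring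
    have e2 : (q : ℂ) ^ b - (q : ℂ) ^ (b - (j + 1)) =
        -(q : ℂ) ^ (b - (j + 1)) * (1 - q * (q : ℂ) ^ j) := by rw [e, pow_succ]; ring
    rw [e1, e2, mul_div_mul_left _ _ (neg_ne_zero.2 h2)]
  · refine Finset.prod_congr rfl fun j _ => ?_
    have h2 : (q : ℂ) ^ b ≠ 0 := pow_ne_zero _ hq
    have e1 : (q : ℂ) ^ b * x - (q : ℂ) ^ (b + (j + 1)) =
        (q : ℂ) ^ b * (x * (1 - q / x * (q : ℂ) ^ j)) := by
      rw [pow_add, pow_succ]; field_simp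
    have e2 : (q : ℂ) ^ b - (q : ℂ) ^ (b + (j + 1)) = (q : ℂ) ^ b * (1 - q * (q : ℂ) ^ j) := by
      rw [pow_add, pow_succ]; ring
    rw [e1, e2, mul_div_mul_left _ _ h2, mul_div_assoc]

theorem ne_zero_of_notMem_badSet {q : ℝ} {x : ℂ} (hx : x ∉ badSet q) : x ≠ 0 :=
  fun h => hx (Or.inl h)

/-- The normalized Schur polynomial in one variable as a Laurent sum. -/
theorem oneVar_eq_laurentSum {q : ℝ} (hq0 : 0 < q) (hq1 : q < 1) {b M : ℕ} {l : Fin (b + (M + 1)) → ℤ}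
    (hl : Antitone l) {x : ℂ} (hx : x ∉ badSet q) :
    oneVar q l b x = x * (qPoch q q b / qPoch (q * x) q b) * (qPoch q q M / qPoch (q / x) q M) *
      laurentSum q (nodes (rowSeq l b) b (M + 1)) b x := by
  have hx0 := ne_zero_of_notMem_badSet hx
  have hxM : x ^ M ≠ 0 := pow_ne_zero _ hx0
  rw [oneVar_generic hq0 hq1 hl (by omega) hx, rowPoly_eq hq0 l hx0, nodePoly_eq hq0 hq1 b M hx0,
    div_eq_mul_inv, mul_inv, mul_inv, inv_div, inv_div, pow_succ]
  field_simp

/-! ### Limits of the prefactors -/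

theorem qPoch_terms_summable {q : ℝ} (hq0 : 0 < q) (hq1 : q < 1) (a : ℂ) :
    Summable fun i : ℕ => ‖-(a * (q : ℂ) ^ i)‖ := by
  simp only [norm_neg, norm_mul, norm_pow, Complex.norm_real, Real.norm_of_nonneg hq0.le]
  exact (summable_geometric_of_lt_one hq0.le hq1).mul_left _

theorem tendsto_qPoch {q : ℝ} (hq0 : 0 < q) (hq1 : q < 1) (a : ℂ) :
    Tendsto (fun n => qPoch a q n) atTop (𝓝 (qPochInf a q)) := by
  have h := (multipliable_one_add_of_summable (qPoch_terms_summable hq0 hq1 a)).tendsto_prod_tprod_nat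
  simpa only [qPoch, qPochInf, sub_eq_add_neg] using h

theorem qPochInf_ne_zero {q : ℝ} (hq0 : 0 < q) (hq1 : q < 1) {a : ℂ} (ha : ∀ i : ℕ, a * (q : ℂ) ^ i ≠ 1) :
    qPochInf a q ≠ 0 := by
  have h := tprod_one_add_ne_zero_of_summable (f := fun i : ℕ => -(a * (q : ℂ) ^ i))
    (fun i => by rw [← sub_eq_add_neg, sub_ne_zero]; exact (ha i).symm) (qPoch_terms_summable hq0 hq1 a)
  simpa only [qPochInf, sub_eq_add_neg] using h

/-- The quotients `1 / (a; q)_n` are bounded, uniformly on circles without poles. -/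
theorem norm_inv_qPoch_le {q : ℝ} (hq0 : 0 < q) (hq1 : q < 1) {ρ : ℝ}
    (hρ : ∀ n : ℤ, ρ ≠ q ^ n) : ∃ C, ∀ (n : ℕ) (a : ℂ), ‖a‖ = ρ → ‖(qPoch a q n)⁻¹‖ ≤ C := by
  have hne : ∀ i : ℕ, ((ρ : ℝ) : ℂ) * (q : ℂ) ^ i ≠ 1 := by
    intro i h
    norm_cast at h
    refine hρ (-(i : ℤ)) ?_
    rw [zpow_neg, zpow_natCast]
    exact eq_inv_of_mul_eq_one_left h
  have h1 := ((tendsto_qPoch hq0 hq1 (ρ : ℂ)).inv₀ (qPochInf_ne_zero hq0 hq1 hne)).norm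
  obtain ⟨C, hC⟩ := h1.bddAbove_range
  refine ⟨C, fun n a ha => le_trans ?_ (hC ⟨n, rfl⟩)⟩
  simp only [norm_inv]
  refine inv_anti₀ ?_ ?_
  · rw [norm_pos_iff, qPoch, Finset.prod_ne_zero_iff]
    exact fun i _ => sub_ne_zero.2 (hne i).symm
  -- On the circle `|1 - a q^i|` is smallest at the positive point `a = ρ`, for which the products
  -- converge to a nonzero limit.
  · rw [qPoch, qPoch, norm_prod, norm_prod]
    refine Finset.prod_le_prod (fun _ _ => norm_nonneg _) fun i _ => ?_
    have h2 := abs_norm_sub_norm_le (1 : ℂ) (a * (q : ℂ) ^ i)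
    rw [norm_one, norm_mul, ha, norm_pow, Complex.norm_real, Real.norm_of_nonneg hq0.le] at h2
    refine le_trans (le_of_eq ?_) h2
    rw [← Real.norm_eq_abs, ← Complex.norm_real]
    push_cast
    rfl

theorem norm_qPoch_le {q : ℝ} (hq0 : 0 < q) (hq1 : q < 1) : ∃ C, ∀ n : ℕ, ‖qPoch (q : ℂ) q n‖ ≤ C := by
  obtain ⟨C, hC⟩ := (tendsto_qPoch hq0 hq1 (q : ℂ)).norm.bddAbove_range
  exact ⟨C, fun n => hC ⟨n, rfl⟩⟩

end
end QSchur

namespace QSchur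
noncomputable section
variable {k N K : ℕ}

/-! ### Convergence in one variable -/

/-- Letting `n → ∞` with `y` fixed, `f y` stays in any closed neighbourhood of `f x` that eventually
contains `F n y`. -/
theorem ContConv.continuousOn {X : Type*} [TopologicalSpace X] {F : ℕ → X → ℂ} {f : X → ℂ} {U : Set X}
    (hU : IsOpen U) (h : ContConv F f U) : ContinuousOn f U := by
  intro x hx
  refine ContinuousAt.continuousWithinAt ?_
  refine (closed_nhds_basis (f x)).tendsto_right_iff.2 fun V ⟨hV, hVc⟩ => ?_
  have h1 := (h x hx).eventually hV
  obtain ⟨pa, hpa, pb, hpb, hp⟩ := eventually_prod_iff.1 h1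
  filter_upwards [hpb, hU.mem_nhds hx] with y hy hyU
  refine hVc.mem_of_tendsto (h.tendsto hyU) ?_
  filter_upwards [hpa] with n hn using hp hn hy

theorem ContConv.differentiableOn {F : ℕ → ℂ → ℂ} {f : ℂ → ℂ} {U : Set ℂ} (hU : IsOpen U)
    (h : ContConv F f U) (hF : ∀ᶠ n in atTop, DifferentiableOn ℂ (F n) U) : DifferentiableOn ℂ f U := by
  refine TendstoLocallyUniformlyOn.differentiableOn (φ := atTop) ?_ hF hU
  rw [tendstoLocallyUniformlyOn_iff_forall_isCompact hU]
  exact fun K hKU hK => h.tendstoUniformlyOn (h.continuousOn hU) hK hKU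

theorem tendsto_ddCirc_one {ρ : ℝ} (hρ : 0 < ρ) {G : ℕ → ℂ → ℂ} {g : ℂ → ℂ}
    (hG : ∀ᶠ n in atTop, ContinuousOn (G n) (Metric.sphere 0 ρ))
    (hb : ∃ C, ∀ᶠ n in atTop, ∀ z ∈ Metric.sphere (0 : ℂ) ρ, ‖G n z‖ ≤ C)
    (hlim : ∀ z ∈ Metric.sphere (0 : ℂ) ρ, Tendsto (fun n => G n z) atTop (𝓝 (g z)))
    {w : ℂ} (hw : ‖w‖ ≠ ρ) :
    Tendsto (fun p : ℕ × ℂ => ∮ z in C(0, ρ), G p.1 z * (z - p.2)⁻¹) (atTop ×ˢ 𝓝 w)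
      (𝓝 (∮ z in C(0, ρ), g z * (z - w)⁻¹)) := by
  have h4 := tendsto_ddCirc hρ hG hb hlim Finset.univ (x := fun _ : Fin 1 => w) fun _ => hw
  have hmap : Tendsto (fun p : ℕ × ℂ => ((p.1, fun _ => p.2) : ℕ × (Fin 1 → ℂ)))
        (atTop ×ˢ 𝓝 w) (atTop ×ˢ 𝓝 fun _ : Fin 1 => w) :=
      tendsto_fst.prodMk (tendsto_pi_nhds.2 fun _ => tendsto_snd)
  have h5 := Tendsto.comp h4 hmap
  simp only [ddCirc, Finset.univ_unique, Finset.prod_singleton] at h5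
  exact h5
-- For finite `n` Cauchy's formula expresses `F n w` through its values on two circles around the
-- origin. Bounds and pointwise limits on circles of arbitrarily small and large radius therefore
-- give convergence everywhere in `ℂ*`, including the points where the limit formula has a vanishing
-- denominator.
theorem exists_contConv_of_circles {F : ℕ → ℂ → ℂ} (hF : ∀ᶠ n in atTop, DifferentiableOn ℂ (F n) {0}ᶜ)
    {φ : ℂ → ℂ} {A : Set ℝ} (hpos : ∀ r ∈ A, 0 < r) (hsmall : ∀ ε > 0, ∃ r ∈ A, r < ε)
    (hlarge : ∀ R, ∃ r ∈ A, R < r)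
    (hb : ∀ ρ ∈ A, ∃ C, ∀ᶠ n in atTop, ∀ z, ‖z‖ = ρ → ‖F n z‖ ≤ C)
    (hlim : ∀ z, ‖z‖ ∈ A → Tendsto (fun n => F n z) atTop (𝓝 (φ z))) :
    ∃ Ψ, DifferentiableOn ℂ Ψ {0}ᶜ ∧ ContConv F Ψ {0}ᶜ := by
  have hU : IsOpen ({0}ᶜ : Set ℂ) := isOpen_compl_singleton
  have key : ∀ w : ℂ, ∃ y, w ≠ 0 → Tendsto (fun p : ℕ × ℂ => F p.1 p.2) (atTop ×ˢ 𝓝 w) (𝓝 y) := by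
    intro w
    by_cases hw : w = 0
    · exact ⟨0, fun h => absurd hw h⟩
    obtain ⟨r, hrA, hr⟩ := hsmall ‖w‖ (norm_pos_iff.2 hw)
    obtain ⟨R, hRA, hR⟩ := hlarge ‖w‖
    have hcirc : ∀ ρ ∈ A, ‖w‖ ≠ ρ → Tendsto (fun p : ℕ × ℂ => ∮ z in C(0, ρ), F p.1 z * (z - p.2)⁻¹)
        (atTop ×ˢ 𝓝 w) (𝓝 (∮ z in C(0, ρ), φ z * (z - w)⁻¹)) := by
      intro ρ hρ hne
      refine tendsto_ddCirc_one (hpos ρ hρ) ?_ ?_ ?_ hne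
      · filter_upwards [hF] with n hn
        refine hn.continuousOn.mono fun z hz h0 => ?_
        rw [Set.mem_singleton_iff.1 h0, mem_sphere_zero_iff_norm, norm_zero] at hz
        exact (hpos ρ hρ).ne hz
      · obtain ⟨C, hC⟩ := hb ρ hρ
        exact ⟨C, by filter_upwards [hC] with n hn z hz using hn z (mem_sphere_zero_iff_norm.1 hz)⟩
      · intro z hz
        exact hlim z (by rwa [mem_sphere_zero_iff_norm.1 hz])
    refine ⟨_, fun _ => (((hcirc R hRA hR.ne).sub (hcirc r hrA hr.ne')).const_mul
      (2 * Real.pi * Complex.I)⁻¹).congr' ?_⟩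
    have hann : {z : ℂ | r < ‖z‖ ∧ ‖z‖ < R} ∈ 𝓝 w :=
      ((isOpen_lt continuous_const continuous_norm).inter
        (isOpen_lt continuous_norm continuous_const)).mem_nhds ⟨hr, hR⟩
    filter_upwards [hF.prod_mk hann] with p hp
    have h1 := cauchy_annulus (hpos r hrA) hp.1 hp.2.1 hp.2.2
    rw [h1, inv_mul_cancel_left₀ Complex.two_pi_I_ne_zero]
  choose Ψ hΨ using key
  have hc : ContConv F Ψ {0}ᶜ := fun w hw => hΨ w hw
  exact ⟨Ψ, hc.differentiableOn hU hF, hc⟩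

theorem oneVar_eq_laurentSum' {q : ℝ} (hq0 : 0 < q) (hq1 : q < 1) {l : Fin N → ℤ}
    (hl : Antitone l) {b : ℕ} (hb : b < N) {x : ℂ} (hx : x ∉ badSet q) :
    oneVar q l b x = x * (qPoch q q b / qPoch (q * x) q b) *
      (qPoch q q (N - b - 1) / qPoch (q / x) q (N - b - 1)) *
      laurentSum q (nodes (rowSeq l b) b (N - b)) b x := by
  obtain ⟨M, rfl⟩ := Nat.exists_eq_add_of_lt hb
  have e : b + M + 1 - b = M + 1 := by omega
  rw [e]
  exact oneVar_eq_laurentSum hq0 hq1 (b := b) (M := M) hl hx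

theorem monotoneOn_rowSeq' {l : Fin N → ℤ} (hl : Antitone l) {b : ℕ} (hb : b ≤ N) :
    MonotoneOn (rowSeq l b) (Set.Icc (1 - ((N - b : ℕ) : ℤ)) b) := by
  obtain ⟨M, rfl⟩ := Nat.exists_eq_add_of_le hb
  rw [Nat.add_sub_cancel_left]
  exact monotoneOn_rowSeq hl

/-- The radii of the circles without poles. -/
def goodRadii (q : ℝ) : Set ℝ := {ρ | 0 < ρ ∧ ∀ n : ℤ, ρ ≠ q ^ n}

theorem exists_goodRadius (q : ℝ) {a b : ℝ} (h : a < b) (ha : 0 ≤ a) : ∃ ρ ∈ goodRadii q, a < ρ ∧ ρ < b := by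
  have hd : Dense (Set.range fun n : ℤ => q ^ n)ᶜ := (Set.countable_range _).dense_compl ℝ
  obtain ⟨ρ, h1, h2⟩ := hd.exists_between h
  exact ⟨ρ, ⟨ha.trans_lt h2.1, fun n hn => h1 ⟨n, hn.symm⟩⟩, h2⟩

theorem notMem_badSet_of_norm {q : ℝ} (hq0 : 0 < q) {x : ℂ} (hx : ‖x‖ ∈ goodRadii q) : x ∉ badSet q := by
  rintro (h | ⟨n, hn⟩)
  · rw [h, norm_zero] at hx
    exact lt_irrefl _ hx.1
  · refine hx.2 n ?_
    rw [← hn]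
    simp only [norm_zpow, Complex.norm_real, Real.norm_of_nonneg hq0.le]

/-- The hypotheses on `b` and on the signatures. -/
structure StableRows (b : ℕ → ℕ) (lam : ∀ N : ℕ, Fin N → ℤ) (t : ℤ → ℤ) : Prop where
  hb : Tendsto b atTop atTop
  hM : Tendsto (fun N : ℕ => (N : ℤ) - (b N : ℤ)) atTop atTop
  anti : ∀ N, Antitone (lam N)
  stab : Stabilizes b lam t

namespace StableRows

variable {b : ℕ → ℕ} {lam : ∀ N : ℕ, Fin N → ℤ} {t : ℤ → ℤ}

theorem eventually_add_le (hM : Tendsto (fun N : ℕ => (N : ℤ) - (b N : ℤ)) atTop atTop) (k : ℕ) :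
    ∀ᶠ N in atTop, b N + k ≤ N := by
  filter_upwards [hM.eventually_ge_atTop (k : ℤ)] with N hN
  omega

theorem tendsto_sub (hM : Tendsto (fun N : ℕ => (N : ℤ) - (b N : ℤ)) atTop atTop) (m : ℕ) :
    Tendsto (fun N => N - b N - m) atTop atTop := by
  refine tendsto_atTop.2 fun k => ?_
  filter_upwards [eventually_add_le hM (k + m)] with N hN
  omega

theorem exhausts (h : StableRows b lam t) :
    Exhausts t (fun N => rowSeq (lam N) (b N)) b (fun N => N - b N) where
  hB := h.hb
  hM := tendsto_sub h.hM 0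
  lim i := by
    have := h.stab i
    rw [nhds_discrete, tendsto_pure] at this
    exact this
  mono := by
    filter_upwards [eventually_add_le h.hM 0] with N hN
    exact monotoneOn_rowSeq' (h.anti N) hN

end StableRows

theorem mul_qpow_ne_one {q : ℝ} (hq0 : 0 < q) {x : ℂ} (hx : x ∉ badSet q) (i : ℕ) :
    (q : ℂ) * x * (q : ℂ) ^ i ≠ 1 ∧ (q : ℂ) / x * (q : ℂ) ^ i ≠ 1 := by
  have hq : (q : ℂ) ≠ 0 := by exact_mod_cast hq0.ne'
  have hx0 := ne_zero_of_notMem_badSet hx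
  constructor
  · intro h
    refine hx (Or.inr ⟨-((i : ℤ) + 1), ?_⟩)
    simp only
    rw [zpow_neg, zpow_add_one₀ hq, zpow_natCast]
    exact (eq_inv_of_mul_eq_one_left (by linear_combination h)).symm
  · intro h
    refine hx (Or.inr ⟨(i : ℤ) + 1, ?_⟩)
    simp only
    rw [zpow_add_one₀ hq, zpow_natCast]
    field_simp at h
    linear_combination h

theorem tendsto_oneVar {q : ℝ} (hq0 : 0 < q) (hq1 : q < 1) {b : ℕ → ℕ} {lam : ∀ N : ℕ, Fin N → ℤ}
    {t : ℤ → ℤ} (h : StableRows b lam t) {x : ℂ} (hx : x ∉ badSet q) :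
    Tendsto (fun N => oneVar q (lam N) (b N) x) atTop (𝓝 (phiFormula q t x)) := by
  have hx0 := ne_zero_of_notMem_badSet hx
  have T1 := (tendsto_qPoch hq0 hq1 (q : ℂ)).comp h.hb
  have T2 := (tendsto_qPoch hq0 hq1 ((q : ℂ) * x)).comp h.hb
  have T3 := (tendsto_qPoch hq0 hq1 (q : ℂ)).comp (StableRows.tendsto_sub h.hM 1)
  have T4 := (tendsto_qPoch hq0 hq1 ((q : ℂ) / x)).comp (StableRows.tendsto_sub h.hM 1)
  have T5 := tendsto_laurentSum hq0 hq1 h.exhausts hx0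
  have n2 := qPochInf_ne_zero hq0 hq1 fun i => (mul_qpow_ne_one hq0 hx i).1
  have n4 := qPochInf_ne_zero hq0 hq1 fun i => (mul_qpow_ne_one hq0 hx i).2
  have T := ((tendsto_const_nhds (x := x)).mul (T1.div T2 n2)).mul (T3.div T4 n4) |>.mul T5
  have e : phiFormula q t x = x * (qPochInf q q / qPochInf (q * x) q) *
      (qPochInf q q / qPochInf (q / x) q) *
      (-(Real.log q : ℂ) ^ 2 * contourDiff q x (integrand q t x)) := by
    have e1 : phiFormula q t x = -(x * (Real.log q : ℂ) ^ 2 * qPochInf (q : ℂ) q ^ 2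
      / (qPochInf ((q : ℂ) * x) q * qPochInf ((q : ℂ) / x) q)) * contourDiff q x (integrand q t x) := rfl
    rw [e1]
    field_simp
  rw [e]
  refine T.congr' ?_
  filter_upwards [StableRows.eventually_add_le h.hM 1] with N hN
  exact (oneVar_eq_laurentSum' hq0 hq1 (h.anti N) (by omega) hx).symm

/-- On a circle that contains no power of `q` in modulus, the prefactors and the Laurent sum are
bounded separately. -/
theorem oneVar_bounded {q : ℝ} (hq0 : 0 < q) (hq1 : q < 1) {b : ℕ → ℕ} {lam : ∀ N : ℕ, Fin N → ℤ}
    {t : ℤ → ℤ} (h : StableRows b lam t) {ρ : ℝ} (hρ : ρ ∈ goodRadii q) :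
    ∃ C, ∀ᶠ N in atTop, ∀ x, ‖x‖ = ρ → ‖oneVar q (lam N) (b N) x‖ ≤ C := by
  obtain ⟨C1, hC1⟩ := norm_qPoch_le hq0 hq1
  obtain ⟨C2, hC2⟩ := norm_inv_qPoch_le hq0 hq1 (ρ := q * ρ) (fun n hn => hρ.2 (n - 1) (by
    rw [zpow_sub_one₀ hq0.ne', ← hn]; field_simp))
  have hρ0 := hρ.1
  obtain ⟨C3, hC3⟩ := norm_inv_qPoch_le hq0 hq1 (ρ := q / ρ) (fun n hn => hρ.2 (1 - n) (by
    rw [zpow_sub₀ hq0.ne', ← hn]; field_simp))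
  obtain ⟨C4, hC4⟩ := laurentSum_bounded hq0 hq1 h.exhausts hρ.1
  have c1 : 0 ≤ C1 := (norm_nonneg _).trans (hC1 0)
  refine ⟨ρ * (C1 * C2) * (C1 * C3) * C4, ?_⟩
  filter_upwards [StableRows.eventually_add_le h.hM 1, hC4] with N hN h4 x hx
  have hxb := notMem_badSet_of_norm hq0 (x := x) (by rwa [hx])
  have h2 := hC2 (b N) (q * x) (by rw [norm_mul, hx, Complex.norm_real, Real.norm_of_nonneg hq0.le])
  have h3 := hC3 (N - b N - 1) (q / x) (by
    rw [norm_div, hx, Complex.norm_real, Real.norm_of_nonneg hq0.le])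
  have c2 : 0 ≤ C2 := (norm_nonneg _).trans h2
  have c3 : 0 ≤ C3 := (norm_nonneg _).trans h3
  rw [oneVar_eq_laurentSum' hq0 hq1 (h.anti N) (by omega) hxb, norm_mul, norm_mul, norm_mul, hx,
    div_eq_mul_inv, div_eq_mul_inv, norm_mul, norm_mul]
  gcongr
  · exact hC1 _
  · exact hC1 _
  · exact h4 x hx

/-- A vertical line through `x` meets the real axis, and so the excluded set, at most once. -/
theorem mem_closure_formulaDomain (q : ℝ) (x : ℂ) : x ∈ closure (formulaDomain q) := by
  refine dense_of_curve (fun r : ℝ => x + r * Complex.I) (by simp) (by fun_prop) ?_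
  refine (Set.countable_singleton (-x.im)).mono fun r hr => ?_
  by_contra hne
  refine hr ⟨Or.inr ?_, fun n hn => ?_⟩
  · simp only [Complex.add_im, Complex.mul_im, Complex.ofReal_re, Complex.I_im, mul_one,
      Complex.ofReal_im, Complex.I_re, mul_zero, add_zero]
    intro h0
    exact hne (by rw [Set.mem_singleton_iff]; linarith)
  · have := congrArg Complex.im hn
    rw [← Complex.ofReal_zpow, Complex.ofReal_im] at this
    simp at this
    exact hne (by rw [Set.mem_singleton_iff]; linarith)

theorem formulaDomain_notMem_badSet {q : ℝ} {x : ℂ} (hx : x ∈ formulaDomain q) : x ∉ badSet q := by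
  rintro (h | ⟨n, hn⟩)
  · exact Complex.slitPlane_ne_zero hx.1 h
  · exact hx.2 n hn.symm

/-- The limit in one variable. -/
theorem Phi_of_stableRows {q : ℝ} (hq0 : 0 < q) (hq1 : q < 1) {b : ℕ → ℕ} {lam : ∀ N : ℕ, Fin N → ℤ}
    {t : ℤ → ℤ} (h : StableRows b lam t) :
    DifferentiableOn ℂ (Phi q t) {0}ᶜ ∧ Set.EqOn (Phi q t) (phiFormula q t) (formulaDomain q) ∧
      ContConv (fun N => oneVar q (lam N) (b N)) (Phi q t) {0}ᶜ := by
  have hU : IsOpen ({0}ᶜ : Set ℂ) := isOpen_compl_singleton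
  obtain ⟨Ψ, hΨ, hconv⟩ := exists_contConv_of_circles (F := fun N => oneVar q (lam N) (b N))
    (φ := phiFormula q t) (A := goodRadii q)
    (Eventually.of_forall fun N => differentiableOn_oneVar hq0 (lam N) (b N)) (fun r hr => hr.1)
    (fun ε hε => by
      obtain ⟨ρ, h1, h2⟩ := exists_goodRadius q hε le_rfl
      exact ⟨ρ, h1, h2.2⟩)
    (fun R => by
      obtain ⟨ρ, h1, h2⟩ := exists_goodRadius q (lt_add_one |R|) (abs_nonneg R)
      exact ⟨ρ, h1, (le_abs_self R).trans_lt h2.1⟩)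
    (fun ρ hρ => oneVar_bounded hq0 hq1 h hρ)
    (fun z hz => tendsto_oneVar hq0 hq1 h (notMem_badSet_of_norm hq0 hz))
  have hform : Set.EqOn Ψ (phiFormula q t) (formulaDomain q) := fun x hx =>
    tendsto_nhds_unique (hconv.tendsto (ne_zero_of_notMem_badSet (formulaDomain_notMem_badSet hx)))
      (tendsto_oneVar hq0 hq1 h (formulaDomain_notMem_badSet hx))
  -- The limit function is continuous and agrees with the formula on a dense set, so it is the
  -- extension that defines `Phi`.
  have hPhi : Set.EqOn (Phi q t) Ψ {0}ᶜ := by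
    intro x hx
    refine extendFrom_eq (mem_closure_formulaDomain q x) ?_
    refine (((hΨ.continuousOn.continuousAt (hU.mem_nhds hx)).tendsto.mono_left
      nhdsWithin_le_nhds)).congr' ?_
    filter_upwards [self_mem_nhdsWithin] with y hy using hform hy
  refine ⟨hΨ.congr hPhi, fun x hx => ?_, fun x hx => ?_⟩
  · rw [hPhi (ne_zero_of_notMem_badSet (formulaDomain_notMem_badSet hx)), hform hx]
  · rw [hPhi hx]
    exact hconv x hx

end
end QSchur

namespace QSchur
noncomputable section
variable {k N K : ℕ}

/-! ### The limit functions and the direct statement -/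

/-- Every monotone `t` is cut out of itself with `b = N / 2`. Thus the analytic properties of `Phi`
follow from the limit theorem applied to these signatures. -/
theorem stableRows_of_monotone {t : ℤ → ℤ} (ht : Monotone t) :
    StableRows (fun N => N / 2) (fun N j => t (((N / 2 : ℕ) : ℤ) - (j : ℕ))) t where
  hb := Nat.tendsto_div_const_atTop two_ne_zero
  hM := by
    refine tendsto_atTop.2 fun c => ?_
    filter_upwards [eventually_ge_atTop (2 * c.toNat)] with N hN
    omega
  anti N i j hij := ht (by
    have : (i : ℕ) ≤ j := hij
    omega)
  stab i := by
    refine tendsto_nhds_of_eventually_eq ?_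
    filter_upwards [eventually_ge_atTop (2 * (i.natAbs + 1))] with N hN
    rw [row, dif_pos (by omega)]
    congr 1
    simp only
    omega

theorem Phi_differentiableOn {q : ℝ} (hq0 : 0 < q) (hq1 : q < 1) {t : ℤ → ℤ} (ht : Monotone t) :
    DifferentiableOn ℂ (Phi q t) {0}ᶜ :=
  (Phi_of_stableRows hq0 hq1 (stableRows_of_monotone ht)).1

theorem Phi_eqOn {q : ℝ} (hq0 : 0 < q) (hq1 : q < 1) {t : ℤ → ℤ} (ht : Monotone t) :
    Set.EqOn (Phi q t) (phiFormula q t) (formulaDomain q) :=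
  (Phi_of_stableRows hq0 hq1 (stableRows_of_monotone ht)).2.1

theorem shift_monotone {t : ℤ → ℤ} (ht : Monotone t) (m : ℤ) : Monotone (shift m t) :=
  fun _ _ h => ht (by omega)

theorem PhiMulti_differentiableOn {q : ℝ} (hq0 : 0 < q) (hq1 : q < 1) {t : ℤ → ℤ} (ht : Monotone t)
    (k : ℕ) : DifferentiableOn ℂ (PhiMulti q t k) (torus k) := by
  have hP := fun j : Fin k => Phi_differentiableOn hq0 hq1 (shift_monotone ht (((j : ℕ) : ℤ) + 1))
  exact ((differentiableOn_altExt (differentiableOn_hatFun hq0 hP)).const_mul _).congr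
    fun x hx => PhiMulti_eq hq0 t hP hx

theorem PhiMulti_eqOn {q : ℝ} (hq0 : 0 < q) (hq1 : q < 1) {t : ℤ → ℤ} (ht : Monotone t)
    (k : ℕ) : Set.EqOn (PhiMulti q t k) (phiDet q t) (regularTorus k) := by
  have hP := fun j : Fin k => Phi_differentiableOn hq0 hq1 (shift_monotone ht (((j : ℕ) : ℤ) + 1))
  intro x hx
  rw [PhiMulti_eq hq0 t hP hx.1, phiDet_eq, altExt_eq (differentiableOn_hatFun hq0 hP) hx]

/-- Moving the insertion point by `j` amounts to applying the map `A_(j+1)` to the limit sequence;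
this is the origin of the shifts in the determinant. -/
theorem StableRows.add {b : ℕ → ℕ} {lam : ∀ N : ℕ, Fin N → ℤ} {t : ℤ → ℤ} (h : StableRows b lam t)
    (j : ℕ) : StableRows (fun N => b N + j) lam (shift ((j : ℤ) + 1) t) where
  hb := tendsto_atTop_mono (fun N => Nat.le_add_right _ _) h.hb
  hM := by
    have := tendsto_atTop_add_const_right atTop (-(j : ℤ)) h.hM
    refine this.congr fun N => ?_
    push_cast; ring
  anti := h.anti
  stab i := by
    have := h.stab (i - j)
    have e : shift ((j : ℤ) + 1) t i = t (i - j) := by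
      rw [shift]; congr 1; ring
    rw [e]
    refine this.congr fun N => ?_
    congr 1
    push_cast; ring

theorem ContConv.hatFun {q : ℝ} (hq0 : 0 < q) {F : ℕ → Fin k → ℂ → ℂ} {G : Fin k → ℂ → ℂ} (j : Fin k)
    (h : ContConv (fun n => F n j) (G j) {0}ᶜ) :
    ContConv (fun n => QSchur.hatFun q (F n) j) (QSchur.hatFun q G j) {0}ᶜ := by
  have hq : (q : ℂ) ≠ 0 := by exact_mod_cast hq0.ne'
  intro x hx
  have hx' : x * (q : ℂ) ^ (-((j : ℕ) : ℤ)) ∈ ({0}ᶜ : Set ℂ) := mul_ne_zero hx (zpow_ne_zero _ hq)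
  have hmap : Tendsto (fun p : ℕ × ℂ => (p.1, p.2 * (q : ℂ) ^ (-((j : ℕ) : ℤ)))) (atTop ×ˢ 𝓝 x)
      (atTop ×ˢ 𝓝 (x * (q : ℂ) ^ (-((j : ℕ) : ℤ)))) :=
    tendsto_fst.prodMk (tendsto_snd.mul_const _)
  have hw : Tendsto (fun p : ℕ × ℂ => windowProd q j p.2) (atTop ×ˢ 𝓝 x) (𝓝 (windowProd q j x)) :=
    ((differentiable_windowProd q j).continuous.tendsto x).comp tendsto_snd
  exact ((h _ hx').comp hmap).mul hw

/-- The exact determinantal identity for finite `N`, entrywise convergence at the points `b + j`,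
and `contConv_altExt`. -/
theorem convergesTo_PhiMulti {q : ℝ} (hq0 : 0 < q) (hq1 : q < 1) {b : ℕ → ℕ}
    {lam : ∀ N : ℕ, Fin N → ℤ} {t : ℤ → ℤ} (ht : Monotone t) (h : StableRows b lam t) (k : ℕ) :
    ConvergesTo q b lam k (PhiMulti q t k) := by
  have hP := fun j : Fin k => Phi_differentiableOn hq0 hq1 (shift_monotone ht (((j : ℕ) : ℤ) + 1))
  have h1 : ContConv (fun N => altExt (hatFun q fun j : Fin k => oneVar q (lam N) (b N + j)))
      (altExt (hatFun q fun j : Fin k => Phi q (shift (((j : ℕ) : ℤ) + 1) t))) (torus k) :=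
    contConv_altExt (Eventually.of_forall fun N => differentiableOn_hatFun hq0 fun j =>
      differentiableOn_oneVar hq0 (lam N) (b N + j)) (differentiableOn_hatFun hq0 hP) fun j =>
      ContConv.hatFun hq0 (F := fun N j => oneVar q (lam N) (b N + j)) j
        (Phi_of_stableRows hq0 hq1 (h.add j)).2.2
  have h2 : ContConv (fun N (x : Fin k → ℂ) => normSchur q (lam N) (b N) x) (PhiMulti q t k)
      (torus k) := by
    intro x hx
    rw [PhiMulti_eq hq0 t hP hx]
    refine ((h1 x hx).const_mul (detConst q k)).congr' ?_
    filter_upwards [(StableRows.eventually_add_le h.hM k).prod_mk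
      (isOpen_torus.mem_nhds hx)] with p hp
    exact (normSchur_eq_altExt hq0 hq1 (h.anti p.1) hp.1 hp.2).symm
  exact fun K hKT hK => h2.tendstoUniformlyOn (PhiMulti_differentiableOn hq0 hq1 ht k).continuousOn hK hKT

end
end QSchur

namespace QSchur
noncomputable section
variable {k N K : ℕ}

/-! ### Two-sided bounds for the coefficients of the Laurent sum -/

/-- The exponent `t_i + i - 1`. -/
def node (t : ℤ → ℤ) (i : ℤ) : ℤ := t i + i - 1

/-- The window `1 - M ≤ i ≤ B`. -/
def win (B M : ℕ) : Finset ℤ := Finset.Icc (1 - (M : ℤ)) B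

theorem mem_win {B M : ℕ} {i : ℤ} : i ∈ win B M ↔ 1 - (M : ℤ) ≤ i ∧ i ≤ B := Finset.mem_Icc

theorem card_win (B M : ℕ) : (win B M).card = B + M := by
  rw [win, Int.card_Icc]; omega

/-- The coefficient of `x^(t_i + i - 1)`. -/
def wcoef (q : ℝ) (t : ℤ → ℤ) (B M : ℕ) (i : ℤ) : ℂ :=
  ((q : ℂ) ^ node t i) ^ B *
    (Lagrange.basis (win B M) (fun m => (q : ℂ) ^ node t m) i).coeff B

theorem laurentSum_nodes (q : ℝ) (t : ℤ → ℤ) (B M : ℕ) (x : ℂ) :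
    laurentSum q (nodes t B M) B x = ∑ i ∈ win B M, wcoef q t B M i * x ^ node t i := by
  have h1 : ∀ j : Fin (B + M), Lagrange.basis Finset.univ (fun m => (q : ℂ) ^ nodes t B M m) j =
      Lagrange.basis (win B M) (fun m => (q : ℂ) ^ node t m) ((B : ℤ) - (j : ℕ)) := by
    intro j
    rw [Lagrange.basis, Lagrange.basis]
    refine Finset.prod_bij (fun (m : Fin (B + M)) _ => (B : ℤ) - (m : ℕ)) ?_ ?_ ?_ fun _ _ => rfl
    · intro m hm
      have h1 : m ≠ j := Finset.ne_of_mem_erase hm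
      have h2 : (m : ℕ) ≠ j := fun h => h1 (Fin.ext h)
      have := m.isLt
      rw [Finset.mem_erase, mem_win]
      omega
    · intro m _ m' _ h
      exact Fin.ext (by omega)
    · intro i hi
      rw [Finset.mem_erase, mem_win] at hi
      refine ⟨⟨((B : ℤ) - i).toNat, by omega⟩, ?_, ?_⟩
      · rw [Finset.mem_erase]
        refine ⟨fun h => hi.1 ?_, Finset.mem_univ _⟩
        have := congrArg Fin.val h
        simp only at this
        omega
      · simp only
        omega
  rw [laurentSum]
  refine Finset.sum_bij (fun (m : Fin (B + M)) _ => (B : ℤ) - (m : ℕ)) ?_ ?_ ?_ ?_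
  · intro m _
    have := m.isLt
    rw [mem_win]
    omega
  · intro m _ m' _ h
    exact Fin.ext (by omega)
  · intro i hi
    rw [mem_win] at hi
    refine ⟨⟨((B : ℤ) - i).toNat, by omega⟩, Finset.mem_univ _, ?_⟩
    simp only
    omega
  · intro m _
    rw [coef, wcoef, h1]
    rfl

/-- The elementary symmetric polynomial in the numerator of the coefficient. -/
def wesymm (q : ℝ) (t : ℤ → ℤ) (B M : ℕ) (i : ℤ) : ℝ :=
  (∏ m ∈ (win B M).erase i, (Polynomial.X + Polynomial.C (q ^ node t m))).coeff B

theorem card_win_erase {B M : ℕ} {i : ℤ} (hi : i ∈ win B M) : ((win B M).erase i).card = B + M - 1 := by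
  rw [Finset.card_erase_of_mem hi, card_win]

theorem wesymm_eq (q : ℝ) (t : ℤ → ℤ) {B M : ℕ} (hM : 1 ≤ M) {i : ℤ} (hi : i ∈ win B M) :
    wesymm q t B M i = ∑ T ∈ ((win B M).erase i).powersetCard (M - 1), ∏ m ∈ T, q ^ node t m := by
  rw [wesymm, Finset.prod_X_add_C_coeff _ _ (by rw [card_win_erase hi]; omega), card_win_erase hi]
  congr 2
  omega

/-- The coefficient of `y^B` in `∏ (y - y_m)` is, up to sign, an elementary symmetric polynomial of
degree `M - 1` in positive numbers, so no cancellation occurs. -/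
theorem norm_wcoef {q : ℝ} (hq0 : 0 < q) (t : ℤ → ℤ) {B M : ℕ} (hM : 1 ≤ M) {i : ℤ}
    (hi : i ∈ win B M) : ‖wcoef q t B M i‖ = (q ^ node t i) ^ B * wesymm q t B M i /
      ∏ m ∈ (win B M).erase i, |q ^ node t i - q ^ node t m| := by
  have h1 : Lagrange.basis (win B M) (fun m => (q : ℂ) ^ node t m) i =
      Polynomial.C (∏ m ∈ (win B M).erase i, ((q : ℂ) ^ node t i - (q : ℂ) ^ node t m)⁻¹) *
      ∏ m ∈ (win B M).erase i, (Polynomial.X + Polynomial.C (-(q : ℂ) ^ node t m)) := by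
    rw [Lagrange.basis, map_prod, ← Finset.prod_mul_distrib]
    refine Finset.prod_congr rfl fun m _ => ?_
    rw [Lagrange.basisDivisor, map_neg, ← sub_eq_add_neg]
  have h2 : (∏ m ∈ (win B M).erase i, (Polynomial.X + Polynomial.C (-(q : ℂ) ^ node t m))).coeff B =
      (-1) ^ (M - 1) * (wesymm q t B M i : ℂ) := by
    rw [Finset.prod_X_add_C_coeff _ _ (by rw [card_win_erase hi]; omega), card_win_erase hi,
      wesymm_eq q t hM hi, show B + M - 1 - B = M - 1 by omega]
    push_cast
    rw [Finset.mul_sum]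
    refine Finset.sum_congr rfl fun T hT => ?_
    rw [← (Finset.mem_powersetCard.1 hT).2, ← Finset.prod_const, ← Finset.prod_mul_distrib]
    exact Finset.prod_congr rfl fun m _ => by ring
  have h3 : 0 ≤ wesymm q t B M i := by
    rw [wesymm_eq q t hM hi]
    exact Finset.sum_nonneg fun T _ => Finset.prod_nonneg fun m _ => (zpow_pos hq0 _).le
  rw [wcoef, h1, Polynomial.coeff_C_mul, h2, norm_mul, norm_mul, norm_mul, norm_pow, norm_pow, norm_neg,
    norm_one, one_pow, one_mul, Complex.norm_real, Real.norm_of_nonneg h3, norm_prod, norm_zpow,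
    Complex.norm_real, Real.norm_of_nonneg hq0.le, mul_div_assoc, div_eq_mul_inv,
    ← Finset.prod_inv_distrib, mul_comm (∏ m ∈ _, _)]
  congr 2
  refine Finset.prod_congr rfl fun m _ => ?_
  rw [norm_inv, ← Complex.ofReal_zpow, ← Complex.ofReal_zpow, ← Complex.ofReal_sub, Complex.norm_real,
    Real.norm_eq_abs]

/-- The exponent of the size of the coefficient. -/
def wt (α : ℤ → ℤ) (i : ℤ) : ℤ :=
  ∑ m ∈ Finset.Ico 0 i, (α i - α m) + ∑ m ∈ Finset.Ioc i 0, (α m - α i)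

/-- The indices of the dominating monomial of the elementary symmetric polynomial. -/
def domSet (M : ℕ) (i : ℤ) : Finset ℤ := (Finset.Icc (1 - (M : ℤ)) 0).erase (min i 0)

theorem mem_domSet {M : ℕ} {i m : ℤ} : m ∈ domSet M i ↔ m ≠ min i 0 ∧ 1 - (M : ℤ) ≤ m ∧ m ≤ 0 := by
  rw [domSet, Finset.mem_erase, Finset.mem_Icc]

theorem domSet_subset {B M : ℕ} {i : ℤ} : domSet M i ⊆ (win B M).erase i := by
  intro m hm
  rw [mem_domSet] at hm
  rw [Finset.mem_erase, mem_win]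
  omega

theorem card_domSet {B M : ℕ} (hM : 1 ≤ M) {i : ℤ} (hi : i ∈ win B M) : (domSet M i).card = M - 1 := by
  rw [mem_win] at hi
  rw [domSet, Finset.card_erase_of_mem (by rw [Finset.mem_Icc]; omega), Int.card_Icc]
  omega

theorem prod_zpow_eq {q : ℝ} (hq0 : 0 < q) {ι : Type*} (s : Finset ι) (f : ι → ℤ) :
    ∏ m ∈ s, q ^ f m = q ^ ∑ m ∈ s, f m := by
  classical
  induction s using Finset.induction_on with
  | empty => simp
  | insert a s ha ih => rw [Finset.prod_insert ha, Finset.sum_insert ha, zpow_add₀ hq0.ne', ih]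

theorem node_sub_le {t : ℤ → ℤ} {B M : ℕ} (ht : MonotoneOn t (Set.Icc (1 - (M : ℤ)) B)) {i m : ℤ}
    (hi : i ∈ win B M) (hm : m ∈ win B M) (h : i ≤ m) : m - i ≤ node t m - node t i := by
  rw [mem_win] at hi hm
  have := ht (Set.mem_Icc.2 hi) (Set.mem_Icc.2 hm) h
  simp only [node]
  omega

/-- The product of the dominating factors. -/
theorem prod_dom {q : ℝ} (hq0 : 0 < q) (hq1 : q < 1) {t : ℤ → ℤ} {B M : ℕ} (hM : 1 ≤ M)
    (ht : MonotoneOn t (Set.Icc (1 - (M : ℤ)) B)) {i : ℤ} (hi : i ∈ win B M) :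
    ∏ m ∈ (win B M).erase i, ((if m ∈ domSet M i then q ^ node t m else q ^ node t i) /
      max (q ^ node t i) (q ^ node t m)) = q ^ wt (node t) i := by
  have hi' := mem_win.1 hi
  have h1 : ∀ m ∈ (win B M).erase i, ((if m ∈ domSet M i then q ^ node t m else q ^ node t i) /
      max (q ^ node t i) (q ^ node t m)) = q ^ ((if m ∈ Finset.Ico 0 i then node t i - node t m else 0) +
        if m ∈ Finset.Ioc i 0 then node t m - node t i else 0) := by
    intro m hm
    obtain ⟨hmi, hm⟩ := Finset.mem_erase.1 hm
    have hm' := mem_win.1 hm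
    have hmono : ∀ a b : ℤ, a ≤ b → q ^ b ≤ q ^ a := fun a b h =>
      zpow_le_zpow_right_of_le_one₀ hq0 hq1.le h
    simp only [mem_domSet, Finset.mem_Ico, Finset.mem_Ioc]
    rcases lt_or_gt_of_ne hmi with h | h
    · have h2 := node_sub_le ht hm hi h.le
      rw [max_eq_right (hmono _ _ (by omega)), if_neg (show ¬ (i < m ∧ m ≤ 0) by omega), add_zero]
      by_cases h0 : 0 ≤ m
      · rw [if_neg (by omega), if_pos (by omega), zpow_sub₀ hq0.ne']
      · rw [if_pos (by omega), if_neg (by omega), zpow_zero, div_self (zpow_pos hq0 _).ne']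
    · have h2 := node_sub_le ht hi hm h.le
      rw [max_eq_left (hmono _ _ (by omega)), if_neg (show ¬ (0 ≤ m ∧ m < i) by omega), zero_add]
      by_cases h0 : m ≤ 0
      · rw [if_pos (by omega), if_pos (by omega), zpow_sub₀ hq0.ne']
      · rw [if_neg (by omega), if_neg (by omega), zpow_zero, div_self (zpow_pos hq0 _).ne']
  rw [Finset.prod_congr rfl h1, prod_zpow_eq hq0, Finset.sum_add_distrib, Finset.sum_ite_mem,
    Finset.sum_ite_mem, wt]
  congr 3
  · ext m; simp only [Finset.mem_inter, Finset.mem_erase, mem_win, Finset.mem_Ico]; omega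
  · ext m; simp only [Finset.mem_inter, Finset.mem_erase, mem_win, Finset.mem_Ioc]; omega

theorem prod_dom_num (q : ℝ) (t : ℤ → ℤ) {B M : ℕ} (hM : 1 ≤ M) {i : ℤ} (hi : i ∈ win B M) (c : ℝ) :
    ∏ m ∈ (win B M).erase i, (if m ∈ domSet M i then q ^ node t m else c) =
      c ^ B * ∏ m ∈ domSet M i, q ^ node t m := by
  rw [Finset.prod_ite, Finset.prod_const, Finset.filter_mem_eq_inter,
    Finset.inter_eq_right.2 domSet_subset, Finset.filter_notMem_eq_sdiff,
    Finset.card_sdiff_of_subset domSet_subset, card_domSet hM hi, card_win_erase hi, mul_comm]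
  congr 2
  omega

/-- Keep one monomial of the elementary symmetric polynomial and bound each difference in the
denominator by the larger node. -/
theorem le_norm_wcoef {q : ℝ} (hq0 : 0 < q) (hq1 : q < 1) {t : ℤ → ℤ} {B M : ℕ} (hM : 1 ≤ M)
    (ht : MonotoneOn t (Set.Icc (1 - (M : ℤ)) B)) {i : ℤ} (hi : i ∈ win B M) :
    q ^ wt (node t) i ≤ ‖wcoef q t B M i‖ := by
  rw [norm_wcoef hq0 t hM hi, ← prod_dom hq0 hq1 hM ht hi, Finset.prod_div_distrib, prod_dom_num q t hM hi]
  have hpos : 0 < ∏ m ∈ (win B M).erase i, |q ^ node t i - q ^ node t m| := by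
    refine Finset.prod_pos fun m hm => abs_pos.2 (sub_ne_zero.2 fun h => ?_)
    obtain ⟨hmi, hm⟩ := Finset.mem_erase.1 hm
    have h' := zpow_right_injective₀ hq0 hq1.ne h
    rcases lt_or_gt_of_ne hmi with h2 | h2
    · have := node_sub_le ht hm hi h2.le
      omega
    · have := node_sub_le ht hi hm h2.le
      omega
  refine div_le_div₀ ?_ ?_ hpos ?_
  · rw [wesymm_eq q t hM hi]
    exact mul_nonneg (pow_nonneg (zpow_pos hq0 _).le _) (Finset.sum_nonneg fun T _ =>
      Finset.prod_nonneg fun m _ => (zpow_pos hq0 _).le)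
  · refine mul_le_mul_of_nonneg_left ?_ (pow_nonneg (zpow_pos hq0 _).le _)
    rw [wesymm_eq q t hM hi]
    exact Finset.single_le_sum (f := fun T => ∏ m ∈ T, q ^ node t m)
      (fun T _ => Finset.prod_nonneg fun m _ => (zpow_pos hq0 _).le)
      (Finset.mem_powersetCard.2 ⟨domSet_subset, card_domSet hM hi⟩)
  · refine Finset.prod_le_prod (fun _ _ => abs_nonneg _) fun m _ => ?_
    have h1 := zpow_pos hq0 (node t i)
    have h2 := zpow_pos hq0 (node t m)
    rw [abs_le]
    constructor
    · linarith [le_max_right (q ^ node t i) (q ^ node t m)]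
    · linarith [le_max_left (q ^ node t i) (q ^ node t m)]

/-- The sum of `q^|m|` over the integers. -/
def geomSum (q : ℝ) : ℝ := ∑' m : ℤ, q ^ m.natAbs

theorem summable_geom_int {q : ℝ} (hq0 : 0 < q) (hq1 : q < 1) : Summable fun m : ℤ => q ^ m.natAbs := by
  refine Summable.of_nat_of_neg ?_ ?_
  · simpa using summable_geometric_of_lt_one hq0.le hq1
  · simpa using summable_geometric_of_lt_one hq0.le hq1

theorem sum_geom_le {q : ℝ} (hq0 : 0 < q) (hq1 : q < 1) (s : Finset ℤ) (i : ℤ) :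
    ∑ m ∈ s, q ^ (m - i).natAbs ≤ geomSum q := by
  have h1 := (summable_geom_int hq0 hq1).comp_injective (Equiv.subRight i).injective
  have h2 : ∑' m : ℤ, q ^ (m - i).natAbs = geomSum q :=
    (Equiv.subRight i).tsum_eq fun m : ℤ => q ^ m.natAbs
  rw [← h2]
  exact h1.sum_le_tsum s fun m _ => pow_nonneg hq0.le _

theorem exp_neg_le_one_sub {q x : ℝ} (hq1 : q < 1) (hx0 : 0 ≤ x) (hxq : x ≤ q) :
    Real.exp (-(x / (1 - q))) ≤ 1 - x := by
  have h1 : 0 < 1 - q := by linarith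
  have h2 : 0 < 1 - x := by linarith
  have h3 : x / (1 - x) ≤ x / (1 - q) := div_le_div_of_nonneg_left hx0 h1 (by linarith)
  have h4 := Real.add_one_le_exp (x / (1 - x))
  have h5 : x / (1 - x) + 1 = (1 - x)⁻¹ := by field_simp; ring
  rw [h5] at h4
  refine (Real.exp_le_exp.2 (neg_le_neg h3)).trans ?_
  rw [Real.exp_neg]
  exact inv_le_of_inv_le₀ h2 h4

/-- The nodes are separated by factors of at least `q^|m-i|`, so the losses in numerator and
denominator are convergent products, independent of the window. For `i ≥ 0` the dominating monomial
consists of the nodes with negative index, whence the comparison with the node at index `0`. -/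
theorem norm_wcoef_le {q : ℝ} (hq0 : 0 < q) (hq1 : q < 1) {t : ℤ → ℤ} {B M : ℕ} (hM : 1 ≤ M)
    (ht : MonotoneOn t (Set.Icc (1 - (M : ℤ)) B)) {i : ℤ} (hi0 : 0 ≤ i) (hi : i ∈ win B M) :
    ‖wcoef q t B M i‖ ≤ Real.exp (geomSum q + geomSum q / (1 - q)) * q ^ wt (node t) i := by
  have hy : ∀ m, 0 < q ^ node t m := fun m => zpow_pos hq0 _
  have hmono : ∀ a b : ℤ, a ≤ b → q ^ b ≤ q ^ a := fun a b h =>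
    zpow_le_zpow_right_of_le_one₀ hq0 hq1.le h
  have h0 : (0 : ℤ) ∈ win B M := by rw [mem_win]; omega
  -- the ratio of two nodes
  have hratio : ∀ a ∈ win B M, ∀ c ∈ win B M, a ≤ c → q ^ node t c ≤ q ^ node t a * q ^ (c - a).natAbs := by
    intro a ha c hc hac
    have := node_sub_le ht ha hc hac
    rw [← zpow_natCast, ← zpow_add₀ hq0.ne']
    exact hmono _ _ (by omega)
  -- the denominator
  have hden : ∏ m ∈ (win B M).erase i, max (q ^ node t i) (q ^ node t m) ≤
      Real.exp (geomSum q / (1 - q)) * ∏ m ∈ (win B M).erase i, |q ^ node t i - q ^ node t m| := by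
    have h1 : ∀ m ∈ (win B M).erase i, max (q ^ node t i) (q ^ node t m) ≤
        Real.exp (q ^ (m - i).natAbs / (1 - q)) * |q ^ node t i - q ^ node t m| := by
      intro m hm
      obtain ⟨hmi, hm⟩ := Finset.mem_erase.1 hm
      have hne : (m - i).natAbs ≠ 0 := by omega
      have h2 : Real.exp (-(q ^ (m - i).natAbs / (1 - q))) ≤ 1 - q ^ (m - i).natAbs :=
        exp_neg_le_one_sub hq1 (pow_nonneg hq0.le _) (pow_le_of_le_one hq0.le hq1.le hne)
      have h3 : max (q ^ node t i) (q ^ node t m) * (1 - q ^ (m - i).natAbs) ≤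
          |q ^ node t i - q ^ node t m| := by
        rcases lt_or_gt_of_ne hmi with h | h
        · have h4 := hratio m hm i hi h.le
          have h5 := node_sub_le ht hm hi h.le
          rw [show (m - i).natAbs = (i - m).natAbs by omega, max_eq_right (hmono _ _ (by omega)),
            abs_sub_comm]
          refine le_trans ?_ (le_abs_self _)
          linarith
        · have h4 := hratio i hi m hm h.le
          have h5 := node_sub_le ht hi hm h.le
          rw [max_eq_left (hmono _ _ (by omega))]
          refine le_trans ?_ (le_abs_self _)
          linarith
      rw [Real.exp_neg] at h2
      have h6 := Real.exp_pos (q ^ (m - i).natAbs / (1 - q))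
      have h7 : 0 < max (q ^ node t i) (q ^ node t m) := lt_max_of_lt_left (hy i)
      calc max (q ^ node t i) (q ^ node t m)
          = Real.exp (q ^ (m - i).natAbs / (1 - q)) * (max (q ^ node t i) (q ^ node t m) *
            (Real.exp (q ^ (m - i).natAbs / (1 - q)))⁻¹) := by field_simp
        _ ≤ _ := by
          refine mul_le_mul_of_nonneg_left (le_trans ?_ h3) h6.le
          exact mul_le_mul_of_nonneg_left h2 h7.le
    refine (Finset.prod_le_prod (fun m _ => (lt_max_of_lt_left (hy i)).le) h1).trans ?_
    rw [Finset.prod_mul_distrib, ← Real.exp_sum, ← Finset.sum_div]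
    refine mul_le_mul_of_nonneg_right (Real.exp_le_exp.2 ?_) (Finset.prod_nonneg fun _ _ => abs_nonneg _)
    exact div_le_div_of_nonneg_right (sum_geom_le hq0 hq1 _ i) (by linarith)
  -- the elementary symmetric polynomial
  have hnum : wesymm q t B M i ≤ Real.exp (geomSum q) * ∏ m ∈ domSet M i, q ^ node t m := by
    have hz := hy 0
    -- All coefficients are nonnegative, so one term of the polynomial is at most its value at
    -- `y_0`.
    have h1 : wesymm q t B M i * (q ^ node t 0) ^ B ≤
        ∏ m ∈ (win B M).erase i, (q ^ node t 0 + q ^ node t m) := by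
      have h2 : ∀ n, 0 ≤ (∏ m ∈ (win B M).erase i,
          (Polynomial.X + Polynomial.C (q ^ node t m))).coeff n := by
        intro n
        by_cases hn : n ≤ ((win B M).erase i).card
        · rw [Finset.prod_X_add_C_coeff _ _ hn]
          exact Finset.sum_nonneg fun T _ => Finset.prod_nonneg fun m _ => (hy m).le
        · rw [Polynomial.coeff_eq_zero_of_natDegree_lt]
          refine lt_of_le_of_lt (Polynomial.natDegree_prod_le _ _) ?_
          simp only [Polynomial.natDegree_X_add_C, Finset.sum_const, smul_eq_mul, mul_one]
          omega
      have h3 : ∏ m ∈ (win B M).erase i, (q ^ node t 0 + q ^ node t m) =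
          (∏ m ∈ (win B M).erase i, (Polynomial.X + Polynomial.C (q ^ node t m))).eval (q ^ node t 0) := by
        rw [Polynomial.eval_prod]
        simp
      rw [h3, Polynomial.eval_eq_sum_range' (n := max _ (B + 1)) (lt_of_lt_of_le (Nat.lt_succ_self _)
        (le_max_left _ _))]
      exact Finset.single_le_sum (f := fun n => (∏ m ∈ (win B M).erase i,
        (Polynomial.X + Polynomial.C (q ^ node t m))).coeff n * (q ^ node t 0) ^ n)
        (fun n _ => mul_nonneg (h2 n) (pow_nonneg hz.le n))
        (Finset.mem_range.2 (lt_of_lt_of_le (Nat.lt_succ_self _) (le_max_right _ _)))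
    have h4 : ∏ m ∈ (win B M).erase i, (q ^ node t 0 + q ^ node t m) ≤ Real.exp (geomSum q) *
        ((q ^ node t 0) ^ B * ∏ m ∈ domSet M i, q ^ node t m) := by
      rw [← prod_dom_num q t hM hi]
      have h5 : ∀ m ∈ (win B M).erase i, q ^ node t 0 + q ^ node t m ≤ Real.exp (q ^ (m - 0).natAbs) *
          (if m ∈ domSet M i then q ^ node t m else q ^ node t 0) := by
        intro m hm
        obtain ⟨hmi, hm⟩ := Finset.mem_erase.1 hm
        have hm' := mem_win.1 hm
        have h6 := Real.add_one_le_exp (q ^ (m - 0).natAbs)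
        simp only [mem_domSet]
        rcases lt_or_ge m 0 with h | h
        · rw [if_pos (by omega)]
          have h7 := hratio m hm 0 h0 h.le
          rw [show (0 - m).natAbs = (m - 0).natAbs by omega] at h7
          nlinarith [mul_le_mul_of_nonneg_right h6 (hy m).le]
        · rw [if_neg (by omega)]
          have h7 := hratio 0 h0 m hm h
          nlinarith [mul_le_mul_of_nonneg_right h6 hz.le]
      refine (Finset.prod_le_prod (fun m _ => (add_pos hz (hy m)).le) h5).trans ?_
      rw [Finset.prod_mul_distrib, ← Real.exp_sum]
      refine mul_le_mul_of_nonneg_right (Real.exp_le_exp.2 (sum_geom_le hq0 hq1 _ 0)) ?_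
      exact Finset.prod_nonneg fun m _ => by split_ifs; exacts [(hy m).le, hz.le]
    have h8 := h1.trans h4
    have h9 : 0 < (q ^ node t 0) ^ B := pow_pos hz B
    refine le_of_mul_le_mul_right (h8.trans (le_of_eq ?_)) h9
    ring
  have hmaxpos : 0 < ∏ m ∈ (win B M).erase i, max (q ^ node t i) (q ^ node t m) :=
    Finset.prod_pos fun m _ => lt_max_of_lt_left (hy i)
  have hE := Real.exp_pos (geomSum q / (1 - q))
  have hdpos : 0 < ∏ m ∈ (win B M).erase i, |q ^ node t i - q ^ node t m| :=
    pos_of_mul_pos_right (hmaxpos.trans_le hden) hE.le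
  rw [norm_wcoef hq0 t hM hi, ← prod_dom hq0 hq1 hM ht hi, Finset.prod_div_distrib,
    prod_dom_num q t hM hi, div_le_iff₀ hdpos, Real.exp_add]
  have hyB : 0 < (q ^ node t i) ^ B := pow_pos (hy i) B
  have hS : 0 < ∏ m ∈ domSet M i, q ^ node t m := Finset.prod_pos fun m _ => hy m
  generalize ∏ m ∈ (win B M).erase i, max (q ^ node t i) (q ^ node t m) = X at hden hmaxpos ⊢
  generalize ∏ m ∈ (win B M).erase i, |q ^ node t i - q ^ node t m| = Y at hden hdpos ⊢
  generalize ∏ m ∈ domSet M i, q ^ node t m = S at hnum hS ⊢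
  have hEg := Real.exp_pos (geomSum q)
  calc (q ^ node t i) ^ B * wesymm q t B M i ≤ (q ^ node t i) ^ B * (Real.exp (geomSum q) * S) := by gcongr
    _ = (q ^ node t i) ^ B * (Real.exp (geomSum q) * S) / X * X := by field_simp
    _ ≤ (q ^ node t i) ^ B * (Real.exp (geomSum q) * S) / X *
        (Real.exp (geomSum q / (1 - q)) * Y) := by gcongr
    _ = _ := by ring

end
end QSchur

namespace QSchur
noncomputable section
variable {k N K : ℕ}

/-! ### Laurent coefficients -/

/-- The Laurent coefficient of `x^n` in the Laurent sum. -/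
def lcoef (q : ℝ) (t : ℤ → ℤ) (B M : ℕ) (n : ℤ) : ℂ :=
  ∑ i ∈ win B M, if node t i = n then wcoef q t B M i else 0

theorem circleIntegral_zpow {ρ : ℝ} (hρ : 0 < ρ) (m : ℤ) :
    (∮ z in C(0, ρ), z ^ m) = if m = -1 then 2 * Real.pi * Complex.I else 0 := by
  split_ifs with h
  · have := circleIntegral.integral_sub_center_inv (0 : ℂ) hρ.ne'
    simpa [h] using this
  · have := circleIntegral.integral_sub_zpow_of_ne h (0 : ℂ) 0 ρ
    simpa using this

theorem circle_laurentSum (q : ℝ) (t : ℤ → ℤ) (B M : ℕ) {ρ : ℝ} (hρ : 0 < ρ) (n : ℤ) :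
    (∮ z in C(0, ρ), laurentSum q (nodes t B M) B z * z ^ (-n - 1)) =
      2 * Real.pi * Complex.I * lcoef q t B M n := by
  have hsph : ∀ z ∈ Metric.sphere (0 : ℂ) ρ, z ≠ 0 := fun z hz h0 => by
    rw [h0, mem_sphere_zero_iff_norm, norm_zero] at hz
    exact hρ.ne hz
  have h1 : (∮ z in C(0, ρ), laurentSum q (nodes t B M) B z * z ^ (-n - 1)) =
      ∮ z in C(0, ρ), ∑ i ∈ win B M, wcoef q t B M i * z ^ (node t i - n - 1) := by
    refine circleIntegral.integral_congr hρ.le fun z hz => ?_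
    rw [laurentSum_nodes, Finset.sum_mul]
    refine Finset.sum_congr rfl fun i _ => ?_
    rw [mul_assoc, ← zpow_add₀ (hsph z hz)]
    congr 2; ring
  have hint : ∀ i ∈ win B M, CircleIntegrable (fun z : ℂ => wcoef q t B M i * z ^ (node t i - n - 1)) 0 ρ := by
    intro i _
    refine ContinuousOn.circleIntegrable hρ.le ?_
    exact continuousOn_const.mul fun z hz =>
      (continuousAt_zpow₀ _ _ (Or.inl (hsph z hz))).continuousWithinAt
  rw [h1, circleIntegral.integral_fun_sum hint, lcoef, Finset.mul_sum]
  refine Finset.sum_congr rfl fun i _ => ?_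
  rw [circleIntegral.integral_const_mul, circleIntegral_zpow hρ]
  by_cases h : node t i = n
  · rw [if_pos h, if_pos (by omega), mul_comm]
  · rw [if_neg h, if_neg (by omega), mul_zero, mul_zero]

/-- Cauchy's estimate on the circle of radius `ρ`. -/
theorem norm_lcoef_le (q : ℝ) (t : ℤ → ℤ) (B M : ℕ) {ρ C : ℝ} (hρ : 0 < ρ)
    (hC : ∀ z, ‖z‖ = ρ → ‖laurentSum q (nodes t B M) B z‖ ≤ C) (n : ℤ) :
    ‖lcoef q t B M n‖ * ρ ^ n ≤ C := by
  have h1 := circleIntegral.norm_integral_le_of_norm_le_const (c := (0 : ℂ)) hρ.le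
    (f := fun z => laurentSum q (nodes t B M) B z * z ^ (-n - 1)) (C := C * ρ ^ (-n - 1)) fun z hz => by
      rw [mem_sphere_zero_iff_norm] at hz
      rw [norm_mul, norm_zpow, hz]
      exact mul_le_mul_of_nonneg_right (hC z hz) (zpow_pos hρ _).le
  rw [circle_laurentSum q t B M hρ, norm_mul] at h1
  have h2 : ‖(2 * (Real.pi : ℂ) * Complex.I)‖ = 2 * Real.pi := by simp [abs_of_pos Real.pi_pos]
  rw [h2] at h1
  have h3 : ‖lcoef q t B M n‖ ≤ C * ρ ^ (-n) := by
    refine le_of_mul_le_mul_left (h1.trans (le_of_eq ?_)) Real.two_pi_pos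
    rw [zpow_sub_one₀ hρ.ne']
    field_simp
  calc ‖lcoef q t B M n‖ * ρ ^ n ≤ C * ρ ^ (-n) * ρ ^ n :=
        mul_le_mul_of_nonneg_right h3 (zpow_pos hρ _).le
    _ = C := by rw [mul_assoc, ← zpow_add₀ hρ.ne', neg_add_cancel, zpow_zero, mul_one]

theorem tendsto_lcoef {q : ℝ} {t : ℕ → ℤ → ℤ} {B M : ℕ → ℕ} {ρ : ℝ} (hρ : 0 < ρ) {G : ℂ → ℂ}
    (hb : ∃ C, ∀ᶠ m in atTop, ∀ z, ‖z‖ = ρ → ‖laurentSum q (nodes (t m) (B m) (M m)) (B m) z‖ ≤ C)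
    (hlim : ∀ z, ‖z‖ = ρ →
      Tendsto (fun m => laurentSum q (nodes (t m) (B m) (M m)) (B m) z) atTop (𝓝 (G z))) (n : ℤ) :
    ∃ d, Tendsto (fun m => lcoef q (t m) (B m) (M m) n) atTop (𝓝 d) := by
  have hz0 : ∀ z ∈ Metric.sphere (0 : ℂ) ρ, z ≠ 0 := fun z hz h0 => by
    rw [h0, mem_sphere_zero_iff_norm, norm_zero] at hz
    exact hρ.ne hz
  -- With no points the kernel is the empty product, and the statement reduces to dominated
  -- convergence on the circle.
  have h1 := tendsto_ddCirc (k := 0) hρ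
    (G := fun m z => laurentSum q (nodes (t m) (B m) (M m)) (B m) z * z ^ (-n - 1))
    (g := fun z => G z * z ^ (-n - 1)) ?_ ?_ ?_ ∅ (x := fun i => i.elim0) fun i => i.elim0
  · have h2 := h1.comp (tendsto_id.prodMk (tendsto_const_nhds (x := fun i : Fin 0 => i.elim0)))
    refine ⟨_, (h2.const_mul (2 * Real.pi * Complex.I)⁻¹).congr fun m => ?_⟩
    simp only [Function.comp_def, ddCirc, Finset.prod_empty, mul_one, id]
    rw [circle_laurentSum q (t m) (B m) (M m) hρ, inv_mul_cancel_left₀ Complex.two_pi_I_ne_zero]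
  · refine Eventually.of_forall fun m => ?_
    simp only [laurentSum]
    refine ContinuousOn.mul (continuousOn_finsetSum _ fun i _ => continuousOn_const.mul fun z hz =>
      (continuousAt_zpow₀ _ _ (Or.inl (hz0 z hz))).continuousWithinAt) fun z hz =>
      (continuousAt_zpow₀ _ _ (Or.inl (hz0 z hz))).continuousWithinAt
  · obtain ⟨C, hC⟩ := hb
    refine ⟨C * ρ ^ (-n - 1), ?_⟩
    filter_upwards [hC] with m hm z hz
    rw [mem_sphere_zero_iff_norm] at hz
    rw [norm_mul, norm_zpow, hz]
    exact mul_le_mul_of_nonneg_right (hm z hz) (zpow_pos hρ _).le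
  · intro z hz
    exact (hlim z (mem_sphere_zero_iff_norm.1 hz)).mul_const _

/-! ### Consequences of the convergence in one variable -/

theorem norm_qPoch_le_exp {q : ℝ} (hq0 : 0 < q) (hq1 : q < 1) (a : ℂ) (n : ℕ) :
    ‖qPoch a q n‖ ≤ Real.exp (‖a‖ * (1 - q)⁻¹) := by
  rw [qPoch, norm_prod]
  have h1 : ∀ i ∈ Finset.range n, ‖1 - a * (q : ℂ) ^ i‖ ≤ Real.exp (‖a‖ * q ^ i) := fun i _ => by
    refine (norm_sub_le _ _).trans ?_
    rw [norm_one, norm_mul, norm_pow, Complex.norm_real, Real.norm_of_nonneg hq0.le]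
    linarith [Real.add_one_le_exp (‖a‖ * q ^ i)]
  refine (Finset.prod_le_prod (fun _ _ => norm_nonneg _) h1).trans ?_
  rw [← Real.exp_sum, ← Finset.mul_sum]
  refine Real.exp_le_exp.2 (mul_le_mul_of_nonneg_left ?_ (norm_nonneg _))
  rw [← tsum_geometric_of_lt_one hq0.le hq1]
  exact (summable_geometric_of_lt_one hq0.le hq1).sum_le_tsum _ fun n _ => by positivity

theorem norm_inv_qPoch_self_le {q : ℝ} (hq0 : 0 < q) (hq1 : q < 1) :
    ∃ C, ∀ n : ℕ, ‖(qPoch (q : ℂ) q n)⁻¹‖ ≤ C := by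
  have hne : qPochInf (q : ℂ) q ≠ 0 := qPochInf_ne_zero hq0 hq1 fun i h => by
    have := one_sub_qpow_ne_zero hq0 hq1 i
    rw [pow_succ', h, sub_self] at this
    exact this rfl
  obtain ⟨C, hC⟩ := ((tendsto_qPoch hq0 hq1 (q : ℂ)).inv₀ hne).norm.bddAbove_range
  exact ⟨C, fun n => hC ⟨n, rfl⟩⟩

theorem laurentSum_eq_oneVar {q : ℝ} (hq0 : 0 < q) (hq1 : q < 1) {l : Fin N → ℤ}
    (hl : Antitone l) {b : ℕ} (hb : b < N) {x : ℂ} (hx : x ∉ badSet q) :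
    laurentSum q (nodes (rowSeq l b) b (N - b)) b x =
      oneVar q l b x * x⁻¹ * (qPoch (q * x) q b * (qPoch q q b)⁻¹) *
      (qPoch (q / x) q (N - b - 1) * (qPoch q q (N - b - 1))⁻¹) := by
  have h1 := qPoch_ne_zero hq0 hq1 b
  have h2 := qPoch_ne_zero hq0 hq1 (N - b - 1)
  have hx0 := ne_zero_of_notMem_badSet hx
  have h3 : qPoch (q * x) q b ≠ 0 := by
    rw [qPoch, Finset.prod_ne_zero_iff]
    exact fun i _ => sub_ne_zero.2 (mul_qpow_ne_one hq0 hx i).1.symm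
  have h4 : qPoch (q / x) q (N - b - 1) ≠ 0 := by
    rw [qPoch, Finset.prod_ne_zero_iff]
    exact fun i _ => sub_ne_zero.2 (mul_qpow_ne_one hq0 hx i).2.symm
  rw [oneVar_eq_laurentSum' hq0 hq1 hl hb hx]
  generalize qPoch (q * x) q b = A at h3 ⊢
  generalize qPoch (q / x) q (N - b - 1) = A' at h4 ⊢
  field_simp

theorem ConvergesTo.tendsto_oneVar {q : ℝ} {b : ℕ → ℕ} {lam : ∀ N : ℕ, Fin N → ℤ}
    {F : (Fin 1 → ℂ) → ℂ} (h : ConvergesTo q b lam 1 F) {x : ℂ} (hx : x ≠ 0) :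
    Tendsto (fun N => oneVar q (lam N) (b N) x) atTop (𝓝 (F fun _ => x)) :=
  (h {fun _ => x} (Set.singleton_subset_iff.2 fun _ => hx) isCompact_singleton).tendsto_at
    (Set.mem_singleton _)

theorem ConvergesTo.oneVar_bounded {q : ℝ} (hq0 : 0 < q) {b : ℕ → ℕ} {lam : ∀ N : ℕ, Fin N → ℤ}
    {F : (Fin 1 → ℂ) → ℂ} (h : ConvergesTo q b lam 1 F) {ρ : ℝ} (hρ : 0 < ρ) :
    ∃ C, ∀ᶠ N in atTop, ∀ x, ‖x‖ = ρ → ‖oneVar q (lam N) (b N) x‖ ≤ C := by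
  set K : Set (Fin 1 → ℂ) := (fun (x : ℂ) (_ : Fin 1) => x) '' Metric.sphere 0 ρ with hK
  have hKc : IsCompact K := (isCompact_sphere 0 ρ).image (continuous_pi fun _ => continuous_id)
  have hKT : K ⊆ torus 1 := by
    rintro _ ⟨x, hx, rfl⟩ i h0
    replace h0 : x = 0 := h0
    rw [h0, mem_sphere_zero_iff_norm, norm_zero] at hx
    exact hρ.ne hx
  have h1 := Metric.tendstoUniformlyOn_iff.1 (h K hKT hKc) 1 one_pos
  -- No regularity of `F` is assumed, so the bound is taken from one fixed polynomial of the
  -- sequence.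
  obtain ⟨N₀, hN₀⟩ := h1.exists
  obtain ⟨C, hC⟩ := hKc.exists_bound_of_continuousOn
    ((differentiableOn_normSchur hq0 (lam N₀) (b N₀)).continuousOn.mono hKT)
  refine ⟨C + 2, ?_⟩
  filter_upwards [h1] with N hN x hx
  have hxK : (fun _ : Fin 1 => x) ∈ K := ⟨x, mem_sphere_zero_iff_norm.2 hx, rfl⟩
  have h2 := (dist_comm _ _).trans_lt (hN _ hxK)
  have h3 := hN₀ _ hxK
  have h4 := hC _ hxK
  have h5 : ‖oneVar q (lam N) (b N) x‖ ≤ ‖normSchur q (lam N₀) (b N₀) fun _ : Fin 1 => x‖ +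
      dist (normSchur q (lam N) (b N) fun _ : Fin 1 => x)
        (normSchur q (lam N₀) (b N₀) fun _ : Fin 1 => x) := by
    rw [dist_eq_norm]
    refine (le_of_eq ?_).trans (norm_add_le _ _)
    rw [add_sub_cancel, oneVar]
  have h6 := dist_triangle (normSchur q (lam N) (b N) fun _ : Fin 1 => x) (F fun _ => x)
    (normSchur q (lam N₀) (b N₀) fun _ : Fin 1 => x)
  linarith

/-- Dividing by the prefactors puts the q-Pochhammer symbols that depend on `x` into the numerator,
where they are bounded on every circle. -/
theorem ConvergesTo.laurentSum_bounded {q : ℝ} (hq0 : 0 < q) (hq1 : q < 1) {b : ℕ → ℕ}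
    (hM : Tendsto (fun N : ℕ => (N : ℤ) - (b N : ℤ)) atTop atTop)
    {lam : ∀ N : ℕ, Fin N → ℤ} (hlam : ∀ N, Antitone (lam N))
    {F : (Fin 1 → ℂ) → ℂ} (h : ConvergesTo q b lam 1 F) {ρ : ℝ} (hρ : ρ ∈ goodRadii q) :
    ∃ C, ∀ᶠ N in atTop, ∀ x, ‖x‖ = ρ →
      ‖laurentSum q (nodes (rowSeq (lam N) (b N)) (b N) (N - b N)) (b N) x‖ ≤ C := by
  obtain ⟨C1, hC1⟩ := h.oneVar_bounded hq0 hρ.1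
  obtain ⟨C2, hC2⟩ := norm_inv_qPoch_self_le hq0 hq1
  have c2 : 0 ≤ C2 := (norm_nonneg _).trans (hC2 0)
  have hρ0 := hρ.1
  refine ⟨C1 * ρ⁻¹ * (Real.exp (q * ρ * (1 - q)⁻¹) * C2) * (Real.exp (q / ρ * (1 - q)⁻¹) * C2), ?_⟩
  filter_upwards [StableRows.eventually_add_le hM 1, hC1] with N hN h1 x hx
  have hxb := notMem_badSet_of_norm hq0 (x := x) (by rwa [hx])
  have h2 := norm_qPoch_le_exp hq0 hq1 (q * x) (b N)
  have h3 := norm_qPoch_le_exp hq0 hq1 (q / x) (N - b N - 1)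
  rw [norm_mul, hx, Complex.norm_real, Real.norm_of_nonneg hq0.le] at h2
  rw [norm_div, hx, Complex.norm_real, Real.norm_of_nonneg hq0.le] at h3
  have h4 := h1 x hx
  have c1 : 0 ≤ C1 := (norm_nonneg _).trans h4
  rw [laurentSum_eq_oneVar hq0 hq1 (hlam N) (by omega) hxb]
  simp only [norm_mul]
  rw [norm_inv x, hx]
  gcongr
  · exact hC2 _
  · exact hC2 _

theorem ConvergesTo.tendsto_laurentSum {q : ℝ} (hq0 : 0 < q) (hq1 : q < 1) {b : ℕ → ℕ}
    (hb : Tendsto b atTop atTop) (hM : Tendsto (fun N : ℕ => (N : ℤ) - (b N : ℤ)) atTop atTop)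
    {lam : ∀ N : ℕ, Fin N → ℤ} (hlam : ∀ N, Antitone (lam N))
    {F : (Fin 1 → ℂ) → ℂ} (h : ConvergesTo q b lam 1 F) {x : ℂ} (hx : x ∉ badSet q) :
    ∃ y, Tendsto (fun N => laurentSum q (nodes (rowSeq (lam N) (b N)) (b N) (N - b N)) (b N) x) atTop
      (𝓝 y) := by
  have hne : qPochInf (q : ℂ) q ≠ 0 := qPochInf_ne_zero hq0 hq1 fun i h => by
    have := one_sub_qpow_ne_zero hq0 hq1 i
    rw [pow_succ', h, sub_self] at this
    exact this rfl
  have T1 := (tendsto_qPoch hq0 hq1 (q : ℂ)).comp hb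
  have T2 := (tendsto_qPoch hq0 hq1 ((q : ℂ) * x)).comp hb
  have T3 := (tendsto_qPoch hq0 hq1 (q : ℂ)).comp (StableRows.tendsto_sub hM 1)
  have T4 := (tendsto_qPoch hq0 hq1 ((q : ℂ) / x)).comp (StableRows.tendsto_sub hM 1)
  have T := (((h.tendsto_oneVar (ne_zero_of_notMem_badSet hx)).mul_const x⁻¹).mul
    (T2.mul (T1.inv₀ hne))).mul (T4.mul (T3.inv₀ hne))
  refine ⟨_, T.congr' ?_⟩
  filter_upwards [StableRows.eventually_add_le hM 1] with N hN
  exact (laurentSum_eq_oneVar hq0 hq1 (hlam N) (by omega) hx).symm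

end
end QSchur

namespace QSchur
noncomputable section
variable {k N K : ℕ}

/-! ### Recovering the limit sequence from the Laurent coefficients -/

theorem lcoef_node (q : ℝ) {t : ℤ → ℤ} {B M : ℕ} (ht : MonotoneOn t (Set.Icc (1 - (M : ℤ)) B)) {i : ℤ}
    (hi : i ∈ win B M) : lcoef q t B M (node t i) = wcoef q t B M i := by
  rw [lcoef, Finset.sum_eq_single_of_mem i hi, if_pos rfl]
  intro m hm hmi
  rw [if_neg]
  intro h
  rcases lt_or_gt_of_ne hmi with h2 | h2
  · have := node_sub_le ht hm hi h2.le
    omega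
  · have := node_sub_le ht hi hm h2.le
    omega

/-- The nodes increase strictly, so no exponent lies between consecutive ones. -/
theorem lcoef_eq_zero (q : ℝ) {t : ℤ → ℤ} {B M : ℕ} (ht : MonotoneOn t (Set.Icc (1 - (M : ℤ)) B)) {i n : ℤ}
    (hi : i ∈ win B M) (hi1 : i + 1 ∈ win B M) (h1 : node t i < n) (h2 : n < node t (i + 1)) :
    lcoef q t B M n = 0 := by
  refine Finset.sum_eq_zero fun m hm => if_neg fun h => ?_
  rcases le_or_gt m i with h3 | h3
  · have := node_sub_le ht hm hi h3
    omega
  · have := node_sub_le ht hi1 hm h3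
    omega

/-- The hypotheses on the Laurent coefficients. -/
structure CoefLimit (q : ℝ) (t : ℕ → ℤ → ℤ) (B M : ℕ → ℕ) (d : ℤ → ℂ) : Prop where
  hB : Tendsto B atTop atTop
  hM : Tendsto M atTop atTop
  mono : ∀ᶠ m in atTop, MonotoneOn (t m) (Set.Icc (1 - (M m : ℤ)) (B m))
  bdd : ∀ ρ ∈ goodRadii q, ∃ C, ∀ᶠ m in atTop, ∀ n, ‖lcoef q (t m) (B m) (M m) n‖ * ρ ^ n ≤ C
  lim : ∀ n, Tendsto (fun m => lcoef q (t m) (B m) (M m) n) atTop (𝓝 (d n))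

namespace CoefLimit

variable {q : ℝ} {t : ℕ → ℤ → ℤ} {B M : ℕ → ℕ} {d : ℤ → ℂ}

theorem eventually_mem (h : CoefLimit q t B M d) (i : ℤ) : ∀ᶠ m in atTop, i ∈ win (B m) (M m) ∧ 1 ≤ M m := by
  filter_upwards [h.hB.eventually_ge_atTop i.natAbs, h.hM.eventually_ge_atTop (i.natAbs + 1)] with m h1 h2
  rw [mem_win]
  omega

/-- Cauchy's estimate combined with the lower bound for the coefficient at the node; this is the
only source of compactness. -/
theorem eventually_wt_le (hq0 : 0 < q) (hq1 : q < 1) (h : CoefLimit q t B M d) (i : ℤ) {ρ : ℝ}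
    (hρ : ρ ∈ goodRadii q) : ∃ C, ∀ᶠ m in atTop, q ^ wt (node (t m)) i * ρ ^ node (t m) i ≤ C := by
  obtain ⟨C, hC⟩ := h.bdd ρ hρ
  refine ⟨C, ?_⟩
  filter_upwards [hC, h.eventually_mem i, h.mono] with m h1 h2 h3
  refine le_trans ?_ (h1 (node (t m) i))
  rw [lcoef_node q h3 h2.1]
  exact mul_le_mul_of_nonneg_right (le_norm_wcoef hq0 hq1 h2.2 h3 h2.1) (zpow_pos hρ.1 _).le

theorem exists_bound_of_pow {r C : ℝ} (hr : 1 < r) : ∃ n : ℕ, ∀ a : ℤ, r ^ a ≤ C → a ≤ n := by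
  obtain ⟨n, hn⟩ := pow_unbounded_of_one_lt C hr
  refine ⟨n, fun a ha => ?_⟩
  by_contra hcon
  push Not at hcon
  have : r ^ (n : ℤ) ≤ r ^ a := zpow_le_zpow_right₀ hr.le hcon.le
  rw [zpow_natCast] at this
  linarith

/-- At `i = 0` the weight vanishes, and radii on both sides of `1` bound the node from both sides.
For `i > 0` the weight is at most `i (α_i - α_0)`, so a radius above `q^(-i)` makes `(q^i ρ)^(α_i -
α_0)` bounded with base above `1`; for `i < 0` a radius below `q^|i|` plays this role. The bound on
the other side is monotonicity. -/
theorem exists_node_bound (hq0 : 0 < q) (hq1 : q < 1) (h : CoefLimit q t B M d) (i : ℤ) :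
    ∃ n : ℕ, ∀ᶠ m in atTop, |node (t m) i| ≤ n := by
  -- the central node
  obtain ⟨n₀, hn₀⟩ : ∃ n : ℕ, ∀ᶠ m in atTop, |node (t m) 0| ≤ n := by
    obtain ⟨ρ, hρ, hρ1, -⟩ := exists_goodRadius q (lt_add_one (1 : ℝ)) zero_le_one
    obtain ⟨σ, hσ, hσ0, hσ1⟩ := exists_goodRadius q zero_lt_one le_rfl
    obtain ⟨C, hC⟩ := h.eventually_wt_le hq0 hq1 0 hρ
    obtain ⟨C', hC'⟩ := h.eventually_wt_le hq0 hq1 0 hσ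
    obtain ⟨n, hn⟩ := exists_bound_of_pow (C := C) hρ1
    obtain ⟨n', hn'⟩ := exists_bound_of_pow (C := C') (one_lt_inv₀ hσ0 |>.2 hσ1)
    refine ⟨max n n', ?_⟩
    filter_upwards [hC, hC'] with m h1 h2
    simp only [wt, Finset.Ico_self, Finset.Ioc_self, Finset.sum_empty, add_zero, zpow_zero, one_mul] at h1 h2
    have h3 := hn _ h1
    have h4 := hn' (-node (t m) 0) (by rwa [inv_zpow', neg_neg])
    rw [abs_le]
    push_cast
    constructor
    · have := le_max_right (n : ℤ) n'
      omega
    · exact h3.trans (le_max_left _ _)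
  have hcomp : ∀ᶠ m in atTop, ∀ a ∈ win (B m) (M m), ∀ c ∈ win (B m) (M m), a ≤ c →
      node (t m) a ≤ node (t m) c := by
    filter_upwards [h.mono] with m hm a ha c hc hac
    have := node_sub_le hm ha hc hac
    omega
  rcases le_total 0 i with hi | hi
  · obtain ⟨ρ, hρ, hρ1, -⟩ := exists_goodRadius q (lt_add_one ((q ^ i)⁻¹)) (inv_nonneg.2 (zpow_pos hq0 i).le)
    have hρ0 := hρ.1
    have hqi := zpow_pos hq0 i
    have hr : 1 < q ^ i * ρ := by
      have := mul_lt_mul_of_pos_left hρ1 hqi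
      rwa [mul_inv_cancel₀ hqi.ne'] at this
    have hρge : 1 ≤ ρ := by
      have h1 : q ^ i ≤ 1 := zpow_le_one₀ hq0 hq1.le hi
      have h2 : 1 ≤ (q ^ i)⁻¹ := one_le_inv₀ hqi |>.2 h1
      linarith
    obtain ⟨C, hC⟩ := h.eventually_wt_le hq0 hq1 i hρ
    obtain ⟨n, hn⟩ := exists_bound_of_pow (C := C * ρ ^ (n₀ : ℤ)) hr
    refine ⟨n + n₀, ?_⟩
    filter_upwards [hC, hn₀, hcomp, h.eventually_mem i, h.eventually_mem 0] with m h1 h2 h3 h4 h5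
    obtain ⟨h2a, h2b⟩ := abs_le.1 h2
    have h6 := h3 0 h5.1 i h4.1 hi
    have hwt : wt (node (t m)) i ≤ i * (node (t m) i - node (t m) 0) := by
      rw [wt, Finset.Ioc_eq_empty (by omega), Finset.sum_empty, add_zero]
      refine (Finset.sum_le_card_nsmul _ _ (node (t m) i - node (t m) 0) fun a ha => ?_).trans
        (le_of_eq ?_)
      · obtain ⟨ha1, ha2⟩ := Finset.mem_Ico.1 ha
        have := h3 0 h5.1 a (by have := mem_win.1 h4.1; have := mem_win.1 h5.1; rw [mem_win]; omega) ha1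
        omega
      · rw [Int.card_Ico, nsmul_eq_mul]
        congr 1
        omega
    have h7 : (q ^ i * ρ) ^ (node (t m) i - node (t m) 0) ≤ C * ρ ^ (n₀ : ℤ) := by
      rw [mul_zpow, ← zpow_mul]
      calc q ^ (i * (node (t m) i - node (t m) 0)) * ρ ^ (node (t m) i - node (t m) 0)
          ≤ q ^ wt (node (t m)) i * ρ ^ (node (t m) i + n₀) := by
            refine mul_le_mul (zpow_le_zpow_right_of_le_one₀ hq0 hq1.le hwt)
              (zpow_le_zpow_right₀ hρge (by omega)) (zpow_pos hρ0 _).le (zpow_pos hq0 _).le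
        _ = q ^ wt (node (t m)) i * ρ ^ node (t m) i * ρ ^ (n₀ : ℤ) := by
            rw [zpow_add₀ hρ0.ne']; ring
        _ ≤ _ := mul_le_mul_of_nonneg_right h1 (zpow_pos hρ0 _).le
    have h8 := hn _ h7
    rw [abs_le]
    push_cast
    constructor <;> omega
  · have hqi := zpow_pos hq0 (-i)
    obtain ⟨ρ, hρ, hρ0, hρ1⟩ := exists_goodRadius q hqi le_rfl
    have hr : 1 < q ^ (-i) * ρ⁻¹ := by
      rw [← div_eq_mul_inv]; exact (one_lt_div hρ0).2 hρ1
    have hρle : ρ ≤ 1 := by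
      have h1 : q ^ (-i) ≤ 1 := zpow_le_one₀ hq0 hq1.le (by omega)
      linarith
    obtain ⟨C, hC⟩ := h.eventually_wt_le hq0 hq1 i hρ
    obtain ⟨n, hn⟩ := exists_bound_of_pow (C := C * ρ ^ (-(n₀ : ℤ))) hr
    refine ⟨n + n₀, ?_⟩
    filter_upwards [hC, hn₀, hcomp, h.eventually_mem i, h.eventually_mem 0] with m h1 h2 h3 h4 h5
    obtain ⟨h2a, h2b⟩ := abs_le.1 h2
    have h6 := h3 i h4.1 0 h5.1 hi
    have hwt : wt (node (t m)) i ≤ -i * (node (t m) 0 - node (t m) i) := by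
      rw [wt, Finset.Ico_eq_empty (by omega), Finset.sum_empty, zero_add]
      refine (Finset.sum_le_card_nsmul _ _ (node (t m) 0 - node (t m) i) fun a ha => ?_).trans
        (le_of_eq ?_)
      · obtain ⟨ha1, ha2⟩ := Finset.mem_Ioc.1 ha
        have := h3 a (by have := mem_win.1 h4.1; have := mem_win.1 h5.1; rw [mem_win]; omega) 0 h5.1 ha2
        omega
      · rw [Int.card_Ioc, nsmul_eq_mul]
        congr 1
        omega
    have h7 : (q ^ (-i) * ρ⁻¹) ^ (node (t m) 0 - node (t m) i) ≤ C * ρ ^ (-(n₀ : ℤ)) := by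
      rw [mul_zpow, ← zpow_mul, inv_zpow', neg_sub]
      calc q ^ (-i * (node (t m) 0 - node (t m) i)) * ρ ^ (node (t m) i - node (t m) 0)
          ≤ q ^ wt (node (t m)) i * ρ ^ (node (t m) i + -(n₀ : ℤ)) := by
            refine mul_le_mul (zpow_le_zpow_right_of_le_one₀ hq0 hq1.le hwt)
              (zpow_le_zpow_right_of_le_one₀ hρ0 hρle (by omega)) (zpow_pos hρ0 _).le (zpow_pos hq0 _).le
        _ = q ^ wt (node (t m)) i * ρ ^ node (t m) i * ρ ^ (-(n₀ : ℤ)) := by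
            rw [zpow_add₀ hρ0.ne']; ring
        _ ≤ _ := mul_le_mul_of_nonneg_right h1 (zpow_pos hρ0 _).le
    have h8 := hn _ h7
    rw [abs_le]
    push_cast
    constructor <;> omega

/-- The properties of a limit point `α` of the nodes. -/
structure IsLimitPoint (q : ℝ) (d : ℤ → ℂ) (α : ℤ → ℤ) : Prop where
  mono : StrictMono α
  lower : ∀ i, q ^ wt α i ≤ ‖d (α i)‖
  upper : ∀ i, 0 ≤ i → ‖d (α i)‖ ≤ Real.exp (geomSum q + geomSum q / (1 - q)) * q ^ wt α i
  zero : ∀ n, n ∉ Set.range α → d n = 0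

theorem exists_between_of_strictMono {α : ℤ → ℤ} (hα : StrictMono α) {n : ℤ} (hn : n ∉ Set.range α) :
    ∃ i, α i < n ∧ n < α (i + 1) := by
  have hge : ∀ i : ℕ, α 0 + i ≤ α i := fun i => by
    induction i with
    | zero => simp
    | succ i ih =>
      have := hα (show (i : ℤ) < ((i + 1 : ℕ) : ℤ) by omega)
      push_cast at this ⊢
      omega
  have hle : ∀ i : ℕ, α (-(i : ℤ)) ≤ α 0 - i := fun i => by
    induction i with
    | zero => simp
    | succ i ih =>
      have := hα (show -((i + 1 : ℕ) : ℤ) < -(i : ℤ) by omega)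
      push_cast at this ⊢
      omega
  have hbdd : ∃ b : ℤ, ∀ z : ℤ, α z ≤ n → z ≤ b := by
    refine ⟨((n - α 0).natAbs : ℕ) + 1, fun z hz => ?_⟩
    by_contra hcon
    push Not at hcon
    have h1 := hge ((n - α 0).natAbs + 1)
    have h2 := hα hcon
    rw [Nat.cast_add, Nat.cast_one] at h1
    omega
  have hinh : ∃ z : ℤ, α z ≤ n := ⟨-((n - α 0).natAbs : ℕ), by
    have := hle (n - α 0).natAbs
    omega⟩
  obtain ⟨i, h1, h2⟩ := Int.exists_greatest_of_bdd hbdd hinh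
  refine ⟨i, lt_of_le_of_ne h1 fun h => hn ⟨i, h⟩, ?_⟩
  by_contra hcon
  push Not at hcon
  have := h2 (i + 1) hcon
  omega

/-- A bounded integer sequence is eventually constant along an ultrafilter; the coefficient bounds
and the gaps then pass to the limit. -/
theorem exists_limitPoint (hq0 : 0 < q) (hq1 : q < 1) (h : CoefLimit q t B M d) (U : Ultrafilter ℕ)
    (hU : (U : Filter ℕ) ≤ atTop) :
    ∃ α, IsLimitPoint q d α ∧ ∀ i, ∀ᶠ m in (U : Filter ℕ), node (t m) i = α i := by
  have h1 : ∀ i, ∃ v, ∀ᶠ m in (U : Filter ℕ), node (t m) i = v := by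
    intro i
    obtain ⟨n, hn⟩ := h.exists_node_bound hq0 hq1 i
    have h2 : (⋃ v ∈ Set.Icc (-(n : ℤ)) n, {m | node (t m) i = v}) ∈ U := by
      filter_upwards [hU hn] with m hm
      simp only [Set.mem_iUnion]
      exact ⟨node (t m) i, abs_le.1 hm, rfl⟩
    obtain ⟨v, -, hv⟩ := (Ultrafilter.finite_biUnion_mem_iff (Set.finite_Icc _ _)).1 h2
    exact ⟨v, hv⟩
  choose α hα using h1
  have hlim : ∀ n, Tendsto (fun m => lcoef q (t m) (B m) (M m) n) U (𝓝 (d n)) := fun n =>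
    (h.lim n).mono_left hU
  have hmono : StrictMono α := by
    intro i j hij
    have h2 : ∀ᶠ m in (U : Filter ℕ), α i < α j := by
      filter_upwards [hα i, hα j, hU h.mono, hU (h.eventually_mem i), hU (h.eventually_mem j)]
        with m h3 h4 h5 h6 h7
      have := node_sub_le h5 h6.1 h7.1 hij.le
      omega
    exact h2.exists.choose_spec
  have hwt : ∀ i, ∀ᶠ m in (U : Filter ℕ), wt (node (t m)) i = wt α i := by
    intro i
    filter_upwards [hα i, (Finset.eventually_all (Finset.Ico 0 i)).2 fun a _ => hα a,
      (Finset.eventually_all (Finset.Ioc i 0)).2 fun a _ => hα a] with m h2 h3 h4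
    rw [wt, wt, h2]
    congr 1
    · exact Finset.sum_congr rfl fun a ha => by rw [h3 a ha]
    · exact Finset.sum_congr rfl fun a ha => by rw [h4 a ha]
  refine ⟨α, ⟨hmono, fun i => ?_, fun i hi => ?_, fun n hn => ?_⟩, hα⟩
  · refine ge_of_tendsto (hlim (α i)).norm ?_
    filter_upwards [hα i, hwt i, hU h.mono, hU (h.eventually_mem i)] with m h2 h3 h4 h5
    rw [← h2, lcoef_node q h4 h5.1, ← h3]
    exact le_norm_wcoef hq0 hq1 h5.2 h4 h5.1
  · refine le_of_tendsto (hlim (α i)).norm ?_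
    filter_upwards [hα i, hwt i, hU h.mono, hU (h.eventually_mem i)] with m h2 h3 h4 h5
    rw [← h2, lcoef_node q h4 h5.1, ← h3]
    exact norm_wcoef_le hq0 hq1 h5.2 h4 hi h5.1
  · obtain ⟨i, h2, h3⟩ := exists_between_of_strictMono hmono hn
    refine tendsto_nhds_unique (hlim n) (tendsto_nhds_of_eventually_eq ?_)
    filter_upwards [hα i, hα (i + 1), hU h.mono, hU (h.eventually_mem i), hU (h.eventually_mem (i + 1))]
      with m h4 h5 h6 h7 h8
    exact lcoef_eq_zero q h6 h7.1 h8.1 (by omega) (by omega)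

theorem IsLimitPoint.range_eq (hq0 : 0 < q) {α : ℤ → ℤ} (h : IsLimitPoint q d α) :
    Set.range α = {n | d n ≠ 0} := by
  ext n
  constructor
  · rintro ⟨i, rfl⟩
    exact norm_pos_iff.1 ((zpow_pos hq0 _).trans_le (h.lower i))
  · intro hn
    by_contra hcon
    exact hn (h.zero n hcon)

/-- The change of enumeration is an order automorphism of `ℤ`, hence commutes with the successor and
is a translation. -/
theorem exists_shift_of_range_eq {α β : ℤ → ℤ} (hα : StrictMono α) (hβ : StrictMono β)
    (h : Set.range α = Set.range β) : ∃ s, ∀ i, β i = α (i + s) := by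
  have h1 : ∀ i, ∃ j, α j = β i := fun i => by
    have : β i ∈ Set.range α := h ▸ Set.mem_range_self i
    exact this
  choose f hf using h1
  have hfm : StrictMono f := fun i j hij => hα.lt_iff_lt.1 (by rw [hf, hf]; exact hβ hij)
  have hfs : Function.Surjective f := fun j => by
    have : α j ∈ Set.range β := h ▸ Set.mem_range_self j
    obtain ⟨i, hi⟩ := this
    exact ⟨i, hα.injective (by rw [hf, hi])⟩
  have hstep : ∀ i, f (i + 1) = f i + 1 := fun i => by
    have := (hfm.orderIsoOfSurjective f hfs).map_succ i
    simpa [Int.succ_eq_succ, Int.succ] using this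
  refine ⟨f 0, fun i => ?_⟩
  have h2 : f i = i + f 0 := by
    induction i using Int.induction_on with
    | zero => simp
    | succ i ih => rw [hstep, ih]; ring
    | pred i ih =>
      have := hstep (-(i : ℤ) - 1)
      rw [sub_add_cancel, ih] at this
      omega
  rw [← h2, hf]

/-- For `s > 0` the weight of the same exponent, computed with `α`, contains at least the extra term
`α_(i+s) - α_0 ≥ i`. The lower bound from `β` and the upper bound from `α` would give `1 ≤ E q^i`
for every `i`. Only large positive `i` are used, so the upper bound is not needed for negative
indices. -/
theorem IsLimitPoint.shift_nonpos (hq0 : 0 < q) (hq1 : q < 1) {α β : ℤ → ℤ} (hα : IsLimitPoint q d α)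
    (hβ : IsLimitPoint q d β) {s : ℤ} (hs : ∀ i, β i = α (i + s)) : s ≤ 0 := by
  by_contra hcon
  push Not at hcon
  set E := Real.exp (geomSum q + geomSum q / (1 - q)) with hE
  have hEpos : 0 < E := Real.exp_pos _
  have key : ∀ i : ℕ, 1 ≤ E * q ^ i := by
    intro i
    have h1 : q ^ wt β i ≤ E * q ^ wt α (i + s) := by
      have h0 := hβ.lower i
      rw [hs i] at h0
      exact h0.trans (hα.upper (i + s) (by omega))
    have h2 : wt β i + i ≤ wt α (i + s) := by
      rw [wt, wt, Finset.Ioc_eq_empty (by omega), Finset.Ioc_eq_empty (by omega), Finset.sum_empty,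
        Finset.sum_empty, add_zero, add_zero]
      have h3 : ∑ m ∈ Finset.Ico 0 (i : ℤ), (β i - β m) = ∑ m ∈ Finset.Ico s (i + s), (α (i + s) - α m) := by
        refine Finset.sum_bij (fun m _ => m + s) ?_ ?_ ?_ ?_
        · intro m hm
          rw [Finset.mem_Ico] at hm ⊢
          omega
        · intro m _ m' _ h
          omega
        · intro m hm
          rw [Finset.mem_Ico] at hm
          exact ⟨m - s, Finset.mem_Ico.2 (by omega), by ring⟩
        · intro m _
          rw [hs, hs]
      have h4 : insert 0 (Finset.Ico s ((i : ℤ) + s)) ⊆ Finset.Ico 0 ((i : ℤ) + s) := by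
        intro m hm
        rw [Finset.mem_insert, Finset.mem_Ico] at hm
        rw [Finset.mem_Ico]
        omega
      have h5 := Finset.sum_le_sum_of_subset_of_nonneg (f := fun m => α (i + s) - α m) h4 fun m hm _ => by
        have := hα.mono (Finset.mem_Ico.1 hm).2
        omega
      rw [Finset.sum_insert (by rw [Finset.mem_Ico]; omega)] at h5
      have h6 : (i : ℤ) ≤ α (i + s) - α 0 := by
        have h7 : ∀ j : ℕ, α 0 + j ≤ α j := fun j => by
          induction j with
          | zero => simp
          | succ j ih =>
            have := hα.mono (show (j : ℤ) < ((j + 1 : ℕ) : ℤ) by omega)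
            push_cast at this ⊢
            omega
        have h8 := h7 i
        have h9 := hα.mono (show (i : ℤ) < i + s by omega)
        omega
      rw [h3]
      omega
    have h10 : q ^ wt α (i + s) ≤ q ^ wt β i * q ^ i := by
      rw [← zpow_natCast, ← zpow_add₀ hq0.ne']
      exact zpow_le_zpow_right_of_le_one₀ hq0 hq1.le h2
    have h11 := h1.trans (mul_le_mul_of_nonneg_left h10 hEpos.le)
    have h12 := zpow_pos hq0 (wt β i)
    refine le_of_mul_le_mul_left (h11.trans' ?_ |>.trans (le_of_eq ?_)) h12
    · rw [mul_one]
    · ring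
  have h1 := (tendsto_pow_atTop_nhds_zero_of_lt_one hq0.le hq1).const_mul E
  rw [mul_zero] at h1
  have := ge_of_tendsto' h1 key
  linarith

theorem IsLimitPoint.unique (hq0 : 0 < q) (hq1 : q < 1) {α β : ℤ → ℤ} (hα : IsLimitPoint q d α)
    (hβ : IsLimitPoint q d β) : α = β := by
  obtain ⟨s, hs⟩ := exists_shift_of_range_eq hα.mono hβ.mono
    ((hα.range_eq hq0).trans (hβ.range_eq hq0).symm)
  have h1 := hα.shift_nonpos hq0 hq1 hβ hs
  have h2 := hβ.shift_nonpos hq0 hq1 hα (s := -s) fun i => by rw [hs]; congr 1; ring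
  have h3 : s = 0 := by omega
  funext i
  rw [hs, h3, add_zero]

/-- All ultrafilters finer than `atTop` give the same limit point, so the whole sequence converges.
-/
theorem exists_limit (hq0 : 0 < q) (hq1 : q < 1) (h : CoefLimit q t B M d) :
    ∃ τ : ℤ → ℤ, Monotone τ ∧ ∀ i, Tendsto (fun m => t m i) atTop (𝓝 (τ i)) := by
  obtain ⟨α, hα, -⟩ := h.exists_limitPoint hq0 hq1 (Ultrafilter.of atTop) (Ultrafilter.of_le _)
  refine ⟨fun i => α i - i + 1, ?_, fun i => ?_⟩
  · refine monotone_int_of_le_succ fun i => ?_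
    have := hα.mono (lt_add_one i)
    omega
  · rw [tendsto_iff_ultrafilter]
    intro U hU
    obtain ⟨β, hβ, hlim⟩ := h.exists_limitPoint hq0 hq1 U hU
    rw [hα.unique hq0 hq1 hβ]
    refine tendsto_nhds_of_eventually_eq ?_
    filter_upwards [hlim i] with m hm
    rw [← hm, node]
    ring

end CoefLimit

/-- Convergence in one variable implies the convergence of the rows. -/
theorem exists_stabilizes {q : ℝ} (hq0 : 0 < q) (hq1 : q < 1) {b : ℕ → ℕ} (hb : Tendsto b atTop atTop)
    (hM : Tendsto (fun N : ℕ => (N : ℤ) - (b N : ℤ)) atTop atTop) {lam : ∀ N : ℕ, Fin N → ℤ}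
    (hlam : ∀ N, Antitone (lam N)) {F : (Fin 1 → ℂ) → ℂ} (h : ConvergesTo q b lam 1 F) :
    ∃ t : ℤ → ℤ, Monotone t ∧ Stabilizes b lam t := by
  obtain ⟨ρ, hρ, -⟩ := exists_goodRadius q zero_lt_one le_rfl
  have hlim : ∀ z : ℂ, ∃ y, ‖z‖ = ρ → Tendsto (fun N => laurentSum q
      (nodes (rowSeq (lam N) (b N)) (b N) (N - b N)) (b N) z) atTop (𝓝 y) := by
    intro z
    by_cases hz : ‖z‖ = ρ
    · obtain ⟨y, hy⟩ := h.tendsto_laurentSum hq0 hq1 hb hM hlam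
        (notMem_badSet_of_norm hq0 (x := z) (by rwa [hz]))
      exact ⟨y, fun _ => hy⟩
    · exact ⟨0, fun h0 => absurd h0 hz⟩
  choose G hG using hlim
  have hd := fun n => tendsto_lcoef hρ.1 (h.laurentSum_bounded hq0 hq1 hM hlam hρ) hG n
  choose d hd using hd
  have hc : CoefLimit q (fun N => rowSeq (lam N) (b N)) b (fun N => N - b N) d :=
    { hB := hb
      hM := StableRows.tendsto_sub hM 0
      mono := by
        filter_upwards [StableRows.eventually_add_le hM 0] with N hN
        exact monotoneOn_rowSeq' (hlam N) hN
      bdd := fun σ hσ => by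
        obtain ⟨C, hC⟩ := h.laurentSum_bounded hq0 hq1 hM hlam hσ
        refine ⟨C, ?_⟩
        filter_upwards [hC] with N hN n
        exact norm_lcoef_le q _ _ _ hσ.1 hN n
      lim := hd }
  exact hc.exists_limit hq0 hq1

end
end QSchur

/-! ### The theorem -/

theorem mainTheorem2 (q : ℝ) (hq0 : 0 < q) (hq1 : q < 1) :
    -- the limit functions are well defined
    (∀ t : ℤ → ℤ, Monotone t →
      (∀ x ∈ QSchur.formulaDomain q, QSchur.IntegralConverges q t x) ∧
      AnalyticOnNhd ℂ (QSchur.Phi q t) {0}ᶜ ∧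
      Set.EqOn (QSchur.Phi q t) (QSchur.phiFormula q t) (QSchur.formulaDomain q) ∧
      ∀ k : ℕ, 1 ≤ k →
        DifferentiableOn ℂ (QSchur.PhiMulti q t k) (QSchur.torus k) ∧
        Set.EqOn (QSchur.PhiMulti q t k) (QSchur.phiDet q t) (QSchur.regularTorus k)) ∧
    ∀ b : ℕ → ℕ, Tendsto b atTop atTop →
      Tendsto (fun N : ℕ => (N : ℤ) - (b N : ℤ)) atTop atTop →
      ∀ lam : (∀ N : ℕ, Fin N → ℤ), (∀ N, Antitone (lam N)) →
        -- the direct statement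
        (∀ t : ℤ → ℤ, Monotone t → QSchur.Stabilizes b lam t →
          ∀ k : ℕ, 1 ≤ k → QSchur.ConvergesTo q b lam k (QSchur.PhiMulti q t k)) ∧
        -- the converse statement
        ((∀ k : ℕ, 1 ≤ k → ∃ F : (Fin k → ℂ) → ℂ, QSchur.ConvergesTo q b lam k F) →
          ∃ t : ℤ → ℤ, Monotone t ∧ QSchur.Stabilizes b lam t ∧
            ∀ k : ℕ, 1 ≤ k → QSchur.ConvergesTo q b lam k (QSchur.PhiMulti q t k)) := by
  refine ⟨fun t ht => ⟨fun x hx => ?_, ?_, QSchur.Phi_eqOn hq0 hq1 ht, fun k _ =>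
    ⟨QSchur.PhiMulti_differentiableOn hq0 hq1 ht k, QSchur.PhiMulti_eqOn hq0 hq1 ht k⟩⟩,
    fun b hb hM lam hlam => ⟨fun t ht hs k _ =>
      QSchur.convergesTo_PhiMulti hq0 hq1 ht ⟨hb, hM, hlam, hs⟩ k, fun hF => ?_⟩⟩
  · exact QSchur.integralConverges hq0 hq1 ht
      (QSchur.ne_zero_of_notMem_badSet (QSchur.formulaDomain_notMem_badSet hx))
  · exact (QSchur.Phi_differentiableOn hq0 hq1 ht).analyticOnNhd isOpen_compl_singleton
  · obtain ⟨F, hF1⟩ := hF 1 le_rfl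
    obtain ⟨t, ht, hs⟩ := QSchur.exists_stabilizes hq0 hq1 hb hM hlam hF1
    exact ⟨t, ht, hs, fun k _ => QSchur.convergesTo_PhiMulti hq0 hq1 ht ⟨hb, hM, hlam, hs⟩ k⟩
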